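/- Let $N\ge 2$, $1<p<N$, let $\Omega\subset\mathbb R^N$ be open and bounded, and consider $$-\operatorname{div}\,a(x,u,\nabla u)=h(u)f\ \text{ in }\Omega,\qquad u\ge 0\ \text{ in }\Omega,\qquad u=0\ \text{ on }\partial\Omega. \tag{P}$$ **Assumptions.** $a:\Omega\times\mathbb R\times\mathbb R^N\to\mathbb R^N$ is a Carathéodory function such that, for almost every $x\in\Omega$ and all $s\in\mathbb R$, $\xi\in\mathbb R^N$, $$a(x,s,\xi)\cdot\xi\ge b(s)|\xi|^p,\qquad |a(x,s,\xi)|\le\beta\big(\ell(x)+|s|^{p-1}+|\xi|^{p-1}\big),$$ where $\beta>0$, $0\le\ell\in L^{p/(p-1)}(\Omega)$, and $b:\mathbb R\to\mathbb R$ is continuous and bounded with $b(s)\ge\alpha(1+|s|)^{-\theta(p-1)}$ for some $\alpha>0$, $\theta\ge 0$. The function $h:[0,\infty)\to[0,\infty]$ is continuous and finite outside the origin, and there are $\gamma_2\ge 0$ and $c_2,s_2>0$ with $h(s)\le c_2s^{-\gamma_2}$ for $s\ge s_2$. The datum $f$ is nonnegative almost everywhere. **Notation.** $T_k(s)=\max(-k,\min(s,k))$.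 If $T_k(u)\in W^{1,1}_{\rm loc}(\Omega)$ for every $k>0$, then $\nabla u$ denotes the a.e. unique measurable $v$ with $\nabla T_k(u)=v\chi_{\{|u|\le k\}}$ a.e. for every $k>0$. In products, $\infty\cdot 0=0$. A measurable, a.e. nonnegative, a.e. finite $u$ is an *entropy solution* of (P) if, for every $k>0$, $T_k(u)\in W^{1,p}_0(\Omega)$ and $a(x,T_k(u),\nabla T_k(u))\in L^{p/(p-1)}(\Omega)^N$, and if, for every $k>0$ and $\varphi\in W^{1,p}_0(\Omega)\cap L^\infty(\Omega)$, $h(u)fT_k(u-\varphi)\in L^1(\Omega)$ and $$\int_\Omega a(x,u,\nabla u)\cdot\nabla T_k(u-\varphi)\le\int_\Omega h(u)f\,T_k(u-\varphi).$$ A measurable, a.e. nonnegative $u$ is a *distributional solution* of (P) if $T_k(u)\in W^{1,1}_0(\Omega)$ for every $k>0$, $a(x,u,\nabla u)\in L^1_{\rm loc}(\Omega)^N$, $h(u)f\in L^1_{\rm loc}(\Omega)$, and $\int_\Omega a(x,u,\nabla u)\cdot\nabla\varphi=\int_\Omega h(u)f\varphi$ for all $\varphi\in C^1_c(\Omega)$.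 Put $$\theta_*(N,p,\gamma_2)=\frac1{N-p+1}+\frac{\gamma_2}{p-1},\qquad m_*(N,p,\theta,\gamma_2)=\max\left(\frac{N(p-1)}{(N(1-\theta)+1+\theta(p-1))(p-1)+\gamma_2(N-p+1)},\,1\right).$$ **Statement.** (1) Let $0\le\theta\le 1+\frac{\gamma_2}{p-1}$ and let $f\in L^m(\Omega)$, where $m\ge m_*$ if $\theta\ne\theta_*$, and $m>1$ if $\theta=\theta_*$. Then every entropy solution of (P) is also a distributional solution of (P). (2) For $0\le\theta\le 1+\frac{\gamma_2}{p-1}$ one has $m_*=1$ if and only if $\theta\le\theta_*$. (3) (Radial example, $p=2$.) Let $N\ge3$, $\Omega=B_1(0)$, $\gamma_2\ge 0$, $0\le\theta<1+\gamma_2$, $0<\varepsilon<N-2$. Then $a(x,s,\xi)=\xi/(1+|s|)^{\theta}$ and $h(s)=(1+s)^{-\gamma_2}$ satisfy the assumptions above, $a$ is strictly monotone in $\xi$, and there is $C>0$ such that, with $f(x)=C|x|^{-(N-\varepsilon)}$, the function $$u(x)=|x|^{\frac{2+\varepsilon-N}{1-\theta+\gamma_2}}-1$$ is an entropy solution of (P).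 For $m\ge1$, $f\in L^m(\Omega)$ if and only if $m<\frac N{N-\varepsilon}$. Moreover $u\in W^{1,1}_0(\Omega)$ if and only if $\theta<\frac{1+\varepsilon}{N-1}+\gamma_2$. (4) (Optimality of the threshold, $p=2$.) Let $N\ge3$, $\Omega=B_1(0)$, $\gamma_2\ge0$, $\theta_*(N,2,\gamma_2)<\theta<1+\gamma_2$ and $1\le m<m_*(N,2,\theta,\gamma_2)$. Then there are $a$ and $h$ satisfying the assumptions above, with $a$ strictly monotone in $\xi$, a nonnegative $f\in L^m(\Omega)$, and an entropy solution of (P) which is not a distributional solution of (P). -/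

import Mathlib

open MeasureTheory Set Filter Topology
open scoped ENNReal ContDiff

noncomputable section

namespace EntropyDistributional

/-- The Euclidean space `ℝ^N`. -/
abbrev Euc (N : ℕ) : Type := EuclideanSpace ℝ (Fin N)

variable {N : ℕ}

/-- The truncation `T_k(s) = max(-k, min(s, k))`. -/
def trunc (k s : ℝ) : ℝ := max (-k) (min s k)

/-! ### Weak gradients and Sobolev spaces -/

/-- `C^r_c(Ω)`: functions of class `C^r` with compact support contained in `Ω`. -/
structure IsTestFunction (r : WithTop ℕ∞) (Ω : Set (Euc N)) (φ : Euc N → ℝ) : Prop where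
  contDiff : ContDiff ℝ r φ
  hasCompactSupport : HasCompactSupport φ
  tsupport_subset : tsupport φ ⊆ Ω

/-- `w ∈ W^{1,1}_loc(Ω)` and `G` is its weak (distributional) gradient in `Ω`. -/
structure HasWeakGrad (Ω : Set (Euc N)) (w : Euc N → ℝ) (G : Euc N → Euc N) : Prop where
  locallyIntegrable : LocallyIntegrableOn w Ω
  locallyIntegrable_grad : LocallyIntegrableOn G Ω
  integral_eq : ∀ φ : Euc N → ℝ, IsTestFunction ∞ Ω φ →
    ∫ x in Ω, w x • gradient φ x = - ∫ x in Ω, φ x • G x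

open Classical in
/-- The weak gradient of `w ∈ W^{1,1}_loc(Ω)`; it is unique up to a null set.
(The value `0` is used for functions which are not in `W^{1,1}_loc(Ω)`.) -/
def weakGrad (Ω : Set (Euc N)) (w : Euc N → ℝ) : Euc N → Euc N :=
  if hw : ∃ G, HasWeakGrad Ω w G then hw.choose else 0

/-- `w ∈ W^{1,q}_0(Ω)`: both `w` and its weak gradient are in `L^q(Ω)`, and `w` is the limit,
in the norm of `W^{1,q}(Ω)`, of a sequence in `C^∞_c(Ω)`. -/
def MemW0 (Ω : Set (Euc N)) (q : ℝ) (w : Euc N → ℝ) : Prop :=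
  ∃ G : Euc N → Euc N, HasWeakGrad Ω w G ∧
    MemLp w (ENNReal.ofReal q) (volume.restrict Ω) ∧
    MemLp G (ENNReal.ofReal q) (volume.restrict Ω) ∧
    ∃ η : ℕ → Euc N → ℝ, (∀ n, IsTestFunction ∞ Ω (η n)) ∧
      Tendsto (fun n => eLpNorm (fun x => η n x - w x) (ENNReal.ofReal q) (volume.restrict Ω))
        atTop (𝓝 0) ∧
      Tendsto (fun n => eLpNorm (fun x => gradient (η n) x - G x) (ENNReal.ofReal q)
        (volume.restrict Ω)) atTop (𝓝 0)

/-- `v` is the generalized gradient of `u`: `v` is measurable and, for every `k > 0`,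
`T_k(u) ∈ W^{1,1}_loc(Ω)` with `∇ T_k(u) = v χ_{|u| ≤ k}` almost everywhere. -/
structure IsGenGrad (Ω : Set (Euc N)) (u : Euc N → ℝ) (v : Euc N → Euc N) : Prop where
  aestronglyMeasurable : AEStronglyMeasurable v (volume.restrict Ω)
  hasWeakGrad : ∀ k : ℝ, 0 < k →
    HasWeakGrad Ω (fun x => trunc k (u x)) ({x | |u x| ≤ k}.indicator v)

open Classical in
/-- The generalized gradient `∇u` of a measurable function `u` all of whose truncations are in
`W^{1,1}_loc(Ω)`; for such `u` it exists and is unique up to a null set.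
(The value `0` is used for all other functions.) -/
def genGrad (Ω : Set (Euc N)) (u : Euc N → ℝ) : Euc N → Euc N :=
  if hu : ∃ v, IsGenGrad Ω u v then hu.choose else 0

/-! ### The data of the problem `-div a(x,u,∇u) = h(u) f`, `u ≥ 0` in `Ω`, `u = 0` on `∂Ω` -/

/-- The standing assumptions on the principal part: `a : Ω × ℝ × ℝ^N → ℝ^N` is a Carathéodory
function, `a(x,s,ξ)·ξ ≥ b(s)|ξ|^p` for a continuous bounded `b` with
`b(s) ≥ α / (1+|s|)^{θ(p-1)}`, `α > 0`, and `|a(x,s,ξ)| ≤ β (ℓ(x) + |s|^{p-1} + |ξ|^{p-1})`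
with `β > 0` and `0 ≤ ℓ ∈ L^{p/(p-1)}(Ω)`. -/
structure IsAdmissibleOperator (Ω : Set (Euc N)) (p θ : ℝ)
    (a : Euc N → ℝ → Euc N → Euc N) : Prop where
  measurable : ∀ (s : ℝ) (ξ : Euc N), AEMeasurable (fun x => a x s ξ) (volume.restrict Ω)
  continuous : ∀ᵐ x ∂(volume.restrict Ω), Continuous (fun z : ℝ × Euc N => a x z.1 z.2)
  coercive : ∃ b : ℝ → ℝ, Continuous b ∧ (∃ B : ℝ, ∀ s, |b s| ≤ B) ∧
    (∃ α : ℝ, 0 < α ∧ ∀ s, α / (1 + |s|) ^ (θ * (p - 1)) ≤ b s) ∧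
    ∀ᵐ x ∂(volume.restrict Ω), ∀ (s : ℝ) (ξ : Euc N), b s * ‖ξ‖ ^ p ≤ inner ℝ (a x s ξ) ξ
  growth : ∃ (β : ℝ) (ℓ : Euc N → ℝ), 0 < β ∧ (∀ᵐ x ∂(volume.restrict Ω), 0 ≤ ℓ x) ∧
    MemLp ℓ (ENNReal.ofReal (p / (p - 1))) (volume.restrict Ω) ∧
    ∀ᵐ x ∂(volume.restrict Ω), ∀ (s : ℝ) (ξ : Euc N),
      ‖a x s ξ‖ ≤ β * (ℓ x + |s| ^ (p - 1) + ‖ξ‖ ^ (p - 1))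

/-- Strict monotonicity of the principal part in the gradient variable. -/
def IsStrictlyMonotone (Ω : Set (Euc N)) (a : Euc N → ℝ → Euc N → Euc N) : Prop :=
  ∀ᵐ x ∂(volume.restrict Ω), ∀ (s : ℝ) (ξ ξ' : Euc N), ξ ≠ ξ' →
    0 < inner ℝ (a x s ξ - a x s ξ') (ξ - ξ')

/-- The assumptions on `h : [0,∞) → [0,∞]`: it is continuous and finite outside the origin, and
`h(s) ≤ c₂ / s^{γ₂}` for `s ≥ s₂`, with `c₂, s₂ > 0`.  The values of `h` at negative
arguments play no role. -/
structure IsAdmissibleSource (γ₂ : ℝ) (h : ℝ → ℝ≥0∞) : Prop where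
  continuousOn : ContinuousOn h (Ioi 0)
  finite : ∀ s : ℝ, 0 < s → h s ≠ ⊤
  decay : ∃ c₂ s₂ : ℝ, 0 < c₂ ∧ 0 < s₂ ∧ ∀ s : ℝ, s₂ ≤ s → h s ≤ ENNReal.ofReal (c₂ / s ^ γ₂)

/-- The right-hand side `h(u) f ∈ [0,∞]`, with the convention `∞ · 0 = 0`. -/
def rhs (h : ℝ → ℝ≥0∞) (f u : Euc N → ℝ) (x : Euc N) : ℝ≥0∞ :=
  h (u x) * ENNReal.ofReal (f x)

/-! ### The two notions of solution -/

/-- Entropy solutions.  The second integrability condition says that `h(u) f T_k(u - φ)`, with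
the convention `∞ · 0 = 0`, is almost everywhere finite and belongs to `L^1(Ω)`. -/
structure IsEntropySolution (Ω : Set (Euc N)) (p : ℝ) (a : Euc N → ℝ → Euc N → Euc N)
    (h : ℝ → ℝ≥0∞) (f u : Euc N → ℝ) : Prop where
  aemeasurable : AEMeasurable u (volume.restrict Ω)
  nonneg : ∀ᵐ x ∂(volume.restrict Ω), 0 ≤ u x
  trunc_mem : ∀ k : ℝ, 0 < k → MemW0 Ω p (fun x => trunc k (u x))
  flux_memLp : ∀ k : ℝ, 0 < k →
    MemLp (fun x => a x (trunc k (u x)) (weakGrad Ω (fun y => trunc k (u y)) x))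
      (ENNReal.ofReal (p / (p - 1))) (volume.restrict Ω)
  rhs_integrable : ∀ (k : ℝ) (φ : Euc N → ℝ), 0 < k → MemW0 Ω p φ →
    MemLp φ ⊤ (volume.restrict Ω) →
      (∀ᵐ x ∂(volume.restrict Ω), rhs h f u x = ⊤ → trunc k (u x - φ x) = 0) ∧
      IntegrableOn (fun x => (rhs h f u x).toReal * trunc k (u x - φ x)) Ω
  entropy_le : ∀ (k : ℝ) (φ : Euc N → ℝ), 0 < k → MemW0 Ω p φ →
    MemLp φ ⊤ (volume.restrict Ω) →
      ∫ x in Ω, inner ℝ (a x (u x) (genGrad Ω u x))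
          (weakGrad Ω (fun y => trunc k (u y - φ y)) x)
        ≤ ∫ x in Ω, (rhs h f u x).toReal * trunc k (u x - φ x)

/-- Distributional solutions. -/
structure IsDistributionalSolution (Ω : Set (Euc N)) (a : Euc N → ℝ → Euc N → Euc N)
    (h : ℝ → ℝ≥0∞) (f u : Euc N → ℝ) : Prop where
  aemeasurable : AEMeasurable u (volume.restrict Ω)
  nonneg : ∀ᵐ x ∂(volume.restrict Ω), 0 ≤ u x
  trunc_mem : ∀ k : ℝ, 0 < k → MemW0 Ω 1 (fun x => trunc k (u x))
  flux_locallyIntegrable : LocallyIntegrableOn (fun x => a x (u x) (genGrad Ω u x)) Ω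
  rhs_finite : ∀ᵐ x ∂(volume.restrict Ω), rhs h f u x ≠ ⊤
  rhs_locallyIntegrable : LocallyIntegrableOn (fun x => (rhs h f u x).toReal) Ω
  integral_eq : ∀ φ : Euc N → ℝ, IsTestFunction 1 Ω φ →
    ∫ x in Ω, inner ℝ (a x (u x) (genGrad Ω u x)) (gradient φ x)
      = ∫ x in Ω, (rhs h f u x).toReal * φ x

/-! ### The summability threshold -/

/-- The critical value `1/(N-p+1) + γ₂/(p-1)` of `θ`. -/
def criticalTheta (N : ℕ) (p γ₂ : ℝ) : ℝ := 1 / ((N : ℝ) - p + 1) + γ₂ / (p - 1)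

/-- The threshold
`max (N(p-1) / ((N(1-θ)+1+θ(p-1))(p-1) + γ₂(N-p+1)), 1)` for the summability of `f`. -/
def threshold (N : ℕ) (p θ γ₂ : ℝ) : ℝ :=
  max ((N : ℝ) * (p - 1) /
    (((N : ℝ) * (1 - θ) + 1 + θ * (p - 1)) * (p - 1) + γ₂ * ((N : ℝ) - p + 1))) 1

/-! ### The radial example -/

/-- The model operator `a(x,s,ξ) = ξ / (1+|s|)^θ` (here `p = 2`). -/
def modelOperator (N : ℕ) (θ : ℝ) (_x : Euc N) (s : ℝ) (ξ : Euc N) : Euc N :=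
  ((1 + |s|) ^ θ)⁻¹ • ξ

/-- The model nonlinearity `h(s) = (1+s)^{-γ₂}`. -/
def modelSource (γ₂ : ℝ) (s : ℝ) : ℝ≥0∞ := ENNReal.ofReal (((1 + s) ^ γ₂)⁻¹)

/-- The radial datum `f(x) = C / |x|^{N-ε}`. -/
def radialDatum (N : ℕ) (C ε : ℝ) (x : Euc N) : ℝ := C / ‖x‖ ^ ((N : ℝ) - ε)

/-- The radial function `u(x) = |x|^α - 1` with `α = (2+ε-N)/(1-θ+γ₂)`. -/
def radialSolution (N : ℕ) (θ γ₂ ε : ℝ) (x : Euc N) : ℝ :=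
  ‖x‖ ^ ((2 + ε - (N : ℝ)) / (1 - θ + γ₂)) - 1

end EntropyDistributional

end

/-! Passing from entropy to distributional solutions is a matter of integrability. If |∇u|^{p-1} and
u^{p-1} are in L^1(Ω), the growth condition puts a(x,u,∇u) in L^1(Ω). The entropy inequality can
then be tested with φ = T_j(u) - ψ: the contribution of ∇u on {u > j} has a sign and is dropped, and
j → ∞ gives ∫ a·∇ψ ≤ ∫ h(u) f ψ. Using ψ and -ψ gives equality
(`IsEntropySolution.integral_flux_gradient_le`).

The integrability comes from dyadic slices. Testing with φ = T_j(u), k = j, gives ∫_{j<u≤2j} |∇u|^p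
≤ C j^{1+θ(p-1)-γ₂} ∫_{u>j} f (`slice_energy_le`). Multiply by t^{ρp}, t = t₀2^i, and sum; let Y be
the weighted energy. The Sobolev inequality on each slice gives (∑ t^r |{u>2t}|)^e ≤ C Y, where e =
(N-p)/N and re = ρp+p. Young's inequality bounds |∇u|^{p-1} on a slice by t^{ρp}|∇u|^p + t^r if also
r = -ρp(p-1). These two conditions fix ρp = -N/(N-p+1) and r = N(p-1)/(N-p+1), and a bound on Y
suffices (`integrable_of_energy_bound`).

The energy estimate gives Y ≤ C ∑ t^κ ∫_{u>t} f with κ = (p-1)(θ-θ_*). If κ < 0 the series is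
geometric and f in L^1 is enough. If κ > 0, Hölder's inequality with exponent s = r/κ on the sum
returns ∑ t^r |{u>t}| to the power κ/r, times the norm of f over {u>t₀} in L^{s'}, where 1/s' =
1-κ/r = 1/m_*. The loop closes if κ/r ≤ e, which is exactly θ ≤ 1+γ₂/(p-1); in the equality case the
small tail of f absorbs it (`integrable_of_exponents`). For θ = θ_*, enlarge θ slightly, which only
weakens coercivity and costs m > 1.

For the examples u = |x|^α - 1 the truncated test function T_k(u-φ) has zero gradient near the
origin, so the singular flux can be cut off there and the divergence theorem turns the entropy
inequality into an equality (`isEntropySolution_norm_rpow_sub_one`). Optimality uses the same u with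
α = -(N-1), so that |∇u| is just not integrable. The model operator alone damps this through its
factor (1+u)^{-θ}. Adding a constant skew-symmetric map S to it keeps coercivity, monotonicity and
the divergence of the flux unchanged, but adds the term S∇u, which is not locally integrable for a
suitable S. -/

open MeasureTheory Set Filter Topology
open scoped ENNReal ContDiff
noncomputable section
namespace EntropyDistributional
variable {N : ℕ}

/-! ### Dominated convergence in L^q. -/

section

variable {α E : Type*} [MeasurableSpace α] {μ : Measure α} [NormedAddCommGroup E]

/-- Dominated convergence to zero in `L^q`. -/
theorem tendsto_eLpNorm_zero_of_dominated {q : ℝ≥0∞} (hq : q ≠ 0) (hq' : q ≠ ⊤)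
    {f : ℕ → α → E} {g : α → ℝ} (hf : ∀ n, AEStronglyMeasurable (f n) μ) (hg : MemLp g q μ)
    (hfg : ∀ n, ∀ᵐ x ∂μ, ‖f n x‖ ≤ g x)
    (hlim : ∀ᵐ x ∂μ, Tendsto (fun n => f n x) atTop (𝓝 0)) :
    Tendsto (fun n => eLpNorm (f n) q μ) atTop (𝓝 0) := by
  have hpos : 0 < q.toReal := ENNReal.toReal_pos hq hq'
  have key : Tendsto (fun n => ∫⁻ x, ‖f n x‖ₑ ^ q.toReal ∂μ) atTop (𝓝 (∫⁻ _, 0 ∂μ)) := by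
    refine tendsto_lintegral_of_dominated_convergence' (fun x => ‖g x‖ₑ ^ q.toReal)
      (fun n => (hf n).enorm.pow_const _) ?_ ?_ ?_
    · intro n
      filter_upwards [hfg n] with x hx
      gcongr
      rw [enorm_le_iff_norm_le]
      exact hx.trans (le_abs_self _)
    · exact (lintegral_rpow_enorm_lt_top_of_eLpNorm_lt_top hq hq' hg.2).ne
    · filter_upwards [hlim] with x hx
      have h1 : Tendsto (fun n => ‖f n x‖ₑ) atTop (𝓝 0) := by
        simpa [Function.comp_def] using (continuous_enorm.tendsto (0 : E)).comp hx
      have h2 := ((ENNReal.continuous_rpow_const (y := q.toReal)).tendsto 0).comp h1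
      simpa [ENNReal.zero_rpow_of_pos hpos, Function.comp_def] using h2
  rw [lintegral_zero] at key
  have h3 := ((ENNReal.continuous_rpow_const (y := 1 / q.toReal)).tendsto 0).comp key
  rw [ENNReal.zero_rpow_of_pos (by positivity)] at h3
  refine h3.congr fun n => ?_
  rw [eLpNorm_eq_lintegral_rpow_enorm_toReal hq hq']
  rfl

theorem tendsto_eLpNorm_sub_of_dominated {q : ℝ≥0∞} (hq : q ≠ 0) (hq' : q ≠ ⊤)
    {f : ℕ → α → E} {F : α → E} {g : α → ℝ} (hf : ∀ n, AEStronglyMeasurable (f n) μ)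
    (hg : MemLp g q μ) (hfg : ∀ n, ∀ᵐ x ∂μ, ‖f n x‖ ≤ g x)
    (hlim : ∀ᵐ x ∂μ, Tendsto (fun n => f n x) atTop (𝓝 (F x))) :
    MemLp F q μ ∧ Tendsto (fun n => eLpNorm (fun x => f n x - F x) q μ) atTop (𝓝 0) := by
  have hF : AEStronglyMeasurable F μ := aestronglyMeasurable_of_tendsto_ae atTop hf hlim
  have hFg : ∀ᵐ x ∂μ, ‖F x‖ ≤ g x := by
    filter_upwards [hlim, ae_all_iff.2 hfg] with x hx hx'
    exact le_of_tendsto hx.norm (Eventually.of_forall hx')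
  refine ⟨hg.mono' hF hFg, tendsto_eLpNorm_zero_of_dominated hq hq' (fun n => (hf n).sub hF)
    (hg.add hg) ?_ ?_⟩
  · intro n
    filter_upwards [hFg, hfg n] with x hx hx'
    exact (norm_sub_le _ _).trans (add_le_add hx' hx)
  · filter_upwards [hlim] with x hx
    simpa using hx.sub_const (F x)

end

/-! ### Gradients of test functions and the closure spaces W^{1,q}_0. -/

theorem IsTestFunction.continuous_gradient {r : WithTop ℕ∞} {Ω : Set (Euc N)} {φ : Euc N → ℝ}
    (hφ : IsTestFunction r Ω φ) (hr : 1 ≤ r) : Continuous (gradient φ) :=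
  (InnerProductSpace.toDual ℝ (Euc N)).symm.continuous.comp (hφ.contDiff.continuous_fderiv
    (by intro h; simp [h] at hr))

theorem IsTestFunction.hasCompactSupport_gradient {r : WithTop ℕ∞} {Ω : Set (Euc N)}
    {φ : Euc N → ℝ} (hφ : IsTestFunction r Ω φ) : HasCompactSupport (gradient φ) := by
  have h := hφ.hasCompactSupport.fderiv (𝕜 := ℝ)
  exact h.comp_left (g := (InnerProductSpace.toDual ℝ (Euc N)).symm) (map_zero _)

theorem norm_gradient_eq (φ : Euc N → ℝ) (x : Euc N) : ‖gradient φ x‖ = ‖fderiv ℝ φ x‖ := by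
  simp [gradient]

theorem gradient_comp {F : ℝ → ℝ} {f : Euc N → ℝ} {x : Euc N} (hF : DifferentiableAt ℝ F (f x))
    (hf : DifferentiableAt ℝ f x) :
    gradient (fun y => F (f y)) x = deriv F (f x) • gradient f x := by
  have := hF.hasDerivAt.comp_hasFDerivAt x hf.hasFDerivAt
  simp only [gradient]
  rw [show (fun y => F (f y)) = F ∘ f from rfl, this.fderiv]
  simp

theorem gradient_fun_add {f g : Euc N → ℝ} {x : Euc N} (hf : DifferentiableAt ℝ f x)
    (hg : DifferentiableAt ℝ g x) :
    gradient (fun y => f y + g y) x = gradient f x + gradient g x := by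
  simp only [gradient]
  rw [show (fun y => f y + g y) = f + g from rfl, fderiv_add hf hg, map_add]

theorem gradient_fun_const_mul {f : Euc N → ℝ} {x : Euc N} (hf : DifferentiableAt ℝ f x) (c : ℝ) :
    gradient (fun y => c * f y) x = c • gradient f x := by
  simp only [gradient]
  rw [show (fun y => c * f y) = c • f from rfl, fderiv_const_smul hf, map_smul]

/-- `w ∈ W^{1,q}_0(Ω)` with weak gradient `G`. -/
structure IsW0 (Ω : Set (Euc N)) (q : ℝ≥0∞) (w : Euc N → ℝ) (G : Euc N → Euc N) : Prop where
  memLp : MemLp w q (volume.restrict Ω)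
  memLp_grad : MemLp G q (volume.restrict Ω)
  approx : ∀ ε : ℝ≥0∞, 0 < ε → ∃ η : Euc N → ℝ, IsTestFunction ∞ Ω η ∧
    eLpNorm (fun x => η x - w x) q (volume.restrict Ω) ≤ ε ∧
    eLpNorm (fun x => gradient η x - G x) q (volume.restrict Ω) ≤ ε

section
variable {Ω : Set (Euc N)} {q : ℝ≥0∞} {w w' : Euc N → ℝ} {G G' : Euc N → Euc N}

theorem IsTestFunction.memLp [IsFiniteMeasure (volume.restrict Ω)] {r : WithTop ℕ∞}
    (hφ : IsTestFunction r Ω w) : MemLp w q (volume.restrict Ω) := by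
  obtain ⟨C, hC⟩ := hφ.hasCompactSupport.exists_bound_of_continuous hφ.contDiff.continuous
  exact MemLp.of_bound hφ.contDiff.continuous.aestronglyMeasurable C (Eventually.of_forall hC)

theorem IsTestFunction.memLp_gradient [IsFiniteMeasure (volume.restrict Ω)] {r : WithTop ℕ∞}
    (hφ : IsTestFunction r Ω w) (hr : 1 ≤ r) : MemLp (gradient w) q (volume.restrict Ω) := by
  obtain ⟨C, hC⟩ := hφ.hasCompactSupport_gradient.exists_bound_of_continuous
    (hφ.continuous_gradient hr)
  exact MemLp.of_bound (hφ.continuous_gradient hr).aestronglyMeasurable C (Eventually.of_forall hC)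

theorem IsTestFunction.differentiable {r : WithTop ℕ∞}
    (hφ : IsTestFunction r Ω w) (hr : 1 ≤ r) : Differentiable ℝ w :=
  hφ.contDiff.differentiable (by intro h; simp [h] at hr)

theorem IsTestFunction.isW0 [IsFiniteMeasure (volume.restrict Ω)]
    (hφ : IsTestFunction ∞ Ω w) : IsW0 Ω q w (gradient w) :=
  ⟨hφ.memLp, hφ.memLp_gradient (by simp), fun ε _ => ⟨w, hφ, by simp, by simp⟩⟩

theorem IsW0.congr (h : IsW0 Ω q w G) (hw : w =ᵐ[volume.restrict Ω] w')
    (hG : G =ᵐ[volume.restrict Ω] G') : IsW0 Ω q w' G' := by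
  refine ⟨h.memLp.ae_eq hw, h.memLp_grad.ae_eq hG, fun ε hε => ?_⟩
  obtain ⟨η, h1, h2, h3⟩ := h.approx ε hε
  refine ⟨η, h1, ?_, ?_⟩
  · rwa [eLpNorm_congr_ae (g := fun x => η x - w x)]
    filter_upwards [hw] with x hx
    rw [hx]
  · rwa [eLpNorm_congr_ae (g := fun x => gradient η x - G x)]
    filter_upwards [hG] with x hx
    rw [hx]

theorem eLpNorm_sub_le_add {α F : Type*} [MeasurableSpace α] {μ : Measure α}
    [NormedAddCommGroup F] {f g h : α → F} (hq : 1 ≤ q)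
    (hf : AEStronglyMeasurable f μ) (hg : AEStronglyMeasurable g μ)
    (hh : AEStronglyMeasurable h μ) :
    eLpNorm (fun x => f x - h x) q μ ≤
      eLpNorm (fun x => f x - g x) q μ + eLpNorm (fun x => g x - h x) q μ := by
  have := eLpNorm_add_le (hf.sub hg) (hg.sub hh) hq
  simpa [Pi.add_def, Pi.sub_def] using this

theorem IsW0.of_limit [IsFiniteMeasure (volume.restrict Ω)] (hq : 1 ≤ q)
    (hw : MemLp w q (volume.restrict Ω)) (hG : MemLp G q (volume.restrict Ω))
    {ws : ℕ → Euc N → ℝ} {Gs : ℕ → Euc N → Euc N} (hs : ∀ n, IsW0 Ω q (ws n) (Gs n))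
    (h1 : Tendsto (fun n => eLpNorm (fun x => ws n x - w x) q (volume.restrict Ω)) atTop (𝓝 0))
    (h2 : Tendsto (fun n => eLpNorm (fun x => Gs n x - G x) q (volume.restrict Ω)) atTop (𝓝 0)) :
    IsW0 Ω q w G := by
  refine ⟨hw, hG, fun ε hε => ?_⟩
  have hε2 : 0 < ε / 2 := ENNReal.half_pos hε.ne'
  obtain ⟨n, hn1, hn2⟩ := ((h1.eventually_le_const hε2).and (h2.eventually_le_const hε2)).exists
  obtain ⟨η, e1, e2, e3⟩ := (hs n).approx (ε / 2) hε2
  refine ⟨η, e1, ?_, ?_⟩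
  · refine (eLpNorm_sub_le_add hq e1.contDiff.continuous.aestronglyMeasurable (hs n).memLp.1
      hw.1).trans ?_
    exact (add_le_add e2 hn1).trans_eq (ENNReal.add_halves ε)
  · refine (eLpNorm_sub_le_add hq (e1.continuous_gradient (by simp)).aestronglyMeasurable
      (hs n).memLp_grad.1 hG.1).trans ?_
    exact (add_le_add e3 hn2).trans_eq (ENNReal.add_halves ε)

theorem IsW0.of_dominated [IsFiniteMeasure (volume.restrict Ω)] (hq : 1 ≤ q) (hq' : q ≠ ⊤)
    {ws : ℕ → Euc N → ℝ} {Gs : ℕ → Euc N → Euc N} (hs : ∀ n, IsW0 Ω q (ws n) (Gs n))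
    {b B : Euc N → ℝ} (hb : MemLp b q (volume.restrict Ω)) (hB : MemLp B q (volume.restrict Ω))
    (h1 : ∀ n, ∀ᵐ x ∂(volume.restrict Ω), |ws n x| ≤ b x)
    (h2 : ∀ n, ∀ᵐ x ∂(volume.restrict Ω), ‖Gs n x‖ ≤ B x)
    (h3 : ∀ᵐ x ∂(volume.restrict Ω), Tendsto (fun n => ws n x) atTop (𝓝 (w x)))
    (h4 : ∀ᵐ x ∂(volume.restrict Ω), Tendsto (fun n => Gs n x) atTop (𝓝 (G x))) :
    IsW0 Ω q w G := by
  have hq0 : q ≠ 0 := (zero_lt_one.trans_le hq).ne'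
  obtain ⟨a1, a2⟩ := tendsto_eLpNorm_sub_of_dominated hq0 hq' (fun n => (hs n).memLp.1) hb h1 h3
  obtain ⟨a3, a4⟩ :=
    tendsto_eLpNorm_sub_of_dominated hq0 hq' (fun n => (hs n).memLp_grad.1) hB h2 h4
  exact IsW0.of_limit hq a1 a3 hs a2 a4

theorem IsW0.exists_seq (h : IsW0 Ω q w G) (hq : 1 ≤ q) :
    ∃ η : ℕ → Euc N → ℝ, (∀ n, IsTestFunction ∞ Ω (η n)) ∧
      Tendsto (fun n => eLpNorm (fun x => η n x - w x) q (volume.restrict Ω)) atTop (𝓝 0) ∧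
      Tendsto (fun n => eLpNorm (fun x => gradient (η n) x - G x) q (volume.restrict Ω))
        atTop (𝓝 0) ∧
      ∀ᵐ x ∂(volume.restrict Ω), Tendsto (fun n => η n x) atTop (𝓝 (w x)) := by
  choose η h1 h2 h3 using fun n : ℕ => h.approx ((n : ℝ≥0∞) + 1)⁻¹ (by simp)
  have hlim : Tendsto (fun n : ℕ => ((n : ℝ≥0∞) + 1)⁻¹) atTop (𝓝 0) := by
    have := ENNReal.tendsto_inv_nat_nhds_zero.comp (tendsto_add_atTop_nat 1)
    refine this.congr fun n => by simp
  have t2 := tendsto_of_tendsto_of_tendsto_of_le_of_le tendsto_const_nhds hlim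
    (fun _ => zero_le) h2
  have t3 := tendsto_of_tendsto_of_tendsto_of_le_of_le tendsto_const_nhds hlim
    (fun _ => zero_le) h3
  obtain ⟨ns, hns, hae⟩ := (tendstoInMeasure_of_tendsto_eLpNorm
    (zero_lt_one.trans_le hq).ne' (fun n => (h1 n).contDiff.continuous.aestronglyMeasurable)
    h.memLp.1 t2).exists_seq_tendsto_ae
  exact ⟨fun n => η (ns n), fun n => h1 _, t2.comp hns.tendsto_atTop, t3.comp hns.tendsto_atTop,
    hae⟩

theorem IsW0.of_seq (hw : MemLp w q (volume.restrict Ω)) (hG : MemLp G q (volume.restrict Ω))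
    {η : ℕ → Euc N → ℝ} (h0 : ∀ n, IsTestFunction ∞ Ω (η n))
    (h1 : Tendsto (fun n => eLpNorm (fun x => η n x - w x) q (volume.restrict Ω)) atTop (𝓝 0))
    (h2 : Tendsto (fun n => eLpNorm (fun x => gradient (η n) x - G x) q (volume.restrict Ω))
      atTop (𝓝 0)) : IsW0 Ω q w G := by
  refine ⟨hw, hG, fun ε hε => ?_⟩
  obtain ⟨n, hn1, hn2⟩ := ((h1.eventually_le_const hε).and (h2.eventually_le_const hε)).exists
  exact ⟨η n, h0 n, hn1, hn2⟩

theorem IsTestFunction.add {r : WithTop ℕ∞} (h : IsTestFunction r Ω w)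
    (h' : IsTestFunction r Ω w') : IsTestFunction r Ω (fun x => w x + w' x) :=
  ⟨h.contDiff.add h'.contDiff, h.hasCompactSupport.add h'.hasCompactSupport,
    (tsupport_add w w').trans (union_subset h.tsupport_subset h'.tsupport_subset)⟩

theorem IsTestFunction.const_mul {r : WithTop ℕ∞} (h : IsTestFunction r Ω w) (c : ℝ) :
    IsTestFunction r Ω (fun x => c * w x) :=
  ⟨contDiff_const.mul h.contDiff, h.hasCompactSupport.mul_left,
    (closure_mono (fun x hx => by
      simp only [Function.mem_support] at hx ⊢; exact right_ne_zero_of_mul hx)).trans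
      h.tsupport_subset⟩

theorem IsW0.add (h : IsW0 Ω q w G) (h' : IsW0 Ω q w' G') (hq : 1 ≤ q) :
    IsW0 Ω q (fun x => w x + w' x) (fun x => G x + G' x) := by
  refine ⟨h.memLp.add h'.memLp, h.memLp_grad.add h'.memLp_grad, fun ε hε => ?_⟩
  obtain ⟨η, h1, h2, h3⟩ := h.approx (ε / 2) (ENNReal.half_pos hε.ne')
  obtain ⟨η', h1', h2', h3'⟩ := h'.approx (ε / 2) (ENNReal.half_pos hε.ne')
  refine ⟨_, h1.add h1', ?_, ?_⟩
  · have := eLpNorm_add_le (h1.contDiff.continuous.aestronglyMeasurable.sub h.memLp.1)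
      (h1'.contDiff.continuous.aestronglyMeasurable.sub h'.memLp.1) hq
    refine le_trans (le_of_eq ?_) (this.trans ((add_le_add h2 h2').trans_eq (ENNReal.add_halves ε)))
    congr 1; ext x; simp; ring
  · have := eLpNorm_add_le ((h1.continuous_gradient (by simp)).aestronglyMeasurable.sub
      h.memLp_grad.1) ((h1'.continuous_gradient (by simp)).aestronglyMeasurable.sub
      h'.memLp_grad.1) hq
    refine le_trans (le_of_eq ?_) (this.trans ((add_le_add h3 h3').trans_eq (ENNReal.add_halves ε)))
    congr 1; funext x
    rw [gradient_fun_add (h1.differentiable (by simp) x) (h1'.differentiable (by simp) x)]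
    simp only [Pi.add_apply, Pi.sub_apply]
    abel

theorem IsW0.const_mul (h : IsW0 Ω q w G) (hq : 1 ≤ q) (c : ℝ) :
    IsW0 Ω q (fun x => c * w x) (fun x => c • G x) := by
  obtain ⟨η, h1, h2, h3, -⟩ := h.exists_seq hq
  refine IsW0.of_seq (h.memLp.const_mul c) (h.memLp_grad.const_smul c) (fun n => (h1 n).const_mul c)
    ?_ ?_
  · have := ENNReal.Tendsto.const_mul (a := ‖c‖ₑ) h2 (Or.inr (by simp))
    rw [mul_zero] at this
    refine this.congr fun n => ?_
    rw [← eLpNorm_const_smul]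
    congr 1; ext x; simp; ring
  · have := ENNReal.Tendsto.const_mul (a := ‖c‖ₑ) h3 (Or.inr (by simp))
    rw [mul_zero] at this
    refine this.congr fun n => ?_
    rw [← eLpNorm_const_smul]
    congr 1; funext x
    rw [gradient_fun_const_mul ((h1 n).differentiable (by simp) x)]
    simp [smul_sub]

theorem IsW0.sub (h : IsW0 Ω q w G) (h' : IsW0 Ω q w' G') (hq : 1 ≤ q) :
    IsW0 Ω q (fun x => w x - w' x) (fun x => G x - G' x) := by
  have := h.add (h'.const_mul hq (-1)) hq
  simpa [sub_eq_add_neg] using this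

theorem IsW0.mono [IsFiniteMeasure (volume.restrict Ω)] {r : ℝ≥0∞} (h : IsW0 Ω q w G)
    (hr : 1 ≤ r) (hrq : r ≤ q) : IsW0 Ω r w G := by
  obtain ⟨η, h1, h2, h3, -⟩ := h.exists_seq (hr.trans hrq)
  set K := (volume.restrict Ω) univ ^ (1 / r.toReal - 1 / q.toReal) with hK
  -- On a null domain the power is 0^(1/r - 1/q), which is finite because r ≤ q makes the exponent
  -- nonnegative.
  have hKt : K ≠ ⊤ := by
    rcases eq_or_ne (volume.restrict Ω univ) 0 with h0 | h0
    · rcases eq_or_ne q ⊤ with rfl | hq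
      · rw [hK, h0]
        apply ENNReal.rpow_ne_top_of_nonneg (by simp) (by simp)
      · rw [hK, h0]
        apply ENNReal.rpow_ne_top_of_nonneg _ (by simp)
        rw [sub_nonneg]
        have hr' : r ≠ ⊤ := ne_top_of_le_ne_top hq hrq
        apply one_div_le_one_div_of_le
        · exact ENNReal.toReal_pos (zero_lt_one.trans_le hr).ne' hr'
        · exact ENNReal.toReal_mono hq hrq
    · exact ENNReal.rpow_ne_top_of_ne_zero h0 (measure_ne_top _ _)
  refine IsW0.of_seq (h.memLp.mono_exponent hrq) (h.memLp_grad.mono_exponent hrq) h1 ?_ ?_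
  · have := ENNReal.Tendsto.mul_const (b := K) h2 (Or.inr hKt)
    rw [zero_mul] at this
    exact tendsto_of_tendsto_of_tendsto_of_le_of_le tendsto_const_nhds this (fun _ => zero_le)
      fun n => eLpNorm_le_eLpNorm_mul_rpow_measure_univ hrq
        ((h1 n).contDiff.continuous.aestronglyMeasurable.sub h.memLp.1)
  · have := ENNReal.Tendsto.mul_const (b := K) h3 (Or.inr hKt)
    rw [zero_mul] at this
    exact tendsto_of_tendsto_of_tendsto_of_le_of_le tendsto_const_nhds this (fun _ => zero_le)
      fun n => eLpNorm_le_eLpNorm_mul_rpow_measure_univ hrq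
        (((h1 n).continuous_gradient (by simp)).aestronglyMeasurable.sub h.memLp_grad.1)
end


/-! ### Integration by parts, uniqueness of weak gradients, comparison with `MemW0`. -/

section
variable {Ω : Set (Euc N)} {q : ℝ≥0∞} {w w' : Euc N → ℝ} {G G' : Euc N → Euc N}

/-- Integrals pass to the limit along sequences controlled by a sequence converging in `L^q`. -/
theorem tendsto_integral_of_tendsto_eLpNorm {α E F : Type*} [MeasurableSpace α] {μ : Measure α}
    [IsFiniteMeasure μ] [NormedAddCommGroup E] [NormedAddCommGroup F] [NormedSpace ℝ F]
    (hq : 1 ≤ q) {f : ℕ → α → E} {f₀ : α → E} {H : ℕ → α → F} {H₀ : α → F}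
    (hf : ∀ n, AEStronglyMeasurable (f n) μ) (hf₀ : AEStronglyMeasurable f₀ μ)
    (hlim : Tendsto (fun n => eLpNorm (fun x => f n x - f₀ x) q μ) atTop (𝓝 0))
    (hH : ∀ n, Integrable (H n) μ) (hH₀ : Integrable H₀ μ) (C : ℝ)
    (hC : ∀ n, ∀ᵐ x ∂μ, ‖H n x - H₀ x‖ ≤ C * ‖f n x - f₀ x‖) :
    Tendsto (fun n => ∫ x, H n x ∂μ) atTop (𝓝 (∫ x, H₀ x ∂μ)) := by
  refine tendsto_integral_of_L1' H₀ hH₀.1 (Eventually.of_forall hH) ?_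
  by_cases hqt : q = ⊤ ∧ μ univ = 0
  · have : μ = 0 := Measure.measure_univ_eq_zero.1 hqt.2
    subst this
    simp
  have hK : μ univ ^ (1 / (1 : ℝ≥0∞).toReal - 1 / q.toReal) ≠ ⊤ := by
    rcases eq_or_ne (μ univ) 0 with h0 | h0
    · rw [h0]
      apply ENNReal.rpow_ne_top_of_nonneg _ (by simp)
      rw [sub_nonneg]
      have hqt' : q ≠ ⊤ := fun h => hqt ⟨h, h0⟩
      apply one_div_le_one_div_of_le
      · simp
      · exact ENNReal.toReal_mono hqt' hq
    · exact ENNReal.rpow_ne_top_of_ne_zero h0 (measure_ne_top _ _)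
  have h1 := ENNReal.Tendsto.mul_const hlim (Or.inr hK)
  rw [zero_mul] at h1
  have h2 := ENNReal.Tendsto.const_mul (a := ENNReal.ofReal C) h1 (Or.inr (by simp))
  rw [mul_zero] at h2
  refine tendsto_of_tendsto_of_tendsto_of_le_of_le tendsto_const_nhds h2 (fun _ => zero_le) ?_
  intro n
  calc eLpNorm (H n - H₀) 1 μ ≤ ENNReal.ofReal C * eLpNorm (fun x => f n x - f₀ x) 1 μ :=
        eLpNorm_le_mul_eLpNorm_of_ae_le_mul (hC n) 1
    _ ≤ _ := mul_le_mul' le_rfl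
        (eLpNorm_le_eLpNorm_mul_rpow_measure_univ hq ((hf n).sub hf₀))

/-- Integration by parts against a vector field passes from test functions to `W^{1,q}_0`. -/
theorem IsW0.integral_parts [IsFiniteMeasure (volume.restrict Ω)] (h : IsW0 Ω q w G) (hq : 1 ≤ q)
    {V : Euc N → Euc N} {d : Euc N → ℝ} {C : ℝ}
    (hVm : AEStronglyMeasurable V (volume.restrict Ω))
    (hdm : AEStronglyMeasurable d (volume.restrict Ω))
    (hV : ∀ᵐ x ∂(volume.restrict Ω), ‖V x‖ ≤ C) (hd : ∀ᵐ x ∂(volume.restrict Ω), |d x| ≤ C)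
    (hparts : ∀ η : Euc N → ℝ, IsTestFunction ∞ Ω η →
      ∫ x in Ω, inner ℝ (V x) (gradient η x) = - ∫ x in Ω, d x * η x) :
    ∫ x in Ω, inner ℝ (V x) (G x) = - ∫ x in Ω, d x * w x := by
  obtain ⟨η, h1, h2, h3, -⟩ := h.exists_seq hq
  have hint : ∀ W : Euc N → Euc N, MemLp W q (volume.restrict Ω) →
      Integrable (fun x => inner ℝ (V x) (W x)) (volume.restrict Ω) := by
    intro W hW
    refine Integrable.mono' ((hW.integrable hq).norm.const_mul C) (hVm.inner hW.1) ?_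
    filter_upwards [hV] with x hx
    exact (norm_inner_le_norm _ _).trans (by gcongr)
  have hint' : ∀ W : Euc N → ℝ, MemLp W q (volume.restrict Ω) →
      Integrable (fun x => d x * W x) (volume.restrict Ω) := by
    intro W hW
    refine Integrable.mono' ((hW.integrable hq).norm.const_mul C) (hdm.mul hW.1) ?_
    filter_upwards [hd] with x hx
    rw [norm_mul]
    gcongr
    exact hx
  have t1 := tendsto_integral_of_tendsto_eLpNorm hq
    (fun n => ((h1 n).continuous_gradient (by simp)).aestronglyMeasurable) h.memLp_grad.1 h3
    (fun n => hint _ ((h1 n).memLp_gradient (by simp))) (hint _ h.memLp_grad) C (by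
      intro n
      filter_upwards [hV] with x hx
      rw [← inner_sub_right]
      exact (norm_inner_le_norm _ _).trans (by gcongr))
  have t2 := tendsto_integral_of_tendsto_eLpNorm hq
    (fun n => (h1 n).contDiff.continuous.aestronglyMeasurable) h.memLp.1 h2
    (fun n => hint' _ (h1 n).memLp) (hint' _ h.memLp) C (by
      intro n
      filter_upwards [hd] with x hx
      rw [← mul_sub, norm_mul]
      gcongr
      exact hx)
  refine tendsto_nhds_unique t1 (t2.neg.congr fun n => ?_)
  exact (hparts _ (h1 n)).symm

theorem integral_gradient_mul {φ η : Euc N → ℝ} (hφ : IsTestFunction ∞ Ω φ)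
    (hη : ContDiff ℝ 1 η) (v : Euc N) :
    ∫ x, φ x * fderiv ℝ η x v = - ∫ x, fderiv ℝ φ x v * η x := by
  have hφ' : Continuous (fun x => fderiv ℝ φ x v) :=
    (hφ.contDiff.continuous_fderiv (by simp)).clm_apply continuous_const
  have hη' : Continuous (fun x => fderiv ℝ η x v) :=
    (hη.continuous_fderiv (by simp)).clm_apply continuous_const
  refine integral_mul_fderiv_eq_neg_fderiv_mul_of_integrable ?_ ?_ ?_ ?_ ?_
  · exact (hφ'.mul hη.continuous).integrable_of_hasCompactSupport
      ((hφ.hasCompactSupport.fderiv_apply (𝕜 := ℝ) v).mul_right)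
  · exact (hφ.contDiff.continuous.mul hη').integrable_of_hasCompactSupport
      hφ.hasCompactSupport.mul_right
  · exact (hφ.contDiff.continuous.mul hη.continuous).integrable_of_hasCompactSupport
      hφ.hasCompactSupport.mul_right
  · exact fun x _ => hφ.differentiable (by simp) x
  · exact fun x _ => hη.differentiable (by simp) x

/-- For each fixed direction v, the field φ v has divergence ∂_v φ. Integration by parts holds
between two test functions and survives the L^q limit in one of them, since φ and its gradient are
bounded. -/
theorem IsW0.hasWeakGrad [IsFiniteMeasure (volume.restrict Ω)] (h : IsW0 Ω q w G) (hq : 1 ≤ q) :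
    HasWeakGrad Ω w G := by
  refine ⟨locallyIntegrableOn_of_locallyIntegrable_restrict (h.memLp.locallyIntegrable hq),
    locallyIntegrableOn_of_locallyIntegrable_restrict (h.memLp_grad.locallyIntegrable hq), ?_⟩
  intro φ hφ
  obtain ⟨C₁, hC₁⟩ := hφ.hasCompactSupport.exists_bound_of_continuous hφ.contDiff.continuous
  obtain ⟨C₂, hC₂⟩ := hφ.hasCompactSupport_gradient.exists_bound_of_continuous
    (hφ.continuous_gradient (by simp))
  have hcg := hφ.continuous_gradient (by simp)
  have hi1 : Integrable (fun x => w x • gradient φ x) (volume.restrict Ω) := by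
    refine Integrable.mono' ((h.memLp.integrable hq).norm.const_mul C₂)
      (h.memLp.1.smul hcg.aestronglyMeasurable) (Eventually.of_forall fun x => ?_)
    rw [norm_smul, mul_comm]
    gcongr
    exact hC₂ x
  have hi2 : Integrable (fun x => φ x • G x) (volume.restrict Ω) := by
    refine Integrable.mono' ((h.memLp_grad.integrable hq).norm.const_mul C₁)
      (hφ.contDiff.continuous.aestronglyMeasurable.smul h.memLp_grad.1)
      (Eventually.of_forall fun x => ?_)
    rw [norm_smul]
    gcongr
    exact hC₁ x
  refine ext_inner_left ℝ fun v => ?_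
  rw [inner_neg_right, ← integral_inner hi1, ← integral_inner hi2]
  have key := h.integral_parts hq (V := fun x => φ x • v) (d := fun x => fderiv ℝ φ x v)
    (C := max (C₁ * ‖v‖) (C₂ * ‖v‖))
    (hφ.contDiff.continuous.smul continuous_const).aestronglyMeasurable
    ((hφ.contDiff.continuous_fderiv (by simp)).clm_apply continuous_const).aestronglyMeasurable
    (Eventually.of_forall fun x => by
      rw [norm_smul]; exact le_max_of_le_left (by gcongr; exact hC₁ x))
    (Eventually.of_forall fun x => by
      rw [← Real.norm_eq_abs]
      refine le_max_of_le_right ((ContinuousLinearMap.le_opNorm _ _).trans ?_)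
      rw [← norm_gradient_eq]
      gcongr
      exact hC₂ x) ?_
  · simp only [inner_smul_left, inner_smul_right] at key ⊢
    simp only [conj_trivial] at key
    rw [key, neg_neg]
    refine integral_congr_ae (Eventually.of_forall fun x => ?_)
    simp only [← inner_gradient_left]
    rw [real_inner_comm, mul_comm]
  · intro η hη
    have e1 : ∀ x, x ∉ Ω → inner ℝ (φ x • v) (gradient η x) = (0 : ℝ) := by
      intro x hx
      rw [image_eq_zero_of_notMem_tsupport fun hx' => hx (hφ.tsupport_subset hx')]
      simp
    have e2 : ∀ x, x ∉ Ω → fderiv ℝ φ x v * η x = (0 : ℝ) := by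
      intro x hx
      rw [image_eq_zero_of_notMem_tsupport fun hx' => hx (hη.tsupport_subset hx')]
      simp
    rw [setIntegral_eq_integral_of_forall_compl_eq_zero e1,
      setIntegral_eq_integral_of_forall_compl_eq_zero e2,
      ← integral_gradient_mul hφ (hη.contDiff.of_le (by simp)) v]
    refine integral_congr_ae (Eventually.of_forall fun x => ?_)
    simp only [inner_smul_left, conj_trivial]
    rw [real_inner_comm, inner_gradient_left]

/-- The difference of the gradients is orthogonal to all test functions, so the fundamental lemma of
the calculus of variations applies. -/
theorem HasWeakGrad.unique (hΩ : IsOpen Ω) (h : HasWeakGrad Ω w G) (h' : HasWeakGrad Ω w' G')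
    (hw : w =ᵐ[volume.restrict Ω] w') : G =ᵐ[volume.restrict Ω] G' := by
  have hloc : LocallyIntegrableOn (fun x => G x - G' x) Ω :=
    h.locallyIntegrable_grad.sub h'.locallyIntegrable_grad
  have := hΩ.ae_eq_zero_of_integral_contDiff_smul_eq_zero hloc ?_
  · rw [EventuallyEq, ae_restrict_iff' hΩ.measurableSet]
    filter_upwards [this] with x hx hxΩ
    exact sub_eq_zero.1 (hx hxΩ)
  · intro g hg hgc hgs
    have hg' : IsTestFunction ∞ Ω g := ⟨hg, hgc, hgs⟩
    have hint : ∀ F : Euc N → Euc N, LocallyIntegrableOn F Ω →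
        Integrable (fun x => g x • F x) := by
      intro F hF
      have hK : IntegrableOn F (tsupport g) := hF.integrableOn_compact_subset hgs hgc
      have : IntegrableOn (fun x => g x • F x) (tsupport g) :=
        hK.continuousOn_smul hg.continuous.continuousOn hgc
      rwa [integrableOn_iff_integrable_of_support_subset] at this
      intro x hx
      refine subset_closure ?_
      simp only [Function.mem_support] at hx ⊢
      exact left_ne_zero_of_smul hx
    have hout : ∀ F : Euc N → Euc N, ∫ x in Ω, g x • F x = ∫ x, g x • F x := fun F =>
      setIntegral_eq_integral_of_forall_compl_eq_zero fun x hx => by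
        rw [image_eq_zero_of_notMem_tsupport fun hx' => hx (hgs hx'), zero_smul]
    simp only [smul_sub]
    rw [integral_sub (hint _ h.locallyIntegrable_grad) (hint _ h'.locallyIntegrable_grad),
      ← hout, ← hout, sub_eq_zero]
    have e1 := h.integral_eq g hg'
    have e2 := h'.integral_eq g hg'
    rw [integral_congr_ae (g := fun x => w' x • gradient g x)] at e1
    · exact neg_injective (e1.symm.trans e2)
    · filter_upwards [hw] with x hx
      rw [hx]

/-- The bridge from the gradient chosen in `weakGrad` to explicit ones. The freedom to change w on a
null set is needed because formulas for truncations hold only where u ≥ 0. -/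
theorem HasWeakGrad.weakGrad_ae_eq (hΩ : IsOpen Ω) (h : HasWeakGrad Ω w G)
    (hw : w' =ᵐ[volume.restrict Ω] w) : weakGrad Ω w' =ᵐ[volume.restrict Ω] G := by
  have h' : HasWeakGrad Ω w' G := by
    refine ⟨?_, h.locallyIntegrable_grad, fun φ hφ => ?_⟩
    · intro x hx
      obtain ⟨s, hs, hs'⟩ := h.locallyIntegrable x hx
      refine ⟨s ∩ Ω, inter_mem hs self_mem_nhdsWithin, ?_⟩
      refine (hs'.mono_set inter_subset_left).congr_fun_ae ?_
      exact (ae_mono (Measure.restrict_mono inter_subset_right le_rfl) hw.symm)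
    · rw [← h.integral_eq φ hφ]
      refine integral_congr_ae ?_
      filter_upwards [hw] with x hx
      rw [hx]
  have hex : ∃ G, HasWeakGrad Ω w' G := ⟨G, h'⟩
  rw [weakGrad, dif_pos hex]
  exact hex.choose_spec.unique hΩ h' EventuallyEq.rfl

/-- The weak-gradient clause of `MemW0` is a consequence of the approximation by test functions. -/
theorem memW0_iff [IsFiniteMeasure (volume.restrict Ω)] {r : ℝ} (hr : 1 ≤ r) :
    MemW0 Ω r w ↔ ∃ G, IsW0 Ω (ENNReal.ofReal r) w G := by
  have hr' : 1 ≤ ENNReal.ofReal r := by simpa using hr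
  constructor
  · rintro ⟨G, -, h1, h2, η, h3, h4, h5⟩
    exact ⟨G, IsW0.of_seq h1 h2 h3 h4 h5⟩
  · rintro ⟨G, h⟩
    obtain ⟨η, h3, h4, h5, -⟩ := h.exists_seq hr'
    exact ⟨G, h.hasWeakGrad hr', h.memLp, h.memLp_grad, η, h3, h4, h5⟩
end

/-! ### Chain rule and truncation in W^{1,q}_0. -/

section
variable {Ω : Set (Euc N)} {q : ℝ≥0∞} {w w' : Euc N → ℝ} {G G' : Euc N → Euc N}

theorem IsTestFunction.comp {F : ℝ → ℝ} (hF : ContDiff ℝ ∞ F) (hF0 : F 0 = 0)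
    (h : IsTestFunction ∞ Ω w) : IsTestFunction ∞ Ω (fun x => F (w x)) :=
  ⟨hF.comp h.contDiff, h.hasCompactSupport.comp_left hF0,
    (closure_mono (fun x hx => by
      simp only [Function.mem_support] at hx ⊢
      intro h0; rw [h0] at hx; exact hx hF0)).trans h.tsupport_subset⟩

theorem abs_sub_le_of_deriv_bound {F : ℝ → ℝ} {C : ℝ} (hF : Differentiable ℝ F)
    (hC : ∀ s, |deriv F s| ≤ C) (s t : ℝ) : |F s - F t| ≤ C * |s - t| := by
  have := Convex.norm_image_sub_le_of_norm_deriv_le (f := F) (s := univ) (C := C)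
    (fun x _ => hF x) (fun x _ => hC x) convex_univ (mem_univ t) (mem_univ s)
  simpa using this

/-- Chain rule in `W^{1,q}_0` for smooth functions. -/
theorem IsW0.comp_smooth [IsFiniteMeasure (volume.restrict Ω)] (h : IsW0 Ω q w G) (hq : 1 ≤ q)
    (hq' : q ≠ ⊤) {F : ℝ → ℝ} (hF : ContDiff ℝ ∞ F) (hF0 : F 0 = 0) {C : ℝ}
    (hC : ∀ s, |deriv F s| ≤ C) :
    IsW0 Ω q (fun x => F (w x)) (fun x => deriv F (w x) • G x) := by
  obtain ⟨η, h1, h2, h3, h4⟩ := h.exists_seq hq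
  have hq0 : q ≠ 0 := (zero_lt_one.trans_le hq).ne'
  have hFd : Differentiable ℝ F := hF.differentiable (by simp)
  have hF' : Continuous (deriv F) := hF.continuous_deriv (by simp)
  have hC0 : 0 ≤ C := (abs_nonneg _).trans (hC 0)
  have hwm : AEStronglyMeasurable (fun x => F (w x)) (volume.restrict Ω) :=
    hF.continuous.comp_aestronglyMeasurable h.memLp.1
  have hw'm : AEStronglyMeasurable (fun x => deriv F (w x)) (volume.restrict Ω) :=
    hF'.comp_aestronglyMeasurable h.memLp.1
  have hmem : MemLp (fun x => F (w x)) q (volume.restrict Ω) := by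
    refine (h.memLp.norm.const_mul C).mono' hwm (Eventually.of_forall fun x => ?_)
    have := abs_sub_le_of_deriv_bound hFd hC (w x) 0
    simpa [hF0] using this
  have hmem' : MemLp (fun x => deriv F (w x) • G x) q (volume.restrict Ω) := by
    refine (h.memLp_grad.norm.const_mul C).mono' (hw'm.smul h.memLp_grad.1)
      (Eventually.of_forall fun x => ?_)
    rw [norm_smul]
    gcongr
    exact hC _
  have hηc : ∀ n, Continuous (η n) := fun n => (h1 n).contDiff.continuous
  refine IsW0.of_seq hmem hmem' (fun n => (h1 n).comp hF hF0) ?_ ?_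
  · have := ENNReal.Tendsto.const_mul (a := ENNReal.ofReal C) h2 (Or.inr (by simp))
    rw [mul_zero] at this
    refine tendsto_of_tendsto_of_tendsto_of_le_of_le tendsto_const_nhds this (fun _ => zero_le) ?_
    intro n
    exact eLpNorm_le_mul_eLpNorm_of_ae_le_mul
      (Eventually.of_forall fun x => abs_sub_le_of_deriv_bound hFd hC _ _) q
  · have t1 := ENNReal.Tendsto.const_mul (a := ENNReal.ofReal C) h3 (Or.inr (by simp))
    rw [mul_zero] at t1
    have t2 : Tendsto (fun n => eLpNorm (fun x => (deriv F (η n x) - deriv F (w x)) • G x) q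
        (volume.restrict Ω)) atTop (𝓝 0) := by
      refine tendsto_eLpNorm_zero_of_dominated hq0 hq' (g := fun x => (C + C) * ‖G x‖) ?_
        (h.memLp_grad.norm.const_mul _) ?_ ?_
      · exact fun n => ((hF'.comp (hηc n)).aestronglyMeasurable.sub hw'm).smul h.memLp_grad.1
      · refine fun n => Eventually.of_forall fun x => ?_
        rw [norm_smul]
        gcongr
        exact (norm_sub_le _ _).trans (add_le_add (hC _) (hC _))
      · filter_upwards [h4] with x hx
        have := ((hF'.tendsto (w x)).comp hx).sub_const (deriv F (w x))
        simpa [Function.comp_def] using this.smul_const (G x)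
    have t3 := t1.add t2
    rw [add_zero] at t3
    refine tendsto_of_tendsto_of_tendsto_of_le_of_le tendsto_const_nhds t3 (fun _ => zero_le) ?_
    intro n
    have hgc := (h1 n).continuous_gradient (by simp)
    have e : (fun x => gradient (fun y => F (η n y)) x - deriv F (w x) • G x) =
        (fun x => deriv F (η n x) • (gradient (η n) x - G x)) +
          (fun x => (deriv F (η n x) - deriv F (w x)) • G x) := by
      funext x
      rw [gradient_comp (hFd _) ((h1 n).differentiable (by simp) x)]
      simp [smul_sub, sub_smul]
    have hm1 : AEStronglyMeasurable (fun x => deriv F (η n x)) (volume.restrict Ω) :=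
      (hF'.comp (hηc n)).aestronglyMeasurable
    show eLpNorm (fun x => gradient (fun y => F (η n y)) x - deriv F (w x) • G x) q _ ≤ _
    rw [e]
    refine (eLpNorm_add_le (hm1.smul (hgc.aestronglyMeasurable.sub h.memLp_grad.1))
      ((hm1.sub hw'm).smul h.memLp_grad.1) hq).trans (add_le_add ?_ le_rfl)
    refine eLpNorm_le_mul_eLpNorm_of_ae_le_mul (Eventually.of_forall fun x => ?_) q
    rw [Pi.smul_apply', norm_smul]
    exact mul_le_mul_of_nonneg_right (hC _) (norm_nonneg _)

/-- A primitive of a pointwise limit of smooth bounded functions is a limit of smooth functions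
with bounded derivative. -/
theorem exists_smooth_primitives {F g : ℝ → ℝ} {gs : ℕ → ℝ → ℝ} {C : ℝ} {D : Set ℝ}
    (hgs : ∀ n, ContDiff ℝ ∞ (gs n)) (hb : ∀ n s, |gs n s| ≤ C)
    (hlim : ∀ s, Tendsto (fun n => gs n s) atTop (𝓝 (g s)))
    (hF : Continuous F) (hF0 : F 0 = 0) (hD : D.Countable)
    (hd : ∀ s ∉ D, HasDerivAt F (g s) s) :
    ∃ Fs : ℕ → ℝ → ℝ, (∀ n s, Fs n s = ∫ t in (0 : ℝ)..s, gs n t) ∧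
      (∀ n, ContDiff ℝ ∞ (Fs n)) ∧ (∀ n, Fs n 0 = 0) ∧ (∀ n, deriv (Fs n) = gs n) ∧
      ∀ s, Tendsto (fun n => Fs n s) atTop (𝓝 (F s)) := by
  have hder : ∀ n s, HasDerivAt (fun s => ∫ t in (0 : ℝ)..s, gs n t) (gs n s) s := fun n s =>
    intervalIntegral.integral_hasDerivAt_right ((hgs n).continuous.intervalIntegrable _ _)
      (hgs n).continuous.stronglyMeasurable.stronglyMeasurableAtFilter
      (hgs n).continuous.continuousAt
  have hder' : ∀ n, deriv (fun s => ∫ t in (0 : ℝ)..s, gs n t) = gs n := fun n =>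
    funext fun s => (hder n s).deriv
  refine ⟨fun n s => ∫ t in (0 : ℝ)..s, gs n t, fun _ _ => rfl, fun n => ?_, fun n => ?_, hder', ?_⟩
  · rw [contDiff_infty_iff_deriv, hder']
    exact ⟨fun s => (hder n s).differentiableAt, hgs n⟩
  · simp
  · intro s
    have hgm : StronglyMeasurable g := stronglyMeasurable_of_tendsto atTop
      (fun n => (hgs n).continuous.stronglyMeasurable) (tendsto_pi_nhds.2 hlim)
    have hgb : ∀ s, |g s| ≤ C := fun s =>
      le_of_tendsto (hlim s).abs (Eventually.of_forall fun n => hb n s)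
    have hint : IntervalIntegrable g volume 0 s := by
      rw [intervalIntegrable_iff]
      exact Measure.integrableOn_of_bounded (M := C) (by simp)
        hgm.aestronglyMeasurable (Eventually.of_forall hgb)
    have e := integral_eq_of_hasDerivAt_off_countable F g hD
      (a := 0) (b := s) hF.continuousOn (fun x hx => hd x hx.2) hint
    rw [hF0, sub_zero] at e
    rw [← e]
    refine intervalIntegral.tendsto_integral_filter_of_dominated_convergence (fun _ => C) ?_ ?_ ?_ ?_
    · exact Eventually.of_forall fun n => (hgs n).continuous.aestronglyMeasurable
    · exact Eventually.of_forall fun n => Eventually.of_forall fun x _ => hb n x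
    · exact intervalIntegrable_const
    · exact Eventually.of_forall fun x _ => hlim x

theorem continuous_trunc (k : ℝ) : Continuous (trunc k) := by
  unfold trunc; fun_prop

theorem trunc_of_abs_le {k s : ℝ} (h : |s| ≤ k) : trunc k s = s := by
  rw [abs_le] at h
  rw [trunc, min_eq_left h.2, max_eq_right h.1]

theorem trunc_of_le {k s : ℝ} (hk : 0 ≤ k) (h : k ≤ s) : trunc k s = k := by
  rw [trunc, min_eq_right h, max_eq_right (by linarith)]

theorem trunc_of_le_neg {k s : ℝ} (h : s ≤ -k) : trunc k s = -k := by
  rw [trunc, max_eq_left]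
  exact (min_le_left _ _).trans h

theorem abs_trunc_le {k : ℝ} (hk : 0 ≤ k) (s : ℝ) : |trunc k s| ≤ k :=
  abs_le.2 ⟨le_max_left _ _, max_le (by linarith) (min_le_right _ _)⟩

theorem trunc_nonneg {k s : ℝ} (hk : 0 ≤ k) (hs : 0 ≤ s) : 0 ≤ trunc k s :=
  le_max_of_le_right (le_min hs hk)

theorem trunc_of_nonneg {k s : ℝ} (hk : 0 ≤ k) (hs : 0 ≤ s) : trunc k s = min s k :=
  max_eq_right (by have := le_min hs hk; linarith)

theorem abs_trunc_le_abs {k : ℝ} (hk : 0 ≤ k) (s : ℝ) : |trunc k s| ≤ |s| := by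
  rcases le_total |s| k with h | h
  · rw [trunc_of_abs_le h]
  · exact (abs_trunc_le hk s).trans h

theorem trunc_trunc {j k s : ℝ} (hj : 0 ≤ j) (hjk : j ≤ k) : trunc j (trunc k s) = trunc j s := by
  rcases le_total |s| k with h | h
  · rw [trunc_of_abs_le h]
  · rcases le_total 0 s with h0 | h0
    · rw [abs_of_nonneg h0] at h
      rw [trunc_of_le (hj.trans hjk) h, trunc_of_le hj hjk, trunc_of_le hj (hjk.trans h)]
    · rw [abs_of_nonpos h0] at h
      rw [trunc_of_le_neg (by linarith : s ≤ -k), trunc_of_le_neg (by linarith),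
        trunc_of_le_neg (by linarith)]

theorem hasDerivAt_trunc {k s : ℝ} (hk : 0 ≤ k) (hs : s ∉ ({k, -k} : Set ℝ)) :
    HasDerivAt (trunc k) ((Icc (-k) k).indicator 1 s) s := by
  simp only [mem_insert_iff, mem_singleton_iff, not_or] at hs
  rcases lt_or_ge k s with h | h
  · rw [indicator_of_notMem (fun h' => absurd h'.2 (not_le.2 h))]
    refine (hasDerivAt_const s k).congr_of_eventuallyEq ?_
    filter_upwards [lt_mem_nhds h] with t ht using trunc_of_le hk ht.le
  rcases lt_or_ge s (-k) with h' | h'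
  · rw [indicator_of_notMem (fun h'' => absurd h''.1 (not_le.2 h'))]
    refine (hasDerivAt_const s (-k)).congr_of_eventuallyEq ?_
    filter_upwards [gt_mem_nhds h'] with t ht using trunc_of_le_neg ht.le
  · rw [indicator_of_mem (show s ∈ Icc (-k) k from ⟨h', h⟩)]
    refine (hasDerivAt_id s).congr_of_eventuallyEq ?_
    filter_upwards [lt_mem_nhds (lt_of_le_of_ne h' (Ne.symm hs.2)),
      gt_mem_nhds (lt_of_le_of_ne h hs.1)] with t h1 h2
    exact trunc_of_abs_le (abs_le.2 ⟨h1.le, h2.le⟩)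

theorem tendsto_smoothTransition_mul {c : ℝ} (b : ℝ) (hc : c < 0) :
    Tendsto (fun n : ℕ => Real.smoothTransition (b + n * c)) atTop (𝓝 0) := by
  refine tendsto_const_nhds.congr' ?_
  obtain ⟨m, hm⟩ := exists_nat_gt (b / -c)
  filter_upwards [eventually_ge_atTop m] with n hn
  rw [Real.smoothTransition.zero_of_nonpos]
  rw [div_lt_iff₀ (by linarith)] at hm
  have : (m : ℝ) ≤ n := by exact_mod_cast hn
  nlinarith

/-- Truncation in `W^{1,q}_0`. -/
theorem IsW0.trunc [IsFiniteMeasure (volume.restrict Ω)] (h : IsW0 Ω q w G) (hq : 1 ≤ q)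
    (hq' : q ≠ ⊤) {k : ℝ} (hk : 0 ≤ k) :
    IsW0 Ω q (fun x => trunc k (w x)) ({x | |w x| ≤ k}.indicator G) := by
  -- The shift by 1 makes both factors equal to 1 at s = ±k, so the limit is the indicator of the
  -- closed interval at every point. This matches the set {|w| ≤ k} without discussing the gradient
  -- on {|w| = k}.
  have hlim : ∀ s : ℝ, Tendsto (fun n : ℕ => Real.smoothTransition (1 + n * (k - s)) *
      Real.smoothTransition (1 + n * (k + s))) atTop (𝓝 ((Icc (-k) k).indicator 1 s)) := by
    intro s
    by_cases hs : s ∈ Icc (-k) k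
    · rw [indicator_of_mem hs]
      refine tendsto_const_nhds.congr fun n => ?_
      have hn : (0 : ℝ) ≤ n := n.cast_nonneg
      rw [Real.smoothTransition.one_of_one_le, Real.smoothTransition.one_of_one_le]
      · simp
      · nlinarith [hs.1, hs.2]
      · nlinarith [hs.1, hs.2]
    · rw [indicator_of_notMem hs]
      rcases lt_or_ge k s with h | h
      · refine squeeze_zero (fun n => mul_nonneg (Real.smoothTransition.nonneg _)
          (Real.smoothTransition.nonneg _)) (fun n => mul_le_of_le_one_right
          (Real.smoothTransition.nonneg _) (Real.smoothTransition.le_one _))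
          (tendsto_smoothTransition_mul 1 (by linarith))
      · have h' : s < -k := by
          by_contra h'
          exact hs ⟨not_lt.1 h', h⟩
        refine squeeze_zero (fun n => mul_nonneg (Real.smoothTransition.nonneg _)
          (Real.smoothTransition.nonneg _)) (fun n => mul_le_of_le_one_left
          (Real.smoothTransition.nonneg _) (Real.smoothTransition.le_one _))
          (tendsto_smoothTransition_mul 1 (by linarith))
  obtain ⟨Fs, -, h1, h2, h3, h4⟩ := exists_smooth_primitives (F := EntropyDistributional.trunc k)
    (g := (Icc (-k) k).indicator 1) (C := 1) (D := {k, -k})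
    (gs := fun n s => Real.smoothTransition (1 + n * (k - s)) *
      Real.smoothTransition (1 + n * (k + s)))
    (fun n => (Real.smoothTransition.contDiff.comp (by fun_prop)).mul
      (Real.smoothTransition.contDiff.comp (by fun_prop)))
    (fun n s => by
      rw [abs_mul, abs_of_nonneg (Real.smoothTransition.nonneg _),
        abs_of_nonneg (Real.smoothTransition.nonneg _)]
      exact mul_le_one₀ (Real.smoothTransition.le_one _) (Real.smoothTransition.nonneg _)
        (Real.smoothTransition.le_one _))
    hlim (continuous_trunc k) (trunc_of_abs_le (by simpa using hk)) (Set.toFinite _).countable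
    (fun s hs => hasDerivAt_trunc hk hs)
  have hb : ∀ n s, |deriv (Fs n) s| ≤ 1 := by
    intro n s
    rw [h3 n, abs_mul, abs_of_nonneg (Real.smoothTransition.nonneg _),
        abs_of_nonneg (Real.smoothTransition.nonneg _)]
    exact mul_le_one₀ (Real.smoothTransition.le_one _) (Real.smoothTransition.nonneg _)
        (Real.smoothTransition.le_one _)
  refine IsW0.of_dominated hq hq' (fun n => h.comp_smooth hq hq' (h1 n) (h2 n) (hb n))
    h.memLp.norm h.memLp_grad.norm (fun n => Eventually.of_forall fun x => ?_)
    (fun n => Eventually.of_forall fun x => ?_) (Eventually.of_forall fun x => h4 _)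
    (Eventually.of_forall fun x => ?_)
  · have := abs_sub_le_of_deriv_bound ((h1 n).differentiable (by simp)) (hb n) (w x) 0
    simpa [h2 n] using this
  · rw [norm_smul]
    exact mul_le_of_le_one_left (norm_nonneg _) (hb n _)
  · have e : {x | |w x| ≤ k}.indicator G x = (Icc (-k) k).indicator (1 : ℝ → ℝ) (w x) • G x := by
      simp only [indicator, mem_ofPred_eq, mem_Icc, abs_le]
      split_ifs <;> simp
    rw [e]
    refine Tendsto.smul_const ?_ (G x)
    simp only [h3]
    exact hlim (w x)

/-- A smooth function which is positive exactly inside `Ω` belongs to `W^{1,q}_0(Ω)`. -/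
theorem isW0_of_pos [IsFiniteMeasure (volume.restrict Ω)] (hΩb : Bornology.IsBounded Ω)
    (hΩ : IsOpen Ω) (hq : 1 ≤ q) (hq' : q ≠ ⊤) {W : Euc N → ℝ} (hW : ContDiff ℝ ∞ W)
    (hpos : ∀ x ∈ Ω, 0 < W x) (hneg : ∀ x ∉ Ω, W x ≤ 0) : IsW0 Ω q W (gradient W) := by
  -- The shift by -1 makes the approximants vanish for ns ≤ 1, so that composing their primitives
  -- with W gives a support inside {nW ≥ 1}, a compact subset of Ω.
  have hlim : ∀ s : ℝ, Tendsto (fun n : ℕ => Real.smoothTransition (-1 + n * s)) atTop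
      (𝓝 ((Ioi 0).indicator 1 s)) := by
    intro s
    by_cases hs : 0 < s
    · rw [indicator_of_mem (show s ∈ Ioi (0 : ℝ) from hs)]
      refine tendsto_const_nhds.congr' ?_
      obtain ⟨m, hm⟩ := exists_nat_gt (2 / s)
      filter_upwards [eventually_ge_atTop m] with n hn
      rw [Real.smoothTransition.one_of_one_le, Pi.one_apply]
      rw [div_lt_iff₀ hs] at hm
      have : (m : ℝ) ≤ n := by exact_mod_cast hn
      nlinarith
    · rw [indicator_of_notMem (show s ∉ Ioi (0 : ℝ) from hs)]
      refine tendsto_const_nhds.congr fun n => ?_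
      rw [Real.smoothTransition.zero_of_nonpos]
      have hn : (0 : ℝ) ≤ n := n.cast_nonneg
      nlinarith [not_lt.1 hs]
  have hst : ∀ s, |Real.smoothTransition s| ≤ 1 := fun s => by
    rw [abs_of_nonneg (Real.smoothTransition.nonneg _)]
    exact Real.smoothTransition.le_one _
  obtain ⟨Fs, h0, h1, h2, h3, h4⟩ := exists_smooth_primitives (F := fun s => max s 0)
    (g := (Ioi 0).indicator 1) (C := 1) (D := {0})
    (gs := fun n s => Real.smoothTransition (-1 + n * s))
    (fun n => Real.smoothTransition.contDiff.comp (by fun_prop)) (fun n s => hst _) hlim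
    (by fun_prop) (by simp) (by simp) (by
      intro s hs
      rcases lt_or_gt_of_ne (show s ≠ 0 from hs) with h | h
      · rw [indicator_of_notMem (show s ∉ Ioi (0 : ℝ) from not_lt.2 h.le)]
        refine (hasDerivAt_const s (0 : ℝ)).congr_of_eventuallyEq ?_
        filter_upwards [gt_mem_nhds h] with t ht using max_eq_right ht.le
      · rw [indicator_of_mem (show s ∈ Ioi (0 : ℝ) from h)]
        refine (hasDerivAt_id s).congr_of_eventuallyEq ?_
        filter_upwards [lt_mem_nhds h] with t ht using max_eq_left ht.le)
  have hzero : ∀ (n : ℕ) (s : ℝ), s * n ≤ 1 → Fs n s = 0 := by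
    intro n s hs
    rw [h0]
    refine intervalIntegral.integral_zero_ae (Eventually.of_forall fun t ht => ?_)
    rw [Real.smoothTransition.zero_of_nonpos]
    have hn : (0 : ℝ) ≤ n := n.cast_nonneg
    rcases le_total 0 s with h | h
    · rw [uIoc_of_le h] at ht
      nlinarith [ht.2]
    · rw [uIoc_of_ge h] at ht
      nlinarith [ht.2]
  have hb : ∀ n s, |deriv (Fs n) s| ≤ 1 := by
    intro n s
    rw [h3 n]
    exact hst _
  have hWd : Differentiable ℝ W := hW.differentiable (by simp)
  have hgW : Continuous (gradient W) :=
    (InnerProductSpace.toDual ℝ (Euc N)).symm.continuous.comp (hW.continuous_fderiv (by simp))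
  have hcl : IsCompact (closure Ω) := hΩb.isCompact_closure
  have htest : ∀ n, IsTestFunction ∞ Ω (fun x => Fs n (W x)) := by
    intro n
    have hsub : tsupport (fun x => Fs n (W x)) ⊆ {x | 1 ≤ W x * n} := by
      refine closure_minimal (fun x hx => ?_)
        (isClosed_le continuous_const (hW.continuous.mul continuous_const))
      by_contra hx'
      exact hx (hzero n _ (le_of_lt (not_le.1 hx')))
    have hsub' : tsupport (fun x => Fs n (W x)) ⊆ Ω := by
      intro x hx
      by_contra hx'
      have e1 : 1 ≤ W x * n := hsub hx
      have e2 := hneg x hx'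
      have hn : (0 : ℝ) ≤ n := n.cast_nonneg
      nlinarith
    exact ⟨(h1 n).comp hW, hcl.of_isClosed_subset (isClosed_tsupport _)
      (hsub'.trans subset_closure), hsub'⟩
  obtain ⟨C₁, hC₁⟩ := hcl.exists_bound_of_continuousOn hW.continuous.continuousOn
  obtain ⟨C₂, hC₂⟩ := hcl.exists_bound_of_continuousOn hgW.continuousOn
  have hae : ∀ {P : Euc N → Prop}, (∀ x ∈ Ω, P x) → ∀ᵐ x ∂(volume.restrict Ω), P x := fun hP =>
    (ae_restrict_iff' hΩ.measurableSet).2 (Eventually.of_forall hP)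
  have hgr : ∀ n x, gradient (fun x => Fs n (W x)) x = deriv (Fs n) (W x) • gradient W x :=
    fun n x => gradient_comp ((h1 n).differentiable (by simp) _) (hWd x)
  refine IsW0.of_dominated hq hq' (fun n => (htest n).isW0) (memLp_const C₁) (memLp_const C₂)
    (fun n => hae fun x hx => ?_) (fun n => hae fun x hx => ?_) (hae fun x hx => ?_)
    (hae fun x hx => ?_)
  · have := abs_sub_le_of_deriv_bound ((h1 n).differentiable (by simp)) (hb n) (W x) 0
    rw [h2 n, sub_zero, sub_zero, one_mul] at this
    exact this.trans (hC₁ x (subset_closure hx))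
  · rw [hgr, norm_smul]
    exact (mul_le_of_le_one_left (norm_nonneg _) (hb n _)).trans (hC₂ x (subset_closure hx))
  · simpa [max_eq_left (hpos x hx).le] using h4 (W x)
  · simp only [hgr, h3]
    have := (hlim (W x)).smul_const (gradient W x)
    rwa [indicator_of_mem (show W x ∈ Ioi (0 : ℝ) from hpos x hx), Pi.one_apply, one_smul] at this

end

/-! ### C^1 test functions and the generalized gradient. -/

section
variable {Ω : Set (Euc N)} {q : ℝ≥0∞} {w w' : Euc N → ℝ} {G G' : Euc N → Euc N}

/-- Convolution with a bump of small radius: φ and its derivative are uniformly continuous,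
convolution commutes with differentiation, and the support grows by at most the radius. -/
theorem exists_mollification (hΩ : IsOpen Ω) {φ : Euc N → ℝ} (hφ : IsTestFunction 1 Ω φ) {ε : ℝ}
    (hε : 0 < ε) : ∃ η, IsTestFunction ∞ Ω η ∧ (∀ x, |η x - φ x| ≤ ε) ∧
      ∀ x, ‖gradient η x - gradient φ x‖ ≤ ε := by
  obtain ⟨δ, hδ, hδΩ⟩ := hφ.hasCompactSupport.isCompact.exists_cthickening_subset_open hΩ
    hφ.tsupport_subset
  have hc' : Continuous (fderiv ℝ φ) := hφ.contDiff.continuous_fderiv (by simp)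
  obtain ⟨δ₁, hδ₁, h1⟩ := Metric.uniformContinuous_iff.1
    (hφ.hasCompactSupport.uniformContinuous_of_continuous hφ.contDiff.continuous) ε hε
  obtain ⟨δ₂, hδ₂, h2⟩ := Metric.uniformContinuous_iff.1
    ((hφ.hasCompactSupport.fderiv (𝕜 := ℝ)).uniformContinuous_of_continuous hc') ε hε
  set r := min δ (min δ₁ δ₂) with hr
  have hr0 : 0 < r := by positivity
  let b : ContDiffBump (0 : Euc N) := ⟨r / 2, r, by positivity, by linarith⟩
  have hloc : LocallyIntegrable (b.normed volume) (volume : Measure (Euc N)) :=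
    b.continuous_normed.locallyIntegrable
  have hsub : tsupport (convolution (b.normed volume) φ (ContinuousLinearMap.lsmul ℝ ℝ) volume) ⊆
      Metric.cthickening δ (tsupport φ) := by
    refine closure_minimal (fun x hx => ?_) Metric.isClosed_cthickening
    obtain ⟨y, hy, z, hz, rfl⟩ := support_convolution_subset _ hx
    rw [b.support_normed_eq] at hy
    refine Metric.mem_cthickening_of_dist_le _ z _ _ (subset_closure hz) ?_
    simp only [Metric.mem_ball, dist_zero_right] at hy
    simp only [dist_eq_norm, add_sub_cancel_right]
    exact hy.le.trans (min_le_left _ _)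
  have hfd : ∀ x, fderiv ℝ (convolution (b.normed volume) φ (ContinuousLinearMap.lsmul ℝ ℝ)
      volume) x = convolution (b.normed volume) (fderiv ℝ φ) (ContinuousLinearMap.lsmul ℝ ℝ)
      volume x := by
    intro x
    rw [(hφ.hasCompactSupport.hasFDerivAt_convolution_right (ContinuousLinearMap.lsmul ℝ ℝ) hloc
      hφ.contDiff x).fderiv]
    simp only [convolution_def]
    refine integral_congr_ae (Eventually.of_forall fun t => ?_)
    ext v
    simp
  refine ⟨convolution (b.normed volume) φ (ContinuousLinearMap.lsmul ℝ ℝ) volume,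
    ⟨?_, ?_, hsub.trans hδΩ⟩, fun x => ?_, fun x => ?_⟩
  · exact b.hasCompactSupport_normed.contDiff_convolution_left _ b.contDiff_normed
      hφ.contDiff.continuous.locallyIntegrable
  · exact hφ.hasCompactSupport.isCompact.cthickening.of_isClosed_subset (isClosed_tsupport _) hsub
  · rw [← Real.dist_eq]
    refine ContDiffBump.dist_normed_convolution_le hφ.contDiff.continuous.aestronglyMeasurable
      fun y hy => (h1 ?_).le
    exact (Metric.mem_ball.1 hy).trans_le ((min_le_right _ _).trans (min_le_left _ _))
  · have : ‖fderiv ℝ (convolution (b.normed volume) φ (ContinuousLinearMap.lsmul ℝ ℝ) volume) x -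
        fderiv ℝ φ x‖ ≤ ε := by
      rw [hfd, ← dist_eq_norm]
      refine ContDiffBump.dist_normed_convolution_le hc'.aestronglyMeasurable
        fun y hy => (h2 ?_).le
      exact (Metric.mem_ball.1 hy).trans_le ((min_le_right _ _).trans (min_le_right _ _))
    rwa [gradient, gradient, ← map_sub, LinearIsometryEquiv.norm_map]

/-- Distributional solutions are tested with C^1 functions, whereas W^{1,q}_0 is built from smooth
ones; mollification reconciles the two. -/
theorem IsTestFunction.isW0_one [IsFiniteMeasure (volume.restrict Ω)] (hΩ : IsOpen Ω)
    (hφ : IsTestFunction 1 Ω w) (hq : 1 ≤ q) (hq' : q ≠ ⊤) : IsW0 Ω q w (gradient w) := by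
  obtain ⟨C, hC⟩ := hφ.hasCompactSupport.exists_bound_of_continuous hφ.contDiff.continuous
  obtain ⟨C', hC'⟩ := hφ.hasCompactSupport_gradient.exists_bound_of_continuous
    (hφ.continuous_gradient le_rfl)
  choose η h1 h2 h3 using fun n : ℕ => exists_mollification hΩ hφ (ε := 1 / ((n : ℝ) + 1))
    (by positivity)
  have hle : ∀ n : ℕ, 1 / ((n : ℝ) + 1) ≤ 1 := fun n => by
    rw [div_le_one (by positivity)]; linarith [n.cast_nonneg (α := ℝ)]
  refine IsW0.of_dominated hq hq' (fun n => (h1 n).isW0) (memLp_const (C + 1))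
    (memLp_const (C' + 1)) (fun n => Eventually.of_forall fun x => ?_)
    (fun n => Eventually.of_forall fun x => ?_) (Eventually.of_forall fun x => ?_)
    (Eventually.of_forall fun x => ?_)
  · have := norm_le_norm_add_norm_sub' (η n x) (w x)
    exact this.trans (add_le_add (hC x) ((h2 n x).trans (hle n)))
  · have := norm_le_norm_add_norm_sub' (gradient (η n) x) (gradient w x)
    exact this.trans (add_le_add (hC' x) ((h3 n x).trans (hle n)))
  · rw [tendsto_iff_dist_tendsto_zero]
    exact squeeze_zero (fun _ => dist_nonneg) (fun n => h2 n x)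
      tendsto_one_div_add_atTop_nhds_zero_nat
  · rw [tendsto_iff_norm_sub_tendsto_zero]
    exact squeeze_zero (fun _ => norm_nonneg _) (fun n => h3 n x)
      tendsto_one_div_add_atTop_nhds_zero_nat

/-- All truncations of `u` are in `W^{1,q}_0(Ω)`, with generalized gradient `v`. -/
structure IsTruncW0 (Ω : Set (Euc N)) (q : ℝ≥0∞) (u : Euc N → ℝ) (v : Euc N → Euc N) : Prop where
  aestronglyMeasurable : AEStronglyMeasurable v (volume.restrict Ω)
  isW0 : ∀ k : ℝ, 0 < k → IsW0 Ω q (fun x => trunc k (u x)) ({x | |u x| ≤ k}.indicator v)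

theorem IsTruncW0.isGenGrad [IsFiniteMeasure (volume.restrict Ω)] (hq : 1 ≤ q)
    {u : Euc N → ℝ} {v : Euc N → Euc N} (h : IsTruncW0 Ω q u v) : IsGenGrad Ω u v :=
  ⟨h.aestronglyMeasurable, fun k hk => (h.isW0 k hk).hasWeakGrad hq⟩

/-- For j < k the identity T_j(T_k(u)) = T_j(u) and uniqueness of weak gradients make the gradients
of the truncations compatible, so they glue. -/
theorem exists_isTruncW0 [IsFiniteMeasure (volume.restrict Ω)] (hΩ : IsOpen Ω) (hq : 1 ≤ q)
    (hq' : q ≠ ⊤) {u : Euc N → ℝ}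
    (h : ∀ k : ℝ, 0 < k → ∃ G, IsW0 Ω q (fun x => trunc k (u x)) G) :
    ∃ v, IsTruncW0 Ω q u v := by
  choose! G hG using h
  have hcompat : ∀ j k : ℝ, 0 < j → j < k →
      ∀ᵐ x ∂(volume.restrict Ω), G j x = {x | |u x| ≤ j}.indicator (G k) x := by
    intro j k hj hjk
    have h1 := (hG k (hj.trans hjk)).trunc hq hq' hj.le
    refine ((hG j hj).hasWeakGrad hq).unique hΩ (h1.congr (G' := {x | |u x| ≤ j}.indicator (G k))
      EventuallyEq.rfl (Eventually.of_forall fun x => ?_) |>.hasWeakGrad hq)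
      (Eventually.of_forall fun x => ?_)
    · have e : |trunc k (u x)| ≤ j ↔ |u x| ≤ j := by
        constructor
        · intro hx
          rcases le_total (|u x|) k with h2 | h2
          · rwa [trunc_of_abs_le h2] at hx
          · exfalso
            rcases le_total 0 (u x) with h0 | h0
            · rw [abs_of_nonneg h0] at h2
              rw [trunc_of_le (hj.trans hjk).le h2, abs_of_pos (hj.trans hjk)] at hx
              linarith
            · rw [abs_of_nonpos h0] at h2
              rw [trunc_of_le_neg (by linarith), abs_neg, abs_of_pos (hj.trans hjk)] at hx
              linarith
        · exact (abs_trunc_le_abs (hj.trans hjk).le _).trans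
      simp only [indicator, mem_ofPred_eq, e]
    · exact (trunc_trunc hj.le hjk.le).symm
  -- Only countably many levels occur, so the exceptional null sets can be united; the added 1 keeps
  -- the level positive and at least |u x|.
  let v : Euc N → Euc N := fun x => G ((⌈|u x|⌉₊ : ℝ) + 1) x
  have hv : ∀ k : ℝ, 0 < k → ∀ᵐ x ∂(volume.restrict Ω), G k x = {x | |u x| ≤ k}.indicator v x := by
    intro k hk
    have e1 : ∀ᵐ x ∂(volume.restrict Ω), ∀ n : ℕ, k < (n : ℝ) + 1 →
        G k x = {x | |u x| ≤ k}.indicator (G ((n : ℝ) + 1)) x := by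
      refine ae_all_iff.2 fun n => ?_
      by_cases hn : k < (n : ℝ) + 1
      · filter_upwards [hcompat k _ hk hn] with x hx _ using hx
      · exact Eventually.of_forall fun x h => absurd h hn
    have e2 : ∀ᵐ x ∂(volume.restrict Ω), ∀ n m : ℕ, n < m →
        G ((n : ℝ) + 1) x = {x | |u x| ≤ (n : ℝ) + 1}.indicator (G ((m : ℝ) + 1)) x := by
      refine ae_all_iff.2 fun n => ae_all_iff.2 fun m => ?_
      by_cases hnm : n < m
      · have : (n : ℝ) + 1 < m + 1 := by exact_mod_cast Nat.succ_lt_succ hnm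
        filter_upwards [hcompat _ _ (by positivity) this] with x hx _ using hx
      · exact Eventually.of_forall fun x h => absurd h hnm
    filter_upwards [e1, e2] with x h1 h2
    obtain ⟨m, hm⟩ := exists_nat_gt (max k (⌈|u x|⌉₊ : ℝ))
    rw [h1 m (by linarith [le_max_left k (⌈|u x|⌉₊ : ℝ)])]
    by_cases hx : |u x| ≤ k
    · rw [indicator_of_mem (by exact hx), indicator_of_mem (by exact hx)]
      have hlt : ⌈|u x|⌉₊ < m := by exact_mod_cast (le_max_right _ _).trans_lt hm
      have := h2 _ _ hlt
      have hle : x ∈ {x_1 | |u x_1| ≤ (⌈|u x|⌉₊ : ℝ) + 1} := by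
        show |u x| ≤ (⌈|u x|⌉₊ : ℝ) + 1
        linarith [Nat.le_ceil |u x|]
      rw [indicator_of_mem hle] at this
      exact this.symm
    · rw [indicator_of_notMem (by exact hx), indicator_of_notMem (by exact hx)]
  have hvm : AEStronglyMeasurable v (volume.restrict Ω) := by
    refine aestronglyMeasurable_of_tendsto_ae (f := fun n : ℕ => G ((n : ℝ) + 1)) atTop
      (fun n => (hG _ (by positivity)).memLp_grad.1) ?_
    filter_upwards [ae_all_iff.2 fun n : ℕ => hv ((n : ℝ) + 1) (by positivity)] with x hx
    refine tendsto_const_nhds.congr' ?_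
    filter_upwards [eventually_ge_atTop ⌈|u x|⌉₊] with n hn
    rw [hx n, indicator_of_mem]
    have : ((⌈|u x|⌉₊ : ℕ) : ℝ) ≤ n := by exact_mod_cast hn
    show |u x| ≤ (n : ℝ) + 1
    linarith [Nat.le_ceil |u x|]
  exact ⟨v, hvm, fun k hk => (hG k hk).congr EventuallyEq.rfl (hv k hk)⟩

theorem isTruncW0_genGrad [IsFiniteMeasure (volume.restrict Ω)] (hΩ : IsOpen Ω) (hq : 1 ≤ q)
    (hq' : q ≠ ⊤) {u : Euc N → ℝ}
    (h : ∀ k : ℝ, 0 < k → ∃ G, IsW0 Ω q (fun x => trunc k (u x)) G) :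
    IsTruncW0 Ω q u (genGrad Ω u) := by
  obtain ⟨v, hv⟩ := exists_isTruncW0 hΩ hq hq' h
  have hex : ∃ v, IsGenGrad Ω u v := ⟨v, hv.isGenGrad hq⟩
  have hs : IsGenGrad Ω u (genGrad Ω u) := by
    rw [genGrad, dif_pos hex]
    exact hex.choose_spec
  refine ⟨hs.aestronglyMeasurable, fun k hk => (hv.isW0 k hk).congr EventuallyEq.rfl ?_⟩
  exact ((hv.isW0 k hk).hasWeakGrad hq).unique hΩ (hs.hasWeakGrad k hk) EventuallyEq.rfl

/-- Two different exponents are allowed: the generalized gradient depends only on u. -/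
theorem IsTruncW0.ae_eq [IsFiniteMeasure (volume.restrict Ω)] (hΩ : IsOpen Ω) (hq : 1 ≤ q)
    {q' : ℝ≥0∞} (hq' : 1 ≤ q') {u : Euc N → ℝ} {v v' : Euc N → Euc N} (h : IsTruncW0 Ω q u v)
    (h' : IsTruncW0 Ω q' u v') : v =ᵐ[volume.restrict Ω] v' := by
  have : ∀ n : ℕ, ∀ᵐ x ∂(volume.restrict Ω), {x | |u x| ≤ (n : ℝ) + 1}.indicator v x =
      {x | |u x| ≤ (n : ℝ) + 1}.indicator v' x := fun n =>
    ((h.isW0 _ (by positivity)).hasWeakGrad hq).unique hΩ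
      ((h'.isW0 _ (by positivity)).hasWeakGrad hq') EventuallyEq.rfl
  filter_upwards [ae_all_iff.2 this] with x hx
  have h1 := hx ⌈|u x|⌉₊
  have h2 : |u x| ≤ (⌈|u x|⌉₊ : ℝ) + 1 := (Nat.le_ceil _).trans (by linarith)
  rwa [indicator_of_mem (by exact h2), indicator_of_mem (by exact h2)] at h1

end

/-! ### The Sobolev inequality and its weak form. -/

section
open scoped NNReal
/-- The Sobolev inequality in `W^{1,p}_0`, with constant independent of the domain. -/
theorem exists_sobolev_const (N : ℕ) {p : ℝ} (hp : 1 ≤ p) (hpN : p < N) :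
    ∃ C : ℝ≥0, ∀ (Ω : Set (Euc N)) (w : Euc N → ℝ) (G : Euc N → Euc N),
      IsW0 Ω (ENNReal.ofReal p) w G →
      eLpNorm w (ENNReal.ofReal (N * p / (N - p))) (volume.restrict Ω) ≤
        C * eLpNorm G (ENNReal.ofReal p) (volume.restrict Ω) := by
  have hN : (0 : ℝ) < N := by linarith
  refine ⟨SNormLESNormFDerivOfEqConst ℝ (volume : Measure (Euc N)) p.toNNReal, fun Ω w G h => ?_⟩
  have hq : 1 ≤ ENNReal.ofReal p := by simpa using hp
  obtain ⟨η, h1, h2, h3, h4⟩ := h.exists_seq hq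
  -- Fatou along an a.e. convergent sequence of test functions; membership of w in the target
  -- Lebesgue space is thus obtained, not assumed.
  refine (Lp.eLpNorm_lim_le_liminf_eLpNorm
    (fun n => (h1 n).contDiff.continuous.aestronglyMeasurable) w h4).trans ?_
  have hgn : ∀ n, eLpNorm (η n) (ENNReal.ofReal (N * p / (N - p))) (volume.restrict Ω) ≤
      SNormLESNormFDerivOfEqConst ℝ (volume : Measure (Euc N)) p.toNNReal *
      (eLpNorm (fun x => gradient (η n) x - G x) (ENNReal.ofReal p) (volume.restrict Ω) +
        eLpNorm G (ENNReal.ofReal p) (volume.restrict Ω)) := by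
    intro n
    have hs := eLpNorm_le_eLpNorm_fderiv_of_eq (volume : Measure (Euc N))
      (u := η n) (F := ℝ) (p := p.toNNReal) (p' := (N * p / (N - p)).toNNReal)
      ((h1 n).contDiff.of_le (by simp)) (h1 n).hasCompactSupport (by simpa using hp)
      (by simpa using hN) (by
        have hNp : (N : ℝ) - p ≠ 0 := by linarith
        rw [Real.coe_toNNReal _ (div_nonneg (by nlinarith) (by linarith)), NNReal.coe_inv,
          Real.coe_toNNReal _ (by linarith), finrank_euclideanSpace_fin]
        field_simp)
    refine (eLpNorm_mono_measure _ Measure.restrict_le_self).trans (hs.trans ?_)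
    refine mul_le_mul' le_rfl ?_
    have e : eLpNorm (fderiv ℝ (η n)) (p.toNNReal : ℝ≥0∞) volume =
        eLpNorm (gradient (η n)) (ENNReal.ofReal p) (volume.restrict Ω) := by
      rw [eLpNorm_restrict_eq_of_support_subset]
      · exact eLpNorm_congr_norm_ae (Eventually.of_forall fun x => (norm_gradient_eq _ _).symm)
      · intro x hx
        refine (h1 n).tsupport_subset (support_fderiv_subset ℝ (f := η n) ?_)
        simp only [Function.mem_support] at hx ⊢
        intro h0
        apply hx
        rw [gradient, h0, map_zero]
    rw [e]
    have := eLpNorm_sub_le_add (f := gradient (η n)) (g := G) (h := 0) hq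
      ((h1 n).continuous_gradient (by simp)).aestronglyMeasurable h.memLp_grad.1
      (aestronglyMeasurable_zero (μ := volume.restrict Ω))
    simpa using this
  refine (liminf_le_liminf (Eventually.of_forall hgn)).trans_eq ?_
  refine Tendsto.liminf_eq ?_
  have := ENNReal.Tendsto.const_mul
    (a := (SNormLESNormFDerivOfEqConst ℝ (volume : Measure (Euc N)) p.toNNReal : ℝ≥0∞))
    (h3.add_const (eLpNorm G (ENNReal.ofReal p) (volume.restrict Ω))) (Or.inr (by simp))
  simpa using this

/-- The weak-type consequence of the Sobolev inequality. -/
theorem exists_level_set_const (N : ℕ) {p : ℝ} (hp : 1 ≤ p) (hpN : p < N) :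
    ∃ C : ℝ, 0 < C ∧ ∀ (Ω : Set (Euc N)) (w : Euc N → ℝ) (G : Euc N → Euc N) (t : ℝ), 0 < t →
      IsW0 Ω (ENNReal.ofReal p) w G →
      t ^ p * ((volume.restrict Ω).real {x | t ≤ |w x|}) ^ ((N - p) / N) ≤
        C * ∫ x in Ω, ‖G x‖ ^ p := by
  obtain ⟨C, hC⟩ := exists_sobolev_const N hp hpN
  have hN : (0 : ℝ) < N := by linarith
  have hp0 : 0 < p := by linarith
  have hps : 0 < N * p / (N - p) := div_pos (by positivity) (by linarith)
  refine ⟨(C : ℝ) ^ p + 1, by positivity, fun Ω w G t ht h => ?_⟩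
  have hG0 : 0 ≤ ∫ x in Ω, ‖G x‖ ^ p := integral_nonneg fun x => by positivity
  have h1 := hC Ω w G h
  have hmeas := mul_meas_ge_le_pow_eLpNorm' (volume.restrict Ω)
    (p := ENNReal.ofReal (N * p / (N - p))) (by simpa using hps)
    ENNReal.ofReal_ne_top h.memLp.1 (ENNReal.ofReal t)
  rw [ENNReal.toReal_ofReal hps.le] at hmeas
  have h2 : eLpNorm G (ENNReal.ofReal p) (volume.restrict Ω) ^ p =
      ENNReal.ofReal (∫ x in Ω, ‖G x‖ ^ p) := by
    rw [h.memLp_grad.eLpNorm_eq_integral_rpow_norm (by simpa using hp0) ENNReal.ofReal_ne_top,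
      ENNReal.toReal_ofReal hp0.le, ENNReal.ofReal_rpow_of_nonneg (by positivity) hp0.le,
      ← Real.rpow_mul hG0, inv_mul_cancel₀ hp0.ne', Real.rpow_one]
  have hset : {x | ENNReal.ofReal t ≤ ‖w x‖ₑ} = {x | t ≤ |w x|} := by
    ext x
    simp only [mem_ofPred_eq]
    rw [← ofReal_norm, ENNReal.ofReal_le_ofReal_iff (norm_nonneg _), Real.norm_eq_abs]
  rw [hset] at hmeas
  set A := (volume.restrict Ω) {x | t ≤ |w x|} with hA
  have h3 : ENNReal.ofReal (t ^ p) * A ^ ((N - p) / N) ≤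
      ENNReal.ofReal ((C : ℝ) ^ p * ∫ x in Ω, ‖G x‖ ^ p) := by
    -- Chebyshev's inequality with exponent p* = Np/(N-p), raised to the power (N-p)/N = p/p*.
    have h4 := ENNReal.rpow_le_rpow (hmeas.trans (ENNReal.rpow_le_rpow h1 hps.le))
      (z := (N - p) / N) (div_nonneg (by linarith) hN.le)
    have e : N * p / (N - p) * ((N - p) / N) = p := by
      have : (N : ℝ) - p ≠ 0 := by linarith
      field_simp
    rw [ENNReal.mul_rpow_of_nonneg _ _ (div_nonneg (by linarith) hN.le), ← ENNReal.rpow_mul,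
      ← ENNReal.rpow_mul, e, ENNReal.mul_rpow_of_nonneg _ _ hp0.le, h2] at h4
    rwa [ENNReal.ofReal_mul (by positivity), ← ENNReal.ofReal_rpow_of_nonneg ht.le hp0.le,
      ← ENNReal.ofReal_rpow_of_nonneg C.coe_nonneg hp0.le, ENNReal.ofReal_coe_nnreal]
  have h5 := ENNReal.toReal_mono ENNReal.ofReal_ne_top h3
  rw [ENNReal.toReal_mul, ENNReal.toReal_ofReal (by positivity), ENNReal.toReal_ofReal
    (by positivity), ← ENNReal.toReal_rpow] at h5
  refine h5.trans ?_
  gcongr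
  linarith

end

/-! ### The flux of an entropy solution and the energy of its slices. -/

section
variable {Ω : Set (Euc N)} {q : ℝ≥0∞} {u : Euc N → ℝ} {v : Euc N → Euc N}

theorem IsTruncW0.isW0_slice [IsFiniteMeasure (volume.restrict Ω)] (h : IsTruncW0 Ω q u v)
    (hq : 1 ≤ q) (h0 : ∀ᵐ x ∂(volume.restrict Ω), 0 ≤ u x) {j k : ℝ} (hj : 0 < j) (hjk : j ≤ k) :
    IsW0 Ω q (fun x => trunc k (u x) - trunc j (u x)) ({x | j < u x ∧ u x ≤ k}.indicator v) := by
  refine ((h.isW0 k (hj.trans_le hjk)).sub (h.isW0 j hj) hq).congr EventuallyEq.rfl ?_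
  filter_upwards [h0] with x hx
  simp only [indicator, mem_ofPred_eq, abs_of_nonneg hx]
  by_cases h1 : u x ≤ j
  · simp [h1, h1.trans hjk, not_lt.2 h1]
  · by_cases h2 : u x ≤ k
    · simp [h1, h2, not_le.1 h1]
    · simp [h1, h2]

variable {p : ℝ} {a : Euc N → ℝ → Euc N → Euc N} {h : ℝ → ℝ≥0∞} {f : Euc N → ℝ}

theorem IsEntropySolution.isTruncW0 [IsFiniteMeasure (volume.restrict Ω)] (hΩ : IsOpen Ω)
    (hp : 1 < p) (hu : IsEntropySolution Ω p a h f u) :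
    IsTruncW0 Ω (ENNReal.ofReal p) u (genGrad Ω u) :=
  isTruncW0_genGrad hΩ (by simpa using hp.le) ENNReal.ofReal_ne_top fun k hk =>
    (memW0_iff hp.le).1 (hu.trunc_mem k hk)

/-- The flux `a(x, u, ∇u)`. -/
def flux (Ω : Set (Euc N)) (a : Euc N → ℝ → Euc N → Euc N) (u : Euc N → ℝ) (x : Euc N) : Euc N :=
  a x (u x) (genGrad Ω u x)

theorem nullMeasurableSet_abs_le (hu : AEMeasurable u (volume.restrict Ω)) (k : ℝ) :
    NullMeasurableSet {x | |u x| ≤ k} (volume.restrict Ω) :=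
  nullMeasurableSet_le hu.norm aemeasurable_const

theorem IsEntropySolution.memLp_flux [IsFiniteMeasure (volume.restrict Ω)] (hΩ : IsOpen Ω)
    (hp : 1 < p) (hu : IsEntropySolution Ω p a h f u) {k : ℝ} (hk : 0 < k) :
    MemLp ({x | |u x| ≤ k}.indicator (flux Ω a u)) (ENNReal.ofReal (p / (p - 1)))
      (volume.restrict Ω) := by
  have h1 := hu.flux_memLp k hk
  have hT := (hu.isTruncW0 hΩ hp).isW0 k hk
  have h2 := (hT.hasWeakGrad (by simpa using hp.le)).weakGrad_ae_eq hΩ (EventuallyEq.refl _ _)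
  have h3 : {x | |u x| ≤ k}.indicator (flux Ω a u) =ᵐ[volume.restrict Ω]
      {x | |u x| ≤ k}.indicator
        (fun x => a x (trunc k (u x)) (weakGrad Ω (fun y => trunc k (u y)) x)) := by
    filter_upwards [h2] with x hx
    by_cases hxk : |u x| ≤ k
    · rw [indicator_of_mem (by exact hxk), indicator_of_mem (by exact hxk), hx,
        indicator_of_mem (by exact hxk), trunc_of_abs_le hxk, flux]
    · rw [indicator_of_notMem (by exact hxk), indicator_of_notMem (by exact hxk)]
  refine (h1.mono (h1.1.indicator₀ (nullMeasurableSet_abs_le hu.aemeasurable k))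
    (Eventually.of_forall fun x => norm_indicator_le_norm_self _ _)).ae_eq h3.symm

theorem IsEntropySolution.aestronglyMeasurable_flux [IsFiniteMeasure (volume.restrict Ω)]
    (hΩ : IsOpen Ω) (hp : 1 < p) (hu : IsEntropySolution Ω p a h f u) :
    AEStronglyMeasurable (flux Ω a u) (volume.restrict Ω) := by
  refine aestronglyMeasurable_of_tendsto_ae atTop
    (fun n : ℕ => (hu.memLp_flux hΩ hp (k := (n : ℝ) + 1) (by positivity)).1)
    (Eventually.of_forall fun x => ?_)
  refine tendsto_const_nhds.congr' ?_
  obtain ⟨m, hm⟩ := exists_nat_gt |u x|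
  filter_upwards [eventually_ge_atTop m] with n hn
  have : (m : ℝ) ≤ n := by exact_mod_cast hn
  exact (indicator_of_mem (show x ∈ {x | |u x| ≤ (n : ℝ) + 1} from
    show |u x| ≤ (n : ℝ) + 1 by linarith) _).symm

/-- The flux is known to be in L^{p'} only on {|u| ≤ k}, hence Hölder's inequality is applied to
fields vanishing above the level k. -/
theorem IsEntropySolution.integrable_inner_flux [IsFiniteMeasure (volume.restrict Ω)]
    (hΩ : IsOpen Ω) (hp : 1 < p) (hu : IsEntropySolution Ω p a h f u) {k : ℝ} (hk : 0 < k)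
    {G : Euc N → Euc N} (hG : MemLp G (ENNReal.ofReal p) (volume.restrict Ω))
    (hG0 : ∀ᵐ x ∂(volume.restrict Ω), k < |u x| → G x = 0) :
    Integrable (fun x => inner ℝ (flux Ω a u x) (G x)) (volume.restrict Ω) := by
  have hc : (p / (p - 1)).HolderConjugate p := (Real.HolderConjugate.conjExponent hp).symm
  have := hc.ennrealOfReal
  have h1 := (hu.memLp_flux hΩ hp hk).norm.integrable_mul hG.norm
  refine h1.mono' ((hu.aestronglyMeasurable_flux hΩ hp).inner hG.1) ?_
  filter_upwards [hG0] with x hx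
  by_cases hxk : |u x| ≤ k
  · simp only [Pi.mul_apply]
    rw [indicator_of_mem (by exact hxk)]
    exact norm_inner_le_norm _ _
  · rw [hx (not_le.1 hxk), inner_zero_right, norm_zero]
    exact mul_nonneg (norm_nonneg _) (norm_nonneg _)

/-- The energy estimate on the slices `{j < u ≤ 2j}`. -/
theorem IsEntropySolution.slice_energy_le [IsFiniteMeasure (volume.restrict Ω)] (hΩ : IsOpen Ω)
    (hp : 1 < p) {θ γ₂ : ℝ} (hθ : 0 ≤ θ) (hγ : 0 ≤ γ₂) (ha : IsAdmissibleOperator Ω p θ a)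
    (hh : IsAdmissibleSource γ₂ h) (hf0 : ∀ᵐ x ∂(volume.restrict Ω), 0 ≤ f x)
    (hf : Integrable f (volume.restrict Ω)) (hu : IsEntropySolution Ω p a h f u) :
    ∃ C j₀ : ℝ, 0 < C ∧ 1 ≤ j₀ ∧ ∀ j : ℝ, j₀ ≤ j →
      ∫ x in Ω, ‖{x | j < u x ∧ u x ≤ 2 * j}.indicator (genGrad Ω u) x‖ ^ p ≤
        C * j ^ (1 + θ * (p - 1) - γ₂) * ∫ x in Ω, {x | j < u x}.indicator f x := by
  obtain ⟨b, -, -, ⟨α, hα, hb⟩, hcoer⟩ := ha.coercive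
  obtain ⟨c₂, s₂, hc₂, hs₂, hdecay⟩ := hh.decay
  have hp1 : 0 < p - 1 := by linarith
  -- On the slice 1 + u ≤ 1 + 2j ≤ 4j, which uses j ≥ 1 and produces the power of 4; j ≥ s₂ puts u >
  -- j in the decay range of h.
  refine ⟨c₂ * 4 ^ (θ * (p - 1)) / α, max 1 s₂, by positivity, le_max_left _ _, fun j hj => ?_⟩
  have hj1 : 1 ≤ j := (le_max_left _ _).trans hj
  have hjs : s₂ ≤ j := (le_max_right _ _).trans hj
  have hj0 : 0 < j := by linarith
  have hq : 1 ≤ ENNReal.ofReal p := by simpa using hp.le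
  have hT := hu.isTruncW0 hΩ hp
  have hS := hT.isW0_slice hq hu.nonneg hj0 (by linarith : j ≤ 2 * j)
  have hφ := hT.isW0 j hj0
  have hent := hu.entropy_le j (fun x => trunc j (u x)) hj0 ((memW0_iff hp.le).2 ⟨_, hφ⟩)
    (memLp_top_of_bound hφ.memLp.1 j (Eventually.of_forall fun x => abs_trunc_le hj0.le _))
  have hrhs := (hu.rhs_integrable j (fun x => trunc j (u x)) hj0 ((memW0_iff hp.le).2 ⟨_, hφ⟩)
    (memLp_top_of_bound hφ.memLp.1 j (Eventually.of_forall fun x => abs_trunc_le hj0.le _))).2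
  -- With φ = T_j(u) and k = j, the test function is T_{2j}(u) - T_j(u), whose gradient lives on {j
  -- < u ≤ 2j}.
  have hfun : (fun y => trunc j (u y - trunc j (u y))) =ᵐ[volume.restrict Ω]
      (fun x => trunc (2 * j) (u x) - trunc j (u x)) := by
    filter_upwards [hu.nonneg] with x hx
    rw [trunc_of_nonneg hj0.le hx, trunc_of_nonneg (by linarith) hx]
    rcases le_total (u x) j with h1 | h1
    · rw [min_eq_left h1, min_eq_left (by linarith), sub_self,
        trunc_of_abs_le (by simpa using hj0.le)]
    · rw [min_eq_right h1, trunc_of_nonneg hj0.le (by linarith)]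
      rcases le_total (u x) (2 * j) with h2 | h2
      · rw [min_eq_left h2, min_eq_left (by linarith)]
      · rw [min_eq_right h2, min_eq_right (by linarith)]; ring
  have hgrad := (hS.hasWeakGrad hq).weakGrad_ae_eq hΩ hfun
  set S : Set (Euc N) := {x | j < u x ∧ u x ≤ 2 * j} with hSdef
  have hint : Integrable (fun x => inner ℝ (flux Ω a u x) (S.indicator (genGrad Ω u) x))
      (volume.restrict Ω) := by
    refine hu.integrable_inner_flux hΩ hp (k := 2 * j) (by linarith) hS.memLp_grad ?_
    filter_upwards [hu.nonneg] with x hx hx'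
    rw [abs_of_nonneg hx] at hx'
    exact indicator_of_notMem (fun h => absurd h.2 (not_le.2 hx')) _
  have hintp : Integrable (fun x => ‖S.indicator (genGrad Ω u) x‖ ^ p) (volume.restrict Ω) := by
    have := hS.memLp_grad.integrable_norm_rpow (by simpa using by linarith) ENNReal.ofReal_ne_top
    rwa [ENNReal.toReal_ofReal (by linarith)] at this
  have e1 : ∫ x in Ω, inner ℝ (flux Ω a u x) (S.indicator (genGrad Ω u) x) ≤
      ∫ x in Ω, (rhs h f u x).toReal * trunc j (u x - trunc j (u x)) := by
    refine le_trans (le_of_eq (integral_congr_ae ?_)) hent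
    filter_upwards [hgrad] with x hx
    rw [hx]
    rfl
  have e2 : α / (4 * j) ^ (θ * (p - 1)) * ∫ x in Ω, ‖S.indicator (genGrad Ω u) x‖ ^ p ≤
      ∫ x in Ω, inner ℝ (flux Ω a u x) (S.indicator (genGrad Ω u) x) := by
    rw [← integral_const_mul]
    refine integral_mono_ae (hintp.const_mul _) hint ?_
    filter_upwards [hcoer, hu.nonneg] with x hx h0
    by_cases hxS : x ∈ S
    · rw [indicator_of_mem hxS]
      refine le_trans ?_ (hx (u x) (genGrad Ω u x))
      gcongr
      refine le_trans ?_ (hb (u x))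
      gcongr
      rw [abs_of_nonneg h0]
      linarith [hxS.2]
    · rw [indicator_of_notMem hxS, inner_zero_right, norm_zero, Real.zero_rpow (by linarith),
        mul_zero]
  have hindf : Integrable ({x | j < u x}.indicator f) (volume.restrict Ω) :=
    hf.indicator₀ (nullMeasurableSet_lt aemeasurable_const hu.aemeasurable)
  -- The test function vanishes on {u ≤ j} and is at most j elsewhere, where h(u) ≤ c₂ j^{-γ₂}.
  have e3 : ∫ x in Ω, (rhs h f u x).toReal * trunc j (u x - trunc j (u x)) ≤
      c₂ * j ^ (1 - γ₂) * ∫ x in Ω, {x | j < u x}.indicator f x := by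
    rw [← integral_const_mul]
    refine integral_mono_ae hrhs (hindf.const_mul _) ?_
    filter_upwards [hu.nonneg, hf0] with x hx hfx
    by_cases hxj : j < u x
    · rw [indicator_of_mem (by exact hxj)]
      have h1 : (rhs h f u x).toReal ≤ c₂ * j ^ (-γ₂) * f x := by
        rw [rhs, ENNReal.toReal_mul, ENNReal.toReal_ofReal hfx]
        refine mul_le_mul_of_nonneg_right ?_ hfx
        refine ENNReal.toReal_le_of_le_ofReal (by positivity)
          ((hdecay (u x) (hjs.trans hxj.le)).trans (ENNReal.ofReal_le_ofReal ?_))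
        rw [Real.rpow_neg hj0.le, ← div_eq_mul_inv]
        gcongr
      have h2 : trunc j (u x - trunc j (u x)) ≤ j :=
        (le_abs_self _).trans (abs_trunc_le hj0.le _)
      calc (rhs h f u x).toReal * trunc j (u x - trunc j (u x))
          ≤ (c₂ * j ^ (-γ₂) * f x) * j :=
            mul_le_mul h1 h2 (trunc_nonneg hj0.le (by
              rw [trunc_of_le hj0.le hxj.le]; linarith)) (by positivity)
        _ = c₂ * j ^ (1 - γ₂) * f x := by
            rw [sub_eq_add_neg, Real.rpow_add hj0, Real.rpow_one]; ring
    · rw [indicator_of_notMem (by exact hxj), trunc_of_abs_le (k := j) (s := u x), sub_self,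
        trunc_of_abs_le (by simpa using hj0.le)]
      · simp
      · rw [abs_of_nonneg hx]; exact not_lt.1 hxj
  have e4 := e2.trans (e1.trans e3)
  rw [div_mul_eq_mul_div, div_le_iff₀ (by positivity), mul_comm α, ← le_div_iff₀ hα] at e4
  refine e4.trans (le_of_eq ?_)
  rw [Real.mul_rpow (by norm_num) hj0.le,
    show 1 + θ * (p - 1) - γ₂ = (1 - γ₂) + θ * (p - 1) by ring, Real.rpow_add hj0]
  field_simp

end

/-! ### Dyadic sums and level sets. -/

section

/-- Subadditivity of y ↦ y^e for 0 < e ≤ 1. With e = (N-p)/N it allows Sobolev bounds on separate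
slices to be summed. -/
theorem sum_rpow_le_of_le_one {ι : Type*} (s : Finset ι) {x : ι → ℝ} (hx : ∀ i, 0 ≤ x i) {e : ℝ}
    (he : 0 < e) (he1 : e ≤ 1) : (∑ i ∈ s, x i) ^ e ≤ ∑ i ∈ s, x i ^ e := by
  classical
  induction s using Finset.induction_on with
  | empty => simp [Real.zero_rpow he.ne']
  | insert i s hi ih =>
    rw [Finset.sum_insert hi, Finset.sum_insert hi]
    exact (Real.rpow_add_le_add_rpow (hx i) (Finset.sum_nonneg fun i _ => hx i) he.le he1).trans
      (by gcongr)

/-- A geometric sum is controlled by its largest term. -/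
theorem sum_two_rpow_le {κ : ℝ} (hκ : 0 < κ) (n : ℕ) :
    ∑ i ∈ Finset.range (n + 1), ((2 : ℝ) ^ i) ^ κ ≤ (1 - 2 ^ (-κ))⁻¹ * ((2 : ℝ) ^ n) ^ κ := by
  have h1 : (2 : ℝ) ^ (-κ) < 1 := Real.rpow_lt_one_of_one_lt_of_neg (by norm_num) (by linarith)
  have h2 : 0 < 1 - (2 : ℝ) ^ (-κ) := by linarith
  have h3 : (2 : ℝ) ^ (-κ) * 2 ^ κ = 1 := by
    rw [← Real.rpow_add (by norm_num)]; simp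
  have hA : (1 - (2 : ℝ) ^ (-κ))⁻¹ - (1 - (2 : ℝ) ^ (-κ))⁻¹ * 2 ^ (-κ) = 1 := by field_simp
  induction n with
  | zero =>
    simp only [zero_add, Finset.range_one, Finset.sum_singleton, pow_zero, Real.one_rpow, mul_one]
    rw [one_le_inv₀ h2]
    linarith [Real.rpow_pos_of_pos (show (0 : ℝ) < 2 by norm_num) (-κ)]
  | succ n ih =>
    rw [Finset.sum_range_succ]
    have e : ((2 : ℝ) ^ (n + 1)) ^ κ = (2 ^ n) ^ κ * 2 ^ κ := by
      rw [pow_succ, Real.mul_rpow (by positivity) (by norm_num)]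
    set y := ((2 : ℝ) ^ n) ^ κ
    have hy : 0 ≤ y := by positivity
    rw [e]
    have : (1 - (2 : ℝ) ^ (-κ))⁻¹ * (y * 2 ^ κ) - y * 2 ^ κ = (1 - (2 : ℝ) ^ (-κ))⁻¹ * y := by
      have e2 : (1 - (2 : ℝ) ^ (-κ))⁻¹ * (y * 2 ^ κ) - y * 2 ^ κ =
        y * 2 ^ κ * ((1 - (2 : ℝ) ^ (-κ))⁻¹ - 1) := by ring
      have e3 : (1 - (2 : ℝ) ^ (-κ))⁻¹ - 1 = (1 - (2 : ℝ) ^ (-κ))⁻¹ * 2 ^ (-κ) := by linarith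
      rw [e2, e3]
      calc y * 2 ^ κ * ((1 - (2 : ℝ) ^ (-κ))⁻¹ * 2 ^ (-κ))
          = (1 - (2 : ℝ) ^ (-κ))⁻¹ * y * (2 ^ (-κ) * 2 ^ κ) := by ring
        _ = _ := by rw [h3, mul_one]
    linarith

/-- A growing geometric sum is comparable with its largest term, so the power s passes inside the
sum at the price of a constant independent of the index set. -/
theorem sum_dyadic_rpow_le {κ t₀ : ℝ} (hκ : 0 < κ) (ht : 0 < t₀) (P : Finset ℕ) {s : ℝ}
    (hs : 1 ≤ s) :
    (∑ i ∈ P, (t₀ * 2 ^ i) ^ κ) ^ s ≤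
      ((1 - 2 ^ (-κ))⁻¹) ^ s * ∑ i ∈ P, (t₀ * 2 ^ i) ^ (κ * s) := by
  have h1 : (2 : ℝ) ^ (-κ) < 1 := Real.rpow_lt_one_of_one_lt_of_neg (by norm_num) (by linarith)
  have h2 : 0 < 1 - (2 : ℝ) ^ (-κ) := by linarith
  rcases P.eq_empty_or_nonempty with rfl | hP
  · simp [Real.zero_rpow (show s ≠ 0 by linarith)]
  set M := P.max' hP
  have h3 : ∑ i ∈ P, (t₀ * 2 ^ i) ^ κ ≤ (1 - 2 ^ (-κ))⁻¹ * (t₀ * 2 ^ M) ^ κ := by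
    calc ∑ i ∈ P, (t₀ * 2 ^ i) ^ κ ≤ ∑ i ∈ Finset.range (M + 1), (t₀ * 2 ^ i) ^ κ := by
          refine Finset.sum_le_sum_of_subset_of_nonneg (fun i hi => ?_)
            (fun i _ _ => by positivity)
          rw [Finset.mem_range]
          exact Nat.lt_succ_of_le (P.le_max' i hi)
      _ = t₀ ^ κ * ∑ i ∈ Finset.range (M + 1), ((2 : ℝ) ^ i) ^ κ := by
          rw [Finset.mul_sum]
          exact Finset.sum_congr rfl fun i _ => Real.mul_rpow ht.le (by positivity)
      _ ≤ t₀ ^ κ * ((1 - 2 ^ (-κ))⁻¹ * ((2 : ℝ) ^ M) ^ κ) := by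
          gcongr
          exact sum_two_rpow_le hκ M
      _ = _ := by rw [Real.mul_rpow ht.le (by positivity)]; ring
  calc (∑ i ∈ P, (t₀ * 2 ^ i) ^ κ) ^ s ≤ ((1 - 2 ^ (-κ))⁻¹ * (t₀ * 2 ^ M) ^ κ) ^ s := by
        gcongr
    _ = ((1 - 2 ^ (-κ))⁻¹) ^ s * (t₀ * 2 ^ M) ^ (κ * s) := by
        rw [Real.mul_rpow (by positivity) (by positivity), ← Real.rpow_mul (by positivity)]
    _ ≤ _ := by
        gcongr
        exact Finset.single_le_sum (f := fun i => (t₀ * (2 : ℝ) ^ i) ^ (κ * s))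
          (fun i _ => by positivity) (P.max'_mem hP)

theorem sum_dyadic_rpow_neg_le {κ t₀ : ℝ} (hκ : κ < 0) (ht : 0 < t₀) (n : ℕ) :
    ∑ i ∈ Finset.range n, (t₀ * 2 ^ i) ^ κ ≤ t₀ ^ κ * (1 - 2 ^ κ)⁻¹ := by
  have h1 : (2 : ℝ) ^ κ < 1 := Real.rpow_lt_one_of_one_lt_of_neg (by norm_num) hκ
  have h0 : (0 : ℝ) < 2 ^ κ := by positivity
  have e : ∀ i : ℕ, (t₀ * (2 : ℝ) ^ i) ^ κ = t₀ ^ κ * ((2 : ℝ) ^ κ) ^ i := fun i => by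
    rw [Real.mul_rpow ht.le (by positivity), ← Real.rpow_natCast, ← Real.rpow_mul (by norm_num),
      ← Real.rpow_natCast, ← Real.rpow_mul (by norm_num), mul_comm (i : ℝ)]
  simp only [e]
  rw [← Finset.mul_sum]
  gcongr
  rw [← tsum_geometric_of_lt_one h0.le h1]
  exact (summable_geometric_of_lt_one h0.le h1).sum_le_tsum _ fun i _ => by positivity

variable {Ω : Set (Euc N)} {u : Euc N → ℝ} {v : Euc N → Euc N} {p : ℝ}

/-- Sobolev inequality on dyadic slices, summed. -/
theorem exists_sum_level_sets_le (N : ℕ) {p : ℝ} (hp : 1 < p) (hpN : p < N) {ρ r : ℝ}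
    (hr : r * ((N - p) / N) = ρ * p + p) :
    ∃ C : ℝ, 0 < C ∧ ∀ (Ω : Set (Euc N)) [IsFiniteMeasure (volume.restrict Ω)] (u : Euc N → ℝ)
      (v : Euc N → Euc N),
      IsTruncW0 Ω (ENNReal.ofReal p) u v → (∀ᵐ x ∂(volume.restrict Ω), 0 ≤ u x) →
      ∀ t₀ : ℝ, 0 < t₀ → ∀ n : ℕ,
      (∑ i ∈ Finset.range n, (t₀ * 2 ^ i) ^ r *
          (volume.restrict Ω).real {x | t₀ * 2 ^ (i + 1) < u x}) ^ ((N - p) / N) ≤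
        C * ∑ i ∈ Finset.range n, (t₀ * 2 ^ i) ^ (ρ * p) *
          ∫ x in Ω, ‖{x | t₀ * 2 ^ i < u x ∧ u x ≤ 2 * (t₀ * 2 ^ i)}.indicator v x‖ ^ p := by
  obtain ⟨C, hC, hS⟩ := exists_level_set_const N hp.le hpN
  have hN : (0 : ℝ) < N := by linarith
  have he : 0 < ((N : ℝ) - p) / N := div_pos (by linarith) hN
  have he1 : ((N : ℝ) - p) / N ≤ 1 := by rw [div_le_one hN]; linarith
  refine ⟨C, hC, fun Ω _ u v hT h0 t₀ ht₀ n => ?_⟩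
  refine (sum_rpow_le_of_le_one _ (fun i => by positivity) he he1).trans ?_
  rw [Finset.mul_sum]
  refine Finset.sum_le_sum fun i _ => ?_
  set t := t₀ * 2 ^ i with ht
  have ht0 : 0 < t := by positivity
  have h1 := hS Ω _ _ t ht0 (hT.isW0_slice (by simpa using hp.le) h0 ht0
    (by linarith : t ≤ 2 * t))
  have e1 : (t₀ * 2 ^ (i + 1) : ℝ) = 2 * t := by rw [ht, pow_succ]; ring
  rw [e1, Real.mul_rpow (by positivity) (by positivity), ← Real.rpow_mul ht0.le, hr,
    Real.rpow_add ht0]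
  -- The slice function T_{2t}(u) - T_t(u) equals t on {u > 2t}.
  have h2 : (volume.restrict Ω).real {x | 2 * t < u x} ≤
      (volume.restrict Ω).real {x | t ≤ |trunc (2 * t) (u x) - trunc t (u x)|} := by
    refine measureReal_mono (fun x hx => ?_) (measure_ne_top _ _)
    simp only [mem_ofPred_eq] at hx ⊢
    rw [trunc_of_le (by linarith) hx.le, trunc_of_le ht0.le (by linarith)]
    exact le_trans (by linarith) (le_abs_self _)
  calc t ^ (ρ * p) * t ^ p * (volume.restrict Ω).real {x | 2 * t < u x} ^ (((N : ℝ) - p) / N)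
      ≤ t ^ (ρ * p) * (t ^ p * (volume.restrict Ω).real
        {x | t ≤ |trunc (2 * t) (u x) - trunc t (u x)|} ^ (((N : ℝ) - p) / N)) := by
        rw [mul_assoc]
        gcongr
    _ ≤ t ^ (ρ * p) * (C * ∫ x in Ω, ‖{x | t < u x ∧ u x ≤ 2 * t}.indicator v x‖ ^ p) := by
        gcongr
    _ = _ := by ring

/-- Shifting the index in the weighted sum of level sets. -/
theorem sum_level_sets_shift (μ : Measure (Euc N)) (u : Euc N → ℝ) {t₀ r : ℝ} (ht₀ : 0 < t₀)
    (n : ℕ) :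
    ∑ i ∈ Finset.range n, (t₀ * 2 ^ i) ^ r * μ.real {x | t₀ * 2 ^ i < u x} ≤
      t₀ ^ r * μ.real {x | t₀ < u x} + 2 ^ r * ∑ i ∈ Finset.range n, (t₀ * 2 ^ i) ^ r *
          μ.real {x | t₀ * 2 ^ (i + 1) < u x} := by
  calc ∑ i ∈ Finset.range n, (t₀ * 2 ^ i) ^ r * μ.real {x | t₀ * 2 ^ i < u x}
      ≤ ∑ i ∈ Finset.range (n + 1), (t₀ * 2 ^ i) ^ r * μ.real {x | t₀ * 2 ^ i < u x} :=
        Finset.sum_le_sum_of_subset_of_nonneg (Finset.range_subset_range.2 n.le_succ)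
          fun i _ _ => by positivity
    _ = _ := by
        rw [Finset.sum_range_succ', add_comm, Finset.mul_sum]
        congr 1
        · simp
        · refine Finset.sum_congr rfl fun i _ => ?_
          rw [pow_succ, ← mul_assoc, mul_comm _ (2 : ℝ),
            Real.mul_rpow (by norm_num) (by positivity), mul_assoc]

end

/-! ### Integrability from a bound on the weighted energy. -/

section

/-- Fatou's lemma: the majorants may vary with n as long as their integrals stay bounded. -/
theorem integrable_of_tendsto_of_le {α : Type*} [MeasurableSpace α] {μ : Measure α} {F : α → ℝ}
    {Fs gs : ℕ → α → ℝ} {K : ℝ} (hFs : ∀ n, AEStronglyMeasurable (Fs n) μ)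
    (hlim : ∀ᵐ x ∂μ, Tendsto (fun n => Fs n x) atTop (𝓝 (F x)))
    (hg : ∀ n, Integrable (gs n) μ) (hle : ∀ n, ∀ᵐ x ∂μ, |Fs n x| ≤ gs n x)
    (hK : ∀ n, ∫ x, gs n x ∂μ ≤ K) : Integrable F μ := by
  rw [← memLp_one_iff_integrable]
  refine ⟨aestronglyMeasurable_of_tendsto_ae atTop hFs hlim, ?_⟩
  refine (Lp.eLpNorm_lim_le_liminf_eLpNorm hFs F hlim).trans_lt
    (lt_of_le_of_lt (b := ENNReal.ofReal K) ?_ ENNReal.ofReal_lt_top)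
  refine (liminf_le_liminf (v := fun _ => ENNReal.ofReal K) (Eventually.of_forall fun n => ?_)).trans
    (by simp)
  have hg0 : 0 ≤ᵐ[μ] gs n := by
    filter_upwards [hle n] with x hx using (abs_nonneg _).trans hx
  calc eLpNorm (Fs n) 1 μ = ∫⁻ x, ‖Fs n x‖ₑ ∂μ := eLpNorm_one_eq_lintegral_enorm
    _ ≤ ∫⁻ x, ENNReal.ofReal (gs n x) ∂μ := by
        refine lintegral_mono_ae ?_
        filter_upwards [hle n] with x hx
        rw [← ofReal_norm]
        exact ENNReal.ofReal_le_ofReal hx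
    _ = ENNReal.ofReal (∫ x, gs n x ∂μ) := (ofReal_integral_eq_lintegral_ofReal (hg n) hg0).symm
    _ ≤ ENNReal.ofReal K := ENNReal.ofReal_le_ofReal (hK n)

/-- A weighted Young inequality, by comparing y with t^{-ρp}: below it y^{p-1} ≤ t^r, above it
t^{ρp} y ≥ 1. The value of r is dictated by the first case. -/
theorem rpow_pred_le {p ρ r t y : ℝ} (hp : 1 < p) (ht : 0 < t) (hy : 0 ≤ y)
    (hr : r = -(ρ * p * (p - 1))) : y ^ (p - 1) ≤ t ^ (ρ * p) * y ^ p + t ^ r := by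
  rcases le_total y (t ^ (-(ρ * p))) with h | h
  · have : y ^ (p - 1) ≤ t ^ r := by
      refine (Real.rpow_le_rpow hy h (by linarith)).trans_eq ?_
      rw [← Real.rpow_mul ht.le, hr]
      congr 1; ring
    have h2 : 0 ≤ t ^ (ρ * p) * y ^ p := by positivity
    linarith
  · have hy0 : 0 < y := lt_of_lt_of_le (by positivity) h
    have h1 : y ^ p = y ^ (p - 1) * y := by
      rw [← Real.rpow_add_one hy0.ne']; congr 1; ring
    have h2 : 1 ≤ t ^ (ρ * p) * y := by
      calc (1 : ℝ) = t ^ (ρ * p) * t ^ (-(ρ * p)) := by rw [← Real.rpow_add ht]; simp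
        _ ≤ _ := by gcongr
    have h3 : 0 ≤ t ^ r := by positivity
    have h4 : 0 ≤ y ^ (p - 1) := by positivity
    rw [h1]
    nlinarith

variable {Ω : Set (Euc N)} {u : Euc N → ℝ} {v : Euc N → Euc N} {p : ℝ}

/-- Weighted energy bounds on dyadic slices give the integrability of `|∇u|^{p-1}` and of
`|u|^{p-1}`. -/
theorem IsTruncW0.integrable_of_energy_bound [IsFiniteMeasure (volume.restrict Ω)] (hp : 1 < p)
    (hpN : p < N) {ρ r t₀ M : ℝ} (hr : r = -(ρ * p * (p - 1))) (hrp : p - 1 ≤ r)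
    (hre : r * ((N - p) / N) = ρ * p + p)
    (hT : IsTruncW0 Ω (ENNReal.ofReal p) u v) (hum : AEMeasurable u (volume.restrict Ω))
    (h0 : ∀ᵐ x ∂(volume.restrict Ω), 0 ≤ u x) (ht₀ : 1 ≤ t₀)
    (hM : ∀ n : ℕ, ∑ i ∈ Finset.range n, (t₀ * 2 ^ i) ^ (ρ * p) *
      ∫ x in Ω, ‖{x | t₀ * 2 ^ i < u x ∧ u x ≤ 2 * (t₀ * 2 ^ i)}.indicator v x‖ ^ p ≤ M) :
    Integrable (fun x => ‖v x‖ ^ (p - 1)) (volume.restrict Ω) ∧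
      Integrable (fun x => |u x| ^ (p - 1)) (volume.restrict Ω) := by
  obtain ⟨C, hC, hS⟩ := exists_sum_level_sets_le N hp hpN hre
  have ht0 : 0 < t₀ := by linarith
  have hN : (0 : ℝ) < N := by linarith
  have hp1 : 0 < p - 1 := by linarith
  have he : 0 < ((N : ℝ) - p) / N := div_pos (by linarith) hN
  have hM0 : 0 ≤ M := by simpa using hM 0
  have hq : 1 ≤ ENNReal.ofReal p := by simpa using hp.le
  set μ := volume.restrict Ω with hμ
  -- The slice Sobolev inequality controls {u > 2t}, not {u > t}. Shifting the index costs a factor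
  -- 2^r and leaves the first level set, of finite measure, as a separate term.
  set M₁ := t₀ ^ r * μ.real {x | t₀ < u x} + 2 ^ r * (C * M) ^ (((N : ℝ) - p) / N)⁻¹ with hM₁
  have hlev : ∀ n : ℕ, ∑ i ∈ Finset.range n, (t₀ * 2 ^ i) ^ r * μ.real {x | t₀ * 2 ^ i < u x} ≤
      M₁ := by
    intro n
    refine (sum_level_sets_shift μ u ht0 n).trans
      (add_le_add le_rfl (mul_le_mul_of_nonneg_left ?_ (by positivity)))
    have := (hS Ω u v hT h0 t₀ ht0 n).trans (mul_le_mul_of_nonneg_left (hM n) hC.le)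
    exact (Real.le_rpow_inv_iff_of_pos (Finset.sum_nonneg fun i _ => by positivity)
      (by positivity) he).2 this
  have hvm : AEStronglyMeasurable (fun x => ‖v x‖ ^ (p - 1)) μ :=
    (hT.aestronglyMeasurable.norm.aemeasurable.pow_const _).aestronglyMeasurable
  have humm : AEStronglyMeasurable (fun x => |u x| ^ (p - 1)) μ :=
    (hum.norm.pow_const _).aestronglyMeasurable
  have hpow : ∀ {G : Euc N → Euc N}, MemLp G (ENNReal.ofReal p) μ →
      Integrable (fun x => ‖G x‖ ^ p) μ := by
    intro G hG
    have := hG.integrable_norm_rpow (by simpa using by linarith) ENNReal.ofReal_ne_top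
    rwa [ENNReal.toReal_ofReal (by linarith)] at this
  set F : Euc N → ℝ := fun x => ‖v x‖ ^ (p - 1) + |u x| ^ (p - 1) with hF
  have hF0 : ∀ x, 0 ≤ F x := fun x => by positivity
  set g₀ : Euc N → ℝ := fun x =>
    (1 + ‖{x | |u x| ≤ t₀}.indicator v x‖ ^ p) + t₀ ^ (p - 1) with hg₀
  have hg₀i : Integrable g₀ μ :=
    ((integrable_const _).add (hpow (hT.isW0 t₀ ht0).memLp_grad)).add (integrable_const _)
  -- In the factor 1 + 2^{p-1}, the 1 is the remainder of Young's inequality and 2^{p-1} bounds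
  -- u^{p-1} ≤ (2t)^{p-1} ≤ 2^{p-1} t^r, which uses t ≥ 1 and r ≥ p-1.
  set sl : ℕ → Euc N → ℝ := fun i x => (t₀ * 2 ^ i) ^ (ρ * p) *
      ‖{x | t₀ * 2 ^ i < u x ∧ u x ≤ 2 * (t₀ * 2 ^ i)}.indicator v x‖ ^ p +
      (1 + 2 ^ (p - 1)) * ((t₀ * 2 ^ i) ^ r * {x | t₀ * 2 ^ i < u x}.indicator 1 x) with hsl
  have hsl0 : ∀ i x, 0 ≤ sl i x := by
    intro i x
    have : (0 : ℝ) ≤ {x | t₀ * 2 ^ i < u x}.indicator 1 x := indicator_nonneg (by simp) x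
    positivity
  have hnull : ∀ t : ℝ, NullMeasurableSet {x | t < u x} μ := fun t =>
    nullMeasurableSet_lt aemeasurable_const hum
  have hind : ∀ t : ℝ, Integrable ({x | t < u x}.indicator (1 : Euc N → ℝ)) μ := fun t =>
    (integrable_const (1 : ℝ)).indicator₀ (hnull t)
  have hslG : ∀ i : ℕ, Integrable (fun x =>
      ‖{x | t₀ * 2 ^ i < u x ∧ u x ≤ 2 * (t₀ * 2 ^ i)}.indicator v x‖ ^ p) μ := fun i =>
    hpow (hT.isW0_slice hq h0 (j := t₀ * 2 ^ i) (k := 2 * (t₀ * 2 ^ i)) (by positivity)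
      (by have : (0 : ℝ) < t₀ * 2 ^ i := by positivity
          linarith)).memLp_grad
  have hsli : ∀ i, Integrable (sl i) μ := fun i =>
    ((hslG i).const_mul _).add (((hind _).const_mul _).const_mul _)
  have hslint : ∀ i, ∫ x, sl i x ∂μ = (t₀ * 2 ^ i) ^ (ρ * p) * (∫ x,
      ‖{x | t₀ * 2 ^ i < u x ∧ u x ≤ 2 * (t₀ * 2 ^ i)}.indicator v x‖ ^ p ∂μ) +
      (1 + 2 ^ (p - 1)) * ((t₀ * 2 ^ i) ^ r * μ.real {x | t₀ * 2 ^ i < u x}) := by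
    intro i
    rw [integral_add ((hslG i).const_mul _) (((hind _).const_mul _).const_mul _),
      integral_const_mul, integral_const_mul, integral_const_mul,
      integral_indicator₀ (hnull _)]
    simp
  -- Each point with u ≤ t₀2^n lies below t₀, where g₀ dominates, or in one of the first n slices,
  -- where the corresponding summand does.
  have hpt : ∀ x, 0 ≤ u x → ∀ n : ℕ, u x ≤ t₀ * 2 ^ n →
      F x ≤ g₀ x + ∑ i ∈ Finset.range n, sl i x := by
    intro x hx n
    induction n with
    | zero =>
      intro hxn
      rw [pow_zero, mul_one] at hxn
      simp only [Finset.range_zero, Finset.sum_empty, add_zero, hF, hg₀]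
      rw [indicator_of_mem (show x ∈ {x | |u x| ≤ t₀} by
        show |u x| ≤ t₀; rwa [abs_of_nonneg hx])]
      refine add_le_add ?_ ?_
      · have := rpow_pred_le (ρ := 0) (r := 0) hp one_pos (norm_nonneg (v x)) (by simp)
        simp only [Real.one_rpow, one_mul] at this
        linarith
      · gcongr
        rwa [abs_of_nonneg hx]
    | succ n ih =>
      intro hxn
      rw [Finset.sum_range_succ]
      rcases le_or_gt (u x) (t₀ * 2 ^ n) with h1 | h1
      · have := ih h1
        linarith [hsl0 n x]
      · have h2 : u x ≤ 2 * (t₀ * 2 ^ n) := by rw [pow_succ] at hxn; linarith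
        have h3 : F x ≤ sl n x := by
          have ht1 : 1 ≤ t₀ * 2 ^ n := one_le_mul_of_one_le_of_one_le ht₀
            (one_le_pow₀ (by norm_num))
          simp only [hF, hsl]
          rw [indicator_of_mem (show x ∈ {x | t₀ * 2 ^ n < u x ∧ u x ≤ 2 * (t₀ * 2 ^ n)} from
            ⟨h1, h2⟩), indicator_of_mem (show x ∈ {x | t₀ * 2 ^ n < u x} from h1), Pi.one_apply]
          have h4 := rpow_pred_le hp (by positivity : 0 < t₀ * 2 ^ n) (norm_nonneg (v x)) hr
          have h5 : |u x| ^ (p - 1) ≤ 2 ^ (p - 1) * (t₀ * 2 ^ n) ^ r := by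
            rw [abs_of_nonneg hx]
            calc u x ^ (p - 1) ≤ (2 * (t₀ * 2 ^ n)) ^ (p - 1) := by gcongr
              _ = 2 ^ (p - 1) * (t₀ * 2 ^ n) ^ (p - 1) :=
                Real.mul_rpow (by norm_num) (by positivity)
              _ ≤ _ := by
                gcongr
          linarith
        have h4 : 0 ≤ g₀ x := by positivity
        have h5 : 0 ≤ ∑ i ∈ Finset.range n, sl i x := Finset.sum_nonneg fun i _ => hsl0 i x
        linarith
  have hFi : Integrable F μ := by
    refine integrable_of_tendsto_of_le
      (Fs := fun n : ℕ => {x | u x ≤ t₀ * 2 ^ n}.indicator F)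
      (gs := fun n x => g₀ x + ∑ i ∈ Finset.range n, sl i x)
      (K := (∫ x, g₀ x ∂μ) + (M + (1 + 2 ^ (p - 1)) * M₁)) (fun n => ?_)
      (Eventually.of_forall fun x => ?_) (fun n => ?_) (fun n => ?_) (fun n => ?_)
    · exact (hvm.add humm).indicator₀ (nullMeasurableSet_le hum aemeasurable_const)
    · refine tendsto_const_nhds.congr' ?_
      have ht : Tendsto (fun n : ℕ => t₀ * 2 ^ n) atTop atTop :=
        (tendsto_pow_atTop_atTop_of_one_lt (by norm_num)).const_mul_atTop ht0
      filter_upwards [ht.eventually_ge_atTop (u x)] with n hn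
      exact (indicator_of_mem (show x ∈ {x | u x ≤ t₀ * 2 ^ n} from hn) _).symm
    · exact hg₀i.add (integrable_finsetSum _ fun i _ => hsli i)
    · filter_upwards [h0] with x hx
      by_cases hxn : u x ≤ t₀ * 2 ^ n
      · rw [indicator_of_mem (show x ∈ {x | u x ≤ t₀ * 2 ^ n} from hxn), abs_of_nonneg (hF0 x)]
        exact hpt x hx n hxn
      · rw [indicator_of_notMem (show x ∉ {x | u x ≤ t₀ * 2 ^ n} from hxn), abs_zero]
        have h4 : 0 ≤ g₀ x := by positivity
        have h5 : 0 ≤ ∑ i ∈ Finset.range n, sl i x := Finset.sum_nonneg fun i _ => hsl0 i x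
        linarith
    · rw [integral_add hg₀i (integrable_finsetSum _ fun i _ => hsli i),
        integral_finsetSum _ fun i _ => hsli i]
      simp only [hslint]
      rw [Finset.sum_add_distrib, ← Finset.mul_sum]
      gcongr
      · exact hM n
      · exact hlev n
  refine ⟨hFi.mono' hvm (Eventually.of_forall fun x => ?_),
    hFi.mono' humm (Eventually.of_forall fun x => ?_)⟩
  · rw [Real.norm_of_nonneg (by positivity)]
    simp only [hF]
    linarith [show 0 ≤ |u x| ^ (p - 1) by positivity]
  · rw [Real.norm_of_nonneg (by positivity)]
    simp only [hF]
    linarith [show 0 ≤ ‖v x‖ ^ (p - 1) by positivity]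

end

/-! ### Bounding the weighted energy by the summability of f. -/

section
variable {Ω : Set (Euc N)} {u : Euc N → ℝ} {p : ℝ} {a : Euc N → ℝ → Euc N → Euc N}
  {h : ℝ → ℝ≥0∞} {f : Euc N → ℝ}

/-- The gradient estimates for an entropy solution, from dyadic energy bounds. -/
theorem IsEntropySolution.exists_dyadic_energy_le [IsFiniteMeasure (volume.restrict Ω)]
    (hΩ : IsOpen Ω) (hp : 1 < p) {θ γ₂ : ℝ} (hθ : 0 ≤ θ) (hγ : 0 ≤ γ₂)
    (ha : IsAdmissibleOperator Ω p θ a)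
    (hh : IsAdmissibleSource γ₂ h) (hf0 : ∀ᵐ x ∂(volume.restrict Ω), 0 ≤ f x)
    (hf : Integrable f (volume.restrict Ω)) (hu : IsEntropySolution Ω p a h f u) (ρ : ℝ) :
    ∃ C j₀ : ℝ, 0 < C ∧ 1 ≤ j₀ ∧ ∀ t₀ : ℝ, j₀ ≤ t₀ → ∀ n : ℕ,
      ∑ i ∈ Finset.range n, (t₀ * 2 ^ i) ^ (ρ * p) * ∫ x in Ω, ‖{x | t₀ * 2 ^ i < u x ∧
        u x ≤ 2 * (t₀ * 2 ^ i)}.indicator (genGrad Ω u) x‖ ^ p ≤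
      C * ∑ i ∈ Finset.range n, (t₀ * 2 ^ i) ^ (ρ * p + 1 + θ * (p - 1) - γ₂) *
        ∫ x in Ω, {x | t₀ * 2 ^ i < u x}.indicator f x := by
  obtain ⟨C, j₀, hC, hj₀, hE⟩ := hu.slice_energy_le hΩ hp hθ hγ ha hh hf0 hf
  refine ⟨C, j₀, hC, hj₀, fun t₀ ht₀ n => ?_⟩
  rw [Finset.mul_sum]
  refine Finset.sum_le_sum fun i _ => ?_
  have h1 : t₀ ≤ t₀ * 2 ^ i := le_mul_of_one_le_right (by linarith) (one_le_pow₀ (by norm_num))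
  have h2 : 0 < t₀ * 2 ^ i := by linarith
  have := hE _ (ht₀.trans h1)
  calc _ ≤ (t₀ * 2 ^ i) ^ (ρ * p) * (C * (t₀ * 2 ^ i) ^ (1 + θ * (p - 1) - γ₂) *
        ∫ x in Ω, {x | t₀ * 2 ^ i < u x}.indicator f x) := by gcongr
    _ = _ := by
      rw [show ρ * p + 1 + θ * (p - 1) - γ₂ = ρ * p + (1 + θ * (p - 1) - γ₂) by ring,
        Real.rpow_add h2]
      ring

/-- Since d ≤ 1, the right-hand side grows at most linearly in S. The smallness of Db allows
absorption even in the critical case d = 1. -/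
theorem le_of_absorb {S D K b d : ℝ} (hS : 0 ≤ S) (hK : 0 ≤ K) (hb : 0 ≤ b) (hD : 0 ≤ D)
    (hd : 0 ≤ d) (hd1 : d ≤ 1) (hDb : D * b ≤ 1 / 2) (h : S ≤ D * (K + b * S) ^ d) :
    S ≤ 2 * D * (1 + K) := by
  have h1 : (K + b * S) ^ d ≤ 1 + (K + b * S) := by
    rcases le_total (K + b * S) 1 with h' | h'
    · have := Real.rpow_le_one (by positivity) h' hd
      have : 0 ≤ K + b * S := by positivity
      linarith
    · have := Real.rpow_le_rpow_of_exponent_le h' hd1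
      rw [Real.rpow_one] at this
      linarith
  have h2 : S ≤ D * (1 + (K + b * S)) := h.trans (mul_le_mul_of_nonneg_left h1 hD)
  nlinarith

/-- For κ > 0 the estimate is a closed loop: Sobolev bounds the level sets by the energy, the
equation bounds the energy by f on the level sets, and Hölder returns to the level sets. All sums
are finite, so the absorbed quantity is finite, and the bound does not depend on the number of
slices. -/
theorem IsEntropySolution.integrable_of_exponents [IsFiniteMeasure (volume.restrict Ω)]
    (hΩ : IsOpen Ω) (hp : 1 < p) (hpN : p < N) {θ γ₂ : ℝ} (hθ : 0 ≤ θ) (hγ : 0 ≤ γ₂)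
    (ha : IsAdmissibleOperator Ω p θ a)
    (hh : IsAdmissibleSource γ₂ h) (hf0 : ∀ᵐ x ∂(volume.restrict Ω), 0 ≤ f x)
    {m : ℝ} (hm : 1 ≤ m) (hf : MemLp f (ENNReal.ofReal m) (volume.restrict Ω))
    (hu : IsEntropySolution Ω p a h f u) {ρ r κ : ℝ} (hr : r = -(ρ * p * (p - 1)))
    (hrp : p - 1 ≤ r) (hre : r * ((N - p) / N) = ρ * p + p)
    (hκ : κ = ρ * p + 1 + θ * (p - 1) - γ₂)
    (hcase : κ < 0 ∨ (0 < κ ∧ κ / r ≤ (N - p) / N ∧ 1 / m ≤ 1 - κ / r)) :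
    Integrable (fun x => ‖genGrad Ω u x‖ ^ (p - 1)) (volume.restrict Ω) ∧
      Integrable (fun x => |u x| ^ (p - 1)) (volume.restrict Ω) := by
  have hf1 : Integrable f (volume.restrict Ω) := hf.integrable (by simpa using hm)
  obtain ⟨c₀, j₀, hc₀, hj₀, hE⟩ := hu.exists_dyadic_energy_le hΩ hp hθ hγ ha hh hf0 hf1 ρ
  rw [← hκ] at hE
  have hT := hu.isTruncW0 hΩ hp
  have hnull : ∀ t : ℝ, NullMeasurableSet {x | t < u x} (volume.restrict Ω) := fun t =>
    nullMeasurableSet_lt aemeasurable_const hu.aemeasurable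
  have hN : (0 : ℝ) < N := by linarith
  rcases hcase with hneg | ⟨hpos, hκe, hmκ⟩
  -- For κ < 0 each tail integral is at most ∫ f and the weights form a convergent geometric series.
  · refine hT.integrable_of_energy_bound hp hpN hr hrp hre hu.aemeasurable hu.nonneg hj₀
      (M := c₀ * (j₀ ^ κ * (1 - 2 ^ κ)⁻¹ * ∫ x in Ω, f x)) fun n => (hE j₀ le_rfl n).trans ?_
    refine mul_le_mul_of_nonneg_left ?_ hc₀.le
    have hfint : 0 ≤ ∫ x in Ω, f x := integral_nonneg_of_ae hf0
    refine le_trans ?_ (mul_le_mul_of_nonneg_right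
      (sum_dyadic_rpow_neg_le hneg (by linarith : 0 < j₀) n) hfint)
    rw [Finset.sum_mul]
    refine Finset.sum_le_sum fun i _ => ?_
    have : 0 ≤ (j₀ * 2 ^ i) ^ κ := by positivity
    refine mul_le_mul_of_nonneg_left ?_ this
    refine integral_mono_ae (hf1.indicator₀ (hnull _)) hf1 ?_
    filter_upwards [hf0] with x hx
    exact indicator_le_self' (fun _ _ => hx) x
  obtain ⟨C, hC, hS⟩ := exists_sum_level_sets_le N hp hpN hre
  set μ := volume.restrict Ω with hμ
  have hr0 : 0 < r := by linarith
  set e := ((N : ℝ) - p) / N with he_def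
  have he : 0 < e := div_pos (by linarith) hN
  have he1 : e < 1 := by rw [he_def, div_lt_one hN]; linarith
  have hκr : 0 < κ / r := div_pos hpos hr0
  -- The choice κs = r makes Hölder's inequality reproduce the sum of t^r |{u > t}|. The conjugate
  -- exponent satisfies 1/m₀ = 1 - κ/r, and s > 1 since κ/r ≤ e < 1.
  set s := r / κ with hs_def
  have hs : 1 < s := by
    rw [hs_def, one_lt_div hpos, ← div_lt_one hr0]
    linarith
  have hsκ : κ * s = r := by rw [hs_def]; field_simp
  have hs1 : 1 / s = κ / r := by rw [hs_def, one_div_div]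
  set m₀ := s / (s - 1) with hm₀_def
  have hconj : m₀.HolderConjugate s := (Real.HolderConjugate.conjExponent hs).symm
  have hm₀0 : 0 < m₀ := hconj.pos
  have hm₀m : m₀ ≤ m := by
    have h1 : 1 / m₀ = 1 - κ / r := by
      have := hconj.inv_add_inv_eq_one
      rw [← hs1]
      simp only [one_div]
      linarith
    rw [← h1] at hmκ
    exact (one_div_le_one_div (by linarith) hm₀0).1 hmκ
  have hfm : MemLp f (ENNReal.ofReal m₀) μ := hf.mono_exponent (ENNReal.ofReal_le_ofReal hm₀m)
  have hfind : ∀ T : ℝ, MemLp ({x | T < u x}.indicator f) (ENNReal.ofReal m₀) μ := fun T =>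
    hfm.mono (hfm.1.indicator₀ (hnull T)) (Eventually.of_forall fun x => norm_indicator_le_norm_self _ _)
  have hfpow : Integrable (fun x => |f x| ^ m₀) μ := by
    have := hfm.integrable_norm_rpow (by simpa using hm₀0) ENNReal.ofReal_ne_top
    rwa [ENNReal.toReal_ofReal hm₀0.le] at this
  set κ' : ℝ := (1 - 2 ^ (-κ))⁻¹ with hκ'_def
  have hκ'0 : 0 < κ' := by
    have : (2 : ℝ) ^ (-κ) < 1 := Real.rpow_lt_one_of_one_lt_of_neg (by norm_num) (by linarith)
    rw [hκ'_def, inv_pos]; linarith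
  let I : ℝ → ℝ := fun T => ∫ x, ({x | T < u x}.indicator f x) ^ m₀ ∂μ
  have hfi0 : ∀ T, ∀ᵐ x ∂μ, 0 ≤ {x | T < u x}.indicator f x := fun T => by
    filter_upwards [hf0] with x hx
    exact indicator_apply_nonneg fun _ => hx
  have hI0 : ∀ T, 0 ≤ I T := fun T => integral_nonneg_of_ae (by
    filter_upwards [hfi0 T] with x hx using Real.rpow_nonneg hx _)
  -- Since u is finite everywhere, the L^{m₀} mass of f on {u > n} vanishes in the limit.
  have hIlim : Tendsto (fun n : ℕ => I n) atTop (𝓝 0) := by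
    have : Tendsto (fun n : ℕ => I n) atTop (𝓝 (∫ _, (0 : ℝ) ∂μ)) := by
      refine tendsto_integral_of_dominated_convergence (fun x => |f x| ^ m₀)
        (fun n => ((hfind n).1.aemeasurable.pow_const _).aestronglyMeasurable) hfpow (fun n => ?_)
        (Eventually.of_forall fun x => ?_)
      · filter_upwards [hf0] with x hx
        by_cases hxn : (n : ℝ) < u x
        · rw [indicator_of_mem (by exact hxn), Real.norm_of_nonneg (by positivity),
            abs_of_nonneg hx]
        · rw [indicator_of_notMem (by exact hxn), Real.zero_rpow hm₀0.ne', norm_zero]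
          positivity
      · refine tendsto_const_nhds.congr' ?_
        obtain ⟨k, hk⟩ := exists_nat_gt (u x)
        filter_upwards [eventually_ge_atTop k] with n hn
        have : (k : ℝ) ≤ n := by exact_mod_cast hn
        rw [indicator_of_notMem (show x ∉ {x | (n : ℝ) < u x} from
          fun hx : (n : ℝ) < u x => by linarith),
          Real.zero_rpow hm₀0.ne']
    simpa using this
  -- The coefficient left in S ≤ D(T) (K + 2^r S)^{1/(se)} after the Sobolev bound is solved for the
  -- level-set sum S.
  let D : ℝ → ℝ := fun T => (C * (c₀ * κ' * (I T) ^ (1 / m₀))) ^ (1 / e)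
  have hD0 : ∀ T, 0 ≤ D T := fun T => by
    have := hI0 T
    positivity
  have hDlim : Tendsto (fun n : ℕ => D n) atTop (𝓝 0) := by
    have h1 := (hIlim.rpow_const (p := 1 / m₀) (Or.inr (by positivity))).const_mul (c₀ * κ')
    have h2 := (h1.const_mul C).rpow_const (p := 1 / e) (Or.inr (by positivity))
    rw [Real.zero_rpow (by positivity), mul_zero, mul_zero, Real.zero_rpow (by positivity)] at h2
    exact h2
  have h2r : (0 : ℝ) < 2 ^ r := by positivity
  -- The starting level T is taken so high that 2^r D(T) ≤ 1/2, as absorption requires.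
  obtain ⟨n₀, hn₀, hn₀j⟩ := ((hDlim.eventually_le_const
    (show (0 : ℝ) < 1 / 2 / 2 ^ r by positivity)).and
    (tendsto_natCast_atTop_atTop.eventually_ge_atTop j₀)).exists
  set T : ℝ := (n₀ : ℝ) with hT_def
  have hT1 : 1 ≤ T := hj₀.trans hn₀j
  have hT0 : 0 < T := by linarith
  set K : ℝ := T ^ r * μ.real {x | T < u x} with hK_def
  have hK0 : 0 ≤ K := by positivity
  have hind : ∀ t : ℝ, Integrable ({x | t < u x}.indicator (1 : Euc N → ℝ)) μ := fun t =>
    (integrable_const (1 : ℝ)).indicator₀ (hnull t)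
  have hindM : ∀ t : ℝ, AEStronglyMeasurable ({x | t < u x}.indicator (1 : Euc N → ℝ)) μ :=
    fun t => (hind t).1
  let H : ℕ → Euc N → ℝ := fun n x =>
    ∑ i ∈ Finset.range n, (T * 2 ^ i) ^ κ * {x | T * 2 ^ i < u x}.indicator 1 x
  have hH0 : ∀ n x, 0 ≤ H n x := fun n x => Finset.sum_nonneg fun i _ =>
    mul_nonneg (by positivity) (indicator_nonneg (by simp) x)
  have hHm : ∀ n, AEStronglyMeasurable (H n) μ := fun n =>
    Finset.aestronglyMeasurable_fun_sum _ fun i _ => (hindM _).const_mul _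
  have hHb : ∀ n x, |H n x| ≤ ∑ i ∈ Finset.range n, (T * 2 ^ i) ^ κ := fun n x => by
    rw [abs_of_nonneg (hH0 n x)]
    refine Finset.sum_le_sum fun i _ => mul_le_of_le_one_right (by positivity) ?_
    exact indicator_apply_le' (fun _ => le_rfl) (fun _ => zero_le_one)
  have hHs : ∀ n x, H n x ^ s ≤
      κ' ^ s * ∑ i ∈ Finset.range n, (T * 2 ^ i) ^ r * {x | T * 2 ^ i < u x}.indicator 1 x := by
    intro n x
    classical
    -- At a fixed point the indicators select a finite set of indices, to which the dyadic
    -- inequality applies.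
    have e1 : ∀ y : ℝ, ∑ i ∈ Finset.range n, (T * 2 ^ i) ^ y * {x | T * 2 ^ i < u x}.indicator 1 x =
        ∑ i ∈ (Finset.range n).filter (fun i => T * 2 ^ i < u x), (T * 2 ^ i) ^ y := by
      intro y
      rw [Finset.sum_filter]
      refine Finset.sum_congr rfl fun i _ => ?_
      simp [indicator]
    simp only [H, e1]
    have := sum_dyadic_rpow_le hpos hT0 ((Finset.range n).filter (fun i => T * 2 ^ i < u x)) hs.le
    rwa [hsκ] at this
  have hHint : ∀ n, ∫ x, H n x ^ s ∂μ ≤ κ' ^ s * ∑ i ∈ Finset.range n, (T * 2 ^ i) ^ r *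
      μ.real {x | T * 2 ^ i < u x} := by
    intro n
    have hi : Integrable (fun x => κ' ^ s * ∑ i ∈ Finset.range n, (T * 2 ^ i) ^ r *
        {x | T * 2 ^ i < u x}.indicator 1 x) μ :=
      (integrable_finsetSum _ fun i _ => (hind _).const_mul _).const_mul _
    refine (integral_mono_of_nonneg (Eventually.of_forall fun x => Real.rpow_nonneg (hH0 n x) _) hi
      (Eventually.of_forall (hHs n))).trans_eq ?_
    rw [integral_const_mul, integral_finsetSum _ fun i _ => (hind _).const_mul _]
    congr 1
    refine Finset.sum_congr rfl fun i _ => ?_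
    rw [integral_const_mul, integral_indicator₀ (hnull _)]
    simp
  let S : ℕ → ℝ := fun n => ∑ i ∈ Finset.range n, (T * 2 ^ i) ^ r *
    μ.real {x | T * 2 ^ (i + 1) < u x}
  have hS0 : ∀ n, 0 ≤ S n := fun n => Finset.sum_nonneg fun i _ => by positivity
  have hY : ∀ n : ℕ, ∑ i ∈ Finset.range n, (T * 2 ^ i) ^ (ρ * p) * ∫ x, ‖{x | T * 2 ^ i < u x ∧
        u x ≤ 2 * (T * 2 ^ i)}.indicator (genGrad Ω u) x‖ ^ p ∂μ ≤
      c₀ * κ' * (I T) ^ (1 / m₀) * (K + 2 ^ r * S n) ^ (1 / s) := by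
    intro n
    refine (hE T hn₀j n).trans ?_
    -- All the level sets lie in {u > T}, so f may be replaced by its tail there; this is the source
    -- of the small factor I(T)^{1/m₀}.
    have e1 : ∑ i ∈ Finset.range n, (T * 2 ^ i) ^ κ * ∫ x, {x | T * 2 ^ i < u x}.indicator f x ∂μ =
        ∫ x, {x | T < u x}.indicator f x * H n x ∂μ := by
      simp only [← integral_const_mul]
      rw [← integral_finsetSum _ fun i _ => (hf1.indicator₀ (hnull _)).const_mul _]
      refine integral_congr_ae (Eventually.of_forall fun x => ?_)
      simp only [H, Finset.mul_sum]
      refine Finset.sum_congr rfl fun i _ => ?_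
      by_cases hx : T * 2 ^ i < u x
      · have hTx : T < u x :=
          (le_mul_of_one_le_right hT0.le (one_le_pow₀ (by norm_num))).trans_lt hx
        have a1 : {x | T * 2 ^ i < u x}.indicator f x = f x := indicator_of_mem (by exact hx) _
        have a2 : {x | T * 2 ^ i < u x}.indicator (1 : Euc N → ℝ) x = 1 :=
          indicator_of_mem (by exact hx) _
        have a3 : {x | T < u x}.indicator f x = f x := indicator_of_mem (by exact hTx) _
        rw [a1, a2, a3]
        ring
      · have a1 : {x | T * 2 ^ i < u x}.indicator f x = 0 := indicator_of_notMem (by exact hx) _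
        have a2 : {x | T * 2 ^ i < u x}.indicator (1 : Euc N → ℝ) x = 0 :=
          indicator_of_notMem (by exact hx) _
        rw [a1, a2]
        ring
    rw [e1]
    have h1 := integral_mul_le_Lp_mul_Lq_of_nonneg hconj (hfi0 T)
      (Eventually.of_forall (hH0 n)) (hfind T)
      (MemLp.of_bound (p := ENNReal.ofReal s) (hHm n) _ (Eventually.of_forall (hHb n)))
    have h2 : (∫ x, H n x ^ s ∂μ) ^ (1 / s) ≤ κ' * (K + 2 ^ r * S n) ^ (1 / s) := by
      have h3 : ∫ x, H n x ^ s ∂μ ≤ κ' ^ s * (K + 2 ^ r * S n) :=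
        (hHint n).trans (mul_le_mul_of_nonneg_left (sum_level_sets_shift μ u hT0 n)
          (by positivity))
      refine (Real.rpow_le_rpow (integral_nonneg fun x => Real.rpow_nonneg (hH0 n x) _) h3
        (by positivity)).trans_eq ?_
      have := hS0 n
      rw [Real.mul_rpow (by positivity) (by positivity), ← Real.rpow_mul hκ'0.le,
        mul_one_div_cancel (by linarith), Real.rpow_one]
    have h4 : 0 ≤ I T ^ (1 / m₀) := Real.rpow_nonneg (hI0 T) _
    calc c₀ * ∫ x, {x | T < u x}.indicator f x * H n x ∂μ
        ≤ c₀ * (I T ^ (1 / m₀) * (κ' * (K + 2 ^ r * S n) ^ (1 / s))) :=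
          mul_le_mul_of_nonneg_left (h1.trans (mul_le_mul_of_nonneg_left h2 h4)) hc₀.le
      _ = _ := by ring
  have hSbound : ∀ n, S n ≤ 2 * D T * (1 + K) := by
    intro n
    have h1 := (hS Ω u _ hT hu.nonneg T hT0 n).trans (mul_le_mul_of_nonneg_left (hY n) hC.le)
    have h4 : 0 ≤ I T ^ (1 / m₀) := Real.rpow_nonneg (hI0 T) _
    have h5 := hS0 n
    have h2 : S n ≤ (C * (c₀ * κ' * (I T) ^ (1 / m₀) * (K + 2 ^ r * S n) ^ (1 / s))) ^ (1 / e) := by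
      rw [one_div e]
      exact (Real.le_rpow_inv_iff_of_pos (hS0 n) (by positivity) he).2 h1
    refine le_of_absorb (hS0 n) hK0 h2r.le (hD0 T) (d := 1 / s * (1 / e)) (by positivity) ?_ ?_
      (h2.trans_eq ?_)
    -- The exponent 1/(se) is at most 1 exactly when κ/r ≤ e.
    · rw [hs1, mul_one_div, div_le_one he]
      exact hκe
    · rwa [le_div_iff₀ h2r] at hn₀
    · rw [← mul_assoc, Real.mul_rpow (by positivity) (by positivity),
        ← Real.rpow_mul (by positivity)]
  refine hT.integrable_of_energy_bound hp hpN hr hrp hre hu.aemeasurable hu.nonneg hT1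
    (M := c₀ * κ' * (I T) ^ (1 / m₀) * (K + 2 ^ r * (2 * D T * (1 + K))) ^ (1 / s)) fun n =>
    (hY n).trans ?_
  have h4 : 0 ≤ I T ^ (1 / m₀) := Real.rpow_nonneg (hI0 T) _
  have h5 := hS0 n
  refine mul_le_mul_of_nonneg_left ?_ (by positivity)
  refine Real.rpow_le_rpow (by positivity) ?_ (by positivity)
  have := hSbound n
  gcongr

end

/-! ### From the entropy inequality to the equation. -/

section
variable {Ω : Set (Euc N)} {u : Euc N → ℝ} {p : ℝ} {a : Euc N → ℝ → Euc N → Euc N}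
  {h : ℝ → ℝ≥0∞} {f : Euc N → ℝ}

/-- A larger θ only weakens the coercivity bound; this is how the case θ = θ_* is moved into the
range κ > 0. -/
theorem IsAdmissibleOperator.mono {θ θ' : ℝ} (hp : 1 < p) (hθ : θ ≤ θ')
    (ha : IsAdmissibleOperator Ω p θ a) : IsAdmissibleOperator Ω p θ' a := by
  obtain ⟨b, h1, h2, ⟨α, hα, h3⟩, h4⟩ := ha.coercive
  refine ⟨ha.measurable, ha.continuous, ⟨b, h1, h2, ⟨α, hα, fun s => (h3 s).trans' ?_⟩, h4⟩,
    ha.growth⟩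
  have : 1 ≤ 1 + |s| := by linarith [abs_nonneg s]
  gcongr

theorem IsAdmissibleOperator.inner_nonneg {θ : ℝ} (ha : IsAdmissibleOperator Ω p θ a) :
    ∀ᵐ x ∂(volume.restrict Ω), ∀ (s : ℝ) (ξ : Euc N), 0 ≤ inner ℝ (a x s ξ) ξ := by
  obtain ⟨b, -, -, ⟨α, hα, hb⟩, h4⟩ := ha.coercive
  filter_upwards [h4] with x hx s ξ
  refine le_trans (mul_nonneg (le_trans ?_ (hb s)) (by positivity)) (hx s ξ)
  positivity

theorem IsTestFunction.zero : IsTestFunction ∞ Ω (fun _ => 0) :=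
  ⟨contDiff_const, HasCompactSupport.zero, by
    simp [tsupport]⟩

/-- With φ = 0 alone, nothing is known where u is small and h(u) may be singular. Adding a bump
equal to 1 near x helps, since |T_1(u)| + |T_1(u-1)| ≥ 1 for u ≥ 0. -/
theorem IsEntropySolution.exists_nhds_rhs [IsFiniteMeasure (volume.restrict Ω)] (hΩ : IsOpen Ω)
    (hp : 1 < p) (hu : IsEntropySolution Ω p a h f u) {x : Euc N} (hx : x ∈ Ω) :
    ∃ r > 0, Metric.ball x r ⊆ Ω ∧
      (∀ᵐ y ∂(volume.restrict (Metric.ball x r)), rhs h f u y ≠ ⊤) ∧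
      IntegrableOn (fun y => (rhs h f u y).toReal) (Metric.ball x r) := by
  obtain ⟨δ, hδ, hδΩ⟩ := Metric.isOpen_iff.1 hΩ x hx
  let b : ContDiffBump x := ⟨δ / 4, δ / 2, by positivity, by linarith⟩
  have hsub : Metric.closedBall x (δ / 2) ⊆ Ω :=
    (Metric.closedBall_subset_ball (by linarith)).trans hδΩ
  have hb : IsTestFunction ∞ Ω b := ⟨b.contDiff, b.hasCompactSupport, by
    rw [b.tsupport_eq]; exact hsub⟩
  have hmem : ∀ φ : Euc N → ℝ, IsTestFunction ∞ Ω φ → MemW0 Ω p φ := fun φ hφ =>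
    (memW0_iff hp.le).2 ⟨_, hφ.isW0⟩
  obtain ⟨t1, i1⟩ := hu.rhs_integrable 1 _ one_pos (hmem _ IsTestFunction.zero)
    IsTestFunction.zero.memLp
  obtain ⟨t2, i2⟩ := hu.rhs_integrable 1 _ one_pos (hmem _ hb) hb.memLp
  have hbΩ : Metric.ball x (δ / 4) ⊆ Ω := (Metric.ball_subset_ball (by linarith)).trans hδΩ
  have hle : volume.restrict (Metric.ball x (δ / 4)) ≤ volume.restrict Ω :=
    Measure.restrict_mono hbΩ le_rfl
  have hbone : ∀ᵐ y ∂(volume.restrict (Metric.ball x (δ / 4))), b y = 1 := by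
    rw [ae_restrict_iff' Metric.isOpen_ball.measurableSet]
    exact Eventually.of_forall fun y hy => b.one_of_mem_closedBall (Metric.ball_subset_closedBall hy)
  set g : Euc N → ℝ := fun y => |trunc 1 (u y - 0)| + |trunc 1 (u y - b y)| with hg
  have hg1 : ∀ᵐ y ∂(volume.restrict (Metric.ball x (δ / 4))), 1 ≤ g y := by
    filter_upwards [hbone, ae_mono hle hu.nonneg] with y hy h0
    simp only [hg, hy, sub_zero]
    rcases le_total (u y) 1 with h1 | h1
    · rw [trunc_of_abs_le (by rwa [abs_of_nonneg h0]), trunc_of_abs_le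
        (by rw [abs_le]; constructor <;> linarith), abs_of_nonneg h0,
        abs_of_nonpos (by linarith)]
      linarith
    · rw [trunc_of_le zero_le_one h1, abs_one]
      linarith [abs_nonneg (trunc 1 (u y - 1))]
  refine ⟨δ / 4, by positivity, hbΩ, ?_, ?_⟩
  · filter_upwards [ae_mono hle t1, ae_mono hle t2, hg1] with y h1 h2 h3 htop
    simp only [hg, h1 htop, h2 htop, abs_zero] at h3
    norm_num at h3
  · have hi : IntegrableOn (fun y => (rhs h f u y).toReal * g y) (Metric.ball x (δ / 4)) := by
      refine ((i1.norm.add i2.norm).mono_measure hle).congr (Eventually.of_forall fun y => ?_)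
      simp only [Pi.add_apply, norm_mul, Real.norm_eq_abs, hg, abs_of_nonneg ENNReal.toReal_nonneg]
      ring
    have hum := hu.aemeasurable.mono_measure hle
    have hgm : AEMeasurable g (volume.restrict (Metric.ball x (δ / 4))) :=
      ((continuous_trunc 1).measurable.comp_aemeasurable (hum.sub aemeasurable_const)).norm.add
        ((continuous_trunc 1).measurable.comp_aemeasurable
          (hum.sub b.continuous.measurable.aemeasurable)).norm
    have hi' : IntegrableOn (fun y => (rhs h f u y).toReal * g y * (g y)⁻¹)
        (Metric.ball x (δ / 4)) := by
      refine hi.norm.mono' (hi.1.mul hgm.inv.aestronglyMeasurable) ?_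
      filter_upwards [hg1] with y hy
      rw [norm_mul]
      refine mul_le_of_le_one_right (norm_nonneg _) ?_
      rw [norm_inv, Real.norm_of_nonneg (by linarith)]
      exact inv_le_one_of_one_le₀ hy
    refine hi'.congr ?_
    filter_upwards [hg1] with y hy
    rw [mul_assoc, mul_inv_cancel₀ (by linarith), mul_one]

theorem IsEntropySolution.rhs_locallyIntegrableOn [IsFiniteMeasure (volume.restrict Ω)]
    (hΩ : IsOpen Ω) (hp : 1 < p) (hu : IsEntropySolution Ω p a h f u) :
    LocallyIntegrableOn (fun y => (rhs h f u y).toReal) Ω := by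
  intro x hx
  obtain ⟨r, hr, -, -, hi⟩ := hu.exists_nhds_rhs hΩ hp hx
  exact ⟨_, mem_nhdsWithin_of_mem_nhds (Metric.ball_mem_nhds x hr), hi⟩

theorem IsEntropySolution.rhs_ne_top [IsFiniteMeasure (volume.restrict Ω)]
    (hΩ : IsOpen Ω) (hp : 1 < p) (hu : IsEntropySolution Ω p a h f u) :
    ∀ᵐ x ∂(volume.restrict Ω), rhs h f u x ≠ ⊤ := by
  rw [ae_restrict_iff' hΩ.measurableSet, ae_iff]
  refine measure_null_of_locally_null _ fun x hx => ?_
  simp only [mem_ofPred_eq, Classical.not_imp, not_not] at hx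
  obtain ⟨r, hr, hrΩ, ht, -⟩ := hu.exists_nhds_rhs hΩ hp hx.1
  rw [ae_restrict_iff' Metric.isOpen_ball.measurableSet, ae_iff] at ht
  refine ⟨{y | ¬(y ∈ Metric.ball x r → rhs h f u y ≠ ⊤)}, ?_, ht⟩
  filter_upwards [mem_nhdsWithin_of_mem_nhds (Metric.ball_mem_nhds x hr), self_mem_nhdsWithin]
    with y hy hy'
  simp only [Classical.not_imp, not_not] at hy' ⊢
  exact ⟨hy, hy'.2⟩

/-- The entropy inequality for φ = T_j(u) - ψ with j → ∞. Where u ≤ j the truncated function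
T_k(u-φ) is ψ; above j the part of its gradient coming from u contributes with a sign. -/
theorem IsEntropySolution.integral_flux_gradient_le [IsFiniteMeasure (volume.restrict Ω)]
    (hΩ : IsOpen Ω) (hp : 1 < p) {θ : ℝ} (ha : IsAdmissibleOperator Ω p θ a)
    (hu : IsEntropySolution Ω p a h f u) (hflux : Integrable (flux Ω a u) (volume.restrict Ω))
    {ψ : Euc N → ℝ} (hψ : IsTestFunction 1 Ω ψ) :
    ∫ x in Ω, inner ℝ (flux Ω a u x) (gradient ψ x) ≤ ∫ x in Ω, (rhs h f u x).toReal * ψ x := by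
  set μ := volume.restrict Ω with hμ
  have hq : 1 ≤ ENNReal.ofReal p := by simpa using hp.le
  have hT := hu.isTruncW0 hΩ hp
  have hψW : IsW0 Ω (ENNReal.ofReal p) ψ (gradient ψ) := hψ.isW0_one hΩ hq ENNReal.ofReal_ne_top
  obtain ⟨K, hK⟩ := hψ.hasCompactSupport.exists_bound_of_continuous hψ.contDiff.continuous
  simp only [Real.norm_eq_abs] at hK
  have hK0 : 0 ≤ K := (abs_nonneg _).trans (hK 0)
  obtain ⟨K', hK'⟩ := hψ.hasCompactSupport_gradient.exists_bound_of_continuous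
    (hψ.continuous_gradient le_rfl)
  -- Any positive k ≥ sup |ψ| serves; the 1 covers ψ = 0.
  set k : ℝ := K + 1 with hk
  have hk0 : 0 < k := by linarith
  let j : ℕ → ℝ := fun n => (n : ℝ) + 1
  have hj1 : ∀ n, 1 ≤ j n := fun n => by simp [j]
  have hj0 : ∀ n, 0 < j n := fun n => by linarith [hj1 n]
  -- For u ≥ M one has u - j + ψ ≥ k, so replacing u by T_M(u) does not change T_k(u-φ) and places
  -- it in W^{1,p}_0.
  let M : ℕ → ℝ := fun n => j n + k + K
  have hjM : ∀ n, j n ≤ M n := fun n => by simp only [M]; linarith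
  let Φ : ℕ → Euc N → ℝ := fun n x => trunc (j n) (u x) - ψ x
  have hΦ : ∀ n, IsW0 Ω (ENNReal.ofReal p) (Φ n) _ := fun n => (hT.isW0 _ (hj0 n)).sub hψW hq
  have hΦm : ∀ n, MemW0 Ω p (Φ n) := fun n => (memW0_iff hp.le).2 ⟨_, hΦ n⟩
  have hΦb : ∀ n, MemLp (Φ n) ⊤ μ := fun n => memLp_top_of_bound (hΦ n).memLp.1 (j n + K)
    (Eventually.of_forall fun x => (norm_sub_le _ _).trans
      (add_le_add (abs_trunc_le (hj0 n).le _) (hK x)))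
  let w : ℕ → Euc N → ℝ := fun n x => trunc (M n) (u x) - trunc (j n) (u x) + ψ x
  have hw : ∀ n, IsW0 Ω (ENNReal.ofReal p) (w n)
      (fun x => {x | j n < u x ∧ u x ≤ M n}.indicator (genGrad Ω u) x + gradient ψ x) := fun n =>
    (hT.isW0_slice hq hu.nonneg (hj0 n) (hjM n)).add hψW hq
  have hwt := fun n => (hw n).trunc hq ENNReal.ofReal_ne_top hk0.le
  have hfun : ∀ n, (fun y => trunc k (u y - Φ n y)) =ᵐ[μ] fun x => trunc k (w n x) := by
    intro n
    filter_upwards [hu.nonneg] with x hx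
    simp only [Φ, w]
    have hKx := abs_le.1 (hK x)
    have h2 := hj0 n
    have h3 := hjM n
    rcases le_total (u x) (M n) with h1 | h1
    · rw [trunc_of_abs_le (k := M n) (by rwa [abs_of_nonneg hx])]
      congr 1; ring
    · rw [trunc_of_le (k := M n) (by linarith) h1, trunc_of_le (k := j n) h2.le (by linarith),
        trunc_of_le hk0.le, trunc_of_le hk0.le]
      · simp only [M]; linarith
      · simp only [M] at h1; linarith
  have hgrad := fun n => ((hwt n).hasWeakGrad hq).weakGrad_ae_eq hΩ (hfun n)
  have hsm : ∀ n, NullMeasurableSet {x | |w n x| ≤ k} μ := fun n =>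
    nullMeasurableSet_le (hw n).memLp.1.aemeasurable.norm aemeasurable_const
  have hiψ : Integrable (fun x => inner ℝ (flux Ω a u x) (gradient ψ x)) μ := by
    refine (hflux.norm.const_mul K').mono'
      (hflux.1.inner (hψ.continuous_gradient le_rfl).aestronglyMeasurable)
      (Eventually.of_forall fun x => ?_)
    refine (norm_inner_le_norm _ _).trans ?_
    rw [mul_comm]
    exact mul_le_mul_of_nonneg_right (hK' x) (norm_nonneg _)
  have hiv : ∀ n, Integrable (fun x => inner ℝ (flux Ω a u x)
      ({x | j n < u x ∧ u x ≤ M n}.indicator (genGrad Ω u) x)) μ := by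
    intro n
    refine hu.integrable_inner_flux hΩ hp (k := M n) (by linarith [hj0 n, hjM n])
      (hT.isW0_slice hq hu.nonneg (hj0 n) (hjM n)).memLp_grad ?_
    filter_upwards [hu.nonneg] with x hx hx'
    rw [abs_of_nonneg hx] at hx'
    exact indicator_of_notMem (fun h => absurd h.2 (not_le.2 hx')) _
  have hentropy : ∀ n, ∫ x in Ω, {x | |w n x| ≤ k}.indicator
        (fun x => inner ℝ (flux Ω a u x) (gradient ψ x)) x ≤
      ∫ x in Ω, (rhs h f u x).toReal * trunc k (u x - Φ n x) := by
    intro n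
    refine le_trans ?_ (hu.entropy_le k (Φ n) hk0 (hΦm n) (hΦb n))
    have e : ∫ x in Ω, inner ℝ (a x (u x) (genGrad Ω u x))
          (weakGrad Ω (fun y => trunc k (u y - Φ n y)) x) =
        ∫ x in Ω, {x | |w n x| ≤ k}.indicator (fun x => inner ℝ (flux Ω a u x)
          ({x | j n < u x ∧ u x ≤ M n}.indicator (genGrad Ω u) x) +
          inner ℝ (flux Ω a u x) (gradient ψ x)) x := by
      refine integral_congr_ae ?_
      filter_upwards [hgrad n] with x hx
      rw [hx]
      by_cases hx' : x ∈ {x | |w n x| ≤ k}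
      · rw [indicator_of_mem hx', indicator_of_mem hx', inner_add_right]
        rfl
      · rw [indicator_of_notMem hx', indicator_of_notMem hx', inner_zero_right]
    rw [e]
    -- The slice term a·∇u is nonnegative by coercivity and is discarded.
    refine integral_mono_ae (hiψ.indicator₀ (hsm n)) (((hiv n).add hiψ).indicator₀ (hsm n)) ?_
    filter_upwards [ha.inner_nonneg] with x hx
    have : 0 ≤ inner ℝ (flux Ω a u x)
        ({x | j n < u x ∧ u x ≤ M n}.indicator (genGrad Ω u) x) := by
      by_cases hx' : x ∈ {x | j n < u x ∧ u x ≤ M n}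
      · rw [indicator_of_mem hx']; exact hx _ _
      · rw [indicator_of_notMem hx', inner_zero_right]
    refine indicator_rel_indicator le_rfl fun _ => ?_
    linarith
  have hev : ∀ x, 0 ≤ u x → ∀ᶠ n in atTop, u x ≤ j n := by
    intro x _
    obtain ⟨m, hm⟩ := exists_nat_gt (u x)
    filter_upwards [eventually_ge_atTop m] with n hn
    have : (m : ℝ) ≤ n := by exact_mod_cast hn
    simp only [j]; linarith
  have lim1 : Tendsto (fun n => ∫ x in Ω, {x | |w n x| ≤ k}.indicator
        (fun x => inner ℝ (flux Ω a u x) (gradient ψ x)) x) atTop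
      (𝓝 (∫ x in Ω, inner ℝ (flux Ω a u x) (gradient ψ x))) := by
    refine tendsto_integral_of_dominated_convergence _ (fun n => hiψ.1.indicator₀ (hsm n))
      hiψ.norm (fun n => Eventually.of_forall fun x => norm_indicator_le_norm_self _ _) ?_
    filter_upwards [hu.nonneg] with x hx
    refine tendsto_const_nhds.congr' ?_
    filter_upwards [hev x hx] with n hn
    have hmem : x ∈ {x | |w n x| ≤ k} := by
      simp only [w, mem_ofPred_eq]
      rw [trunc_of_abs_le (by rw [abs_of_nonneg hx]; linarith [hjM n]),
        trunc_of_abs_le (by rwa [abs_of_nonneg hx]), sub_self, zero_add]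
      linarith [hK x]
    rw [indicator_of_mem hmem]
  have hloc := hu.rhs_locallyIntegrableOn hΩ hp
  have hiR : Integrable (fun x => (rhs h f u x).toReal * ψ x) μ := by
    have h1 : IntegrableOn (fun x => (rhs h f u x).toReal * ψ x) (tsupport ψ) :=
      (hloc.integrableOn_compact_subset hψ.tsupport_subset hψ.hasCompactSupport).mul_continuousOn
        hψ.contDiff.continuous.continuousOn hψ.hasCompactSupport
    rw [integrableOn_iff_integrable_of_support_subset] at h1
    · exact h1.integrableOn
    · intro x hx
      refine subset_closure ?_
      simp only [Function.mem_support] at hx ⊢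
      exact right_ne_zero_of_mul hx
  have hi1 : Integrable (fun x => (rhs h f u x).toReal * trunc 1 (u x)) μ := by
    have := (hu.rhs_integrable 1 _ one_pos
      ((memW0_iff hp.le).2 ⟨_, IsTestFunction.zero.isW0⟩) IsTestFunction.zero.memLp).2
    simp only [sub_zero] at this
    exact this
  have lim2 : Tendsto (fun n => ∫ x in Ω, (rhs h f u x).toReal * trunc k (u x - Φ n x)) atTop
      (𝓝 (∫ x in Ω, (rhs h f u x).toReal * ψ x)) := by
    have hsmall : ∀ n x, 0 ≤ u x → u x ≤ j n → trunc k (u x - Φ n x) = ψ x := by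
      intro n x hx hn
      simp only [Φ]
      rw [trunc_of_abs_le (k := j n) (by rwa [abs_of_nonneg hx]), trunc_of_abs_le]
      · ring
      · have := hK x
        rw [show u x - (u x - ψ x) = ψ x by ring]
        linarith
    -- Where u > j ≥ 1 the test function is bounded by k = k T_1(u), and h(u) f T_1(u) is integrable
    -- by the choice φ = 0.
    refine tendsto_integral_of_dominated_convergence
      (fun x => ‖(rhs h f u x).toReal * ψ x‖ + k * ((rhs h f u x).toReal * trunc 1 (u x)))
      (fun n => (hu.rhs_integrable k (Φ n) hk0 (hΦm n) (hΦb n)).2.1)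
      (hiR.norm.add (hi1.const_mul k)) (fun n => ?_) ?_
    · filter_upwards [hu.nonneg] with x hx
      have h0 : 0 ≤ (rhs h f u x).toReal := ENNReal.toReal_nonneg
      have h1 : 0 ≤ trunc 1 (u x) := trunc_nonneg zero_le_one hx
      rcases le_total (u x) (j n) with h2 | h2
      · rw [hsmall n x hx h2]
        have : 0 ≤ k * ((rhs h f u x).toReal * trunc 1 (u x)) := by positivity
        linarith
      · rw [trunc_of_le zero_le_one ((hj1 n).trans h2), mul_one, norm_mul,
          Real.norm_of_nonneg h0, Real.norm_eq_abs]
        have h3 := mul_le_mul_of_nonneg_left (abs_trunc_le hk0.le (u x - Φ n x)) h0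
        have h4 := norm_nonneg ((rhs h f u x).toReal * ψ x)
        linarith
    · filter_upwards [hu.nonneg] with x hx
      refine tendsto_const_nhds.congr' ?_
      filter_upwards [hev x hx] with n hn
      rw [hsmall n x hx hn]
  exact le_of_tendsto_of_tendsto' lim1 lim2 hentropy

theorem IsEntropySolution.isDistributionalSolution [IsFiniteMeasure (volume.restrict Ω)]
    (hΩ : IsOpen Ω) (hp : 1 < p) {θ : ℝ} (ha : IsAdmissibleOperator Ω p θ a)
    (hu : IsEntropySolution Ω p a h f u)
    (h1 : Integrable (fun x => ‖genGrad Ω u x‖ ^ (p - 1)) (volume.restrict Ω))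
    (h2 : Integrable (fun x => |u x| ^ (p - 1)) (volume.restrict Ω)) :
    IsDistributionalSolution Ω a h f u := by
  have hflux : Integrable (flux Ω a u) (volume.restrict Ω) := by
    obtain ⟨β, ℓ, hβ, hℓ0, hℓ, hgr⟩ := ha.growth
    have hp' : 1 ≤ p / (p - 1) := by
      rw [le_div_iff₀ (by linarith)]; linarith
    have hℓi : Integrable ℓ (volume.restrict Ω) := hℓ.integrable (by simpa using hp')
    refine (((hℓi.add h2).add h1).const_mul β).mono' (hu.aestronglyMeasurable_flux hΩ hp) ?_
    filter_upwards [hgr] with x hx using hx _ _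
  refine ⟨hu.aemeasurable, hu.nonneg, fun k hk => ?_,
    locallyIntegrableOn_of_locallyIntegrable_restrict hflux.locallyIntegrable,
    hu.rhs_ne_top hΩ hp, hu.rhs_locallyIntegrableOn hΩ hp, fun φ hφ => ?_⟩
  · obtain ⟨G, hG⟩ := (memW0_iff hp.le).1 (hu.trunc_mem k hk)
    exact (memW0_iff le_rfl).2 ⟨G, hG.mono (by simp) (ENNReal.ofReal_le_ofReal hp.le)⟩
  · refine le_antisymm (hu.integral_flux_gradient_le hΩ hp ha hflux hφ) ?_
    have := hu.integral_flux_gradient_le hΩ hp ha hflux (hφ.const_mul (-1))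
    have e : ∀ x, gradient (fun x => -1 * φ x) x = -gradient φ x := fun x => by
      rw [gradient_fun_const_mul (hφ.differentiable le_rfl x)]; simp
    simp only [e, inner_neg_right] at this
    simp only [neg_mul, one_mul, mul_neg] at this
    rw [integral_neg, integral_neg] at this
    exact neg_le_neg_iff.1 this

end

/-! ### Arithmetic of the threshold and the first two assertions. -/

section
variable {Ω : Set (Euc N)} {u : Euc N → ℝ} {p : ℝ} {a : Euc N → ℝ → Euc N → Euc N}
  {h : ℝ → ℝ≥0∞} {f : Euc N → ℝ}

/-- With M = N the last factor is 1 - κ/r, so the quotient in the threshold is 1/(1 - κ/r), the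
Hölder exponent of the energy argument. -/
theorem threshold_denom_eq {M p θ γ₂ : ℝ} (hp : 1 < p) (hpM : p < M) :
    (M * (1 - θ) + 1 + θ * (p - 1)) * (p - 1) + γ₂ * (M - p + 1) =
      M * (p - 1) * (1 - (θ - (1 / (M - p + 1) + γ₂ / (p - 1))) * (M - p + 1) / M) := by
  have h1 : p - 1 ≠ 0 := by linarith
  have h2 : M - p + 1 ≠ 0 := by linarith
  have h3 : M ≠ 0 := by linarith
  field_simp
  ring

/-- This is κ/r ≤ e. It makes the absorption possible and keeps the denominator of the threshold
positive. -/
theorem sub_criticalTheta_le {p θ γ₂ : ℝ} (hp : 1 < p) (hpN : p < N)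
    (hθ : θ ≤ 1 + γ₂ / (p - 1)) :
    (θ - criticalTheta N p γ₂) * (N - p + 1) / N ≤ (N - p) / N := by
  have h2 : (0 : ℝ) < N - p + 1 := by linarith
  have h3 : (0 : ℝ) < N := by linarith
  have h4 : θ - criticalTheta N p γ₂ ≤ 1 - 1 / (N - p + 1) := by
    rw [criticalTheta]; linarith
  gcongr
  calc (θ - criticalTheta N p γ₂) * (N - p + 1) ≤ (1 - 1 / (N - p + 1)) * (N - p + 1) := by gcongr
    _ = N - p := by field_simp; ring

theorem threshold_eq {p θ γ₂ : ℝ} (hp : 1 < p) (hpN : p < N) :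
    threshold N p θ γ₂ =
      max (1 / (1 - (θ - criticalTheta N p γ₂) * (N - p + 1) / N)) 1 := by
  have h3 : (0 : ℝ) < N := by linarith
  rw [threshold, threshold_denom_eq hp hpN, criticalTheta]
  congr 1
  have : (N : ℝ) * (p - 1) ≠ 0 := mul_ne_zero h3.ne' (by linarith)
  rw [div_mul_eq_div_div, div_self this]

theorem threshold_eq_one_iff {p θ γ₂ : ℝ} (hp : 1 < p) (hpN : p < N)
    (hθ : θ ≤ 1 + γ₂ / (p - 1)) : threshold N p θ γ₂ = 1 ↔ θ ≤ criticalTheta N p γ₂ := by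
  have h2 : (0 : ℝ) < N - p + 1 := by linarith
  have h3 : (0 : ℝ) < N := by linarith
  have h4 := sub_criticalTheta_le hp hpN hθ
  have h5 : ((N : ℝ) - p) / N < 1 := by rw [div_lt_one h3]; linarith
  rw [threshold_eq hp hpN, max_eq_right_iff, div_le_one (by linarith)]
  constructor
  · intro h
    by_contra hlt
    have : 0 < (θ - criticalTheta N p γ₂) * (N - p + 1) / N := by
      have : 0 < θ - criticalTheta N p γ₂ := by linarith
      positivity
    linarith
  · intro h
    have : (θ - criticalTheta N p γ₂) * (N - p + 1) / N ≤ 0 :=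
      div_nonpos_of_nonpos_of_nonneg (mul_nonpos_of_nonpos_of_nonneg (by linarith) h2.le) h3.le
    linarith

theorem IsEntropySolution.isDistributionalSolution_of_threshold_le (hΩ : IsOpen Ω)
    (hΩb : Bornology.IsBounded Ω) (hp : 1 < p) (hpN : p < N) {θ γ₂ m : ℝ} (hγ : 0 ≤ γ₂)
    (hθ : 0 ≤ θ) (hθ1 : θ ≤ 1 + γ₂ / (p - 1)) (ha : IsAdmissibleOperator Ω p θ a)
    (hh : IsAdmissibleSource γ₂ h) (hf0 : ∀ᵐ x ∂(volume.restrict Ω), 0 ≤ f x)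
    (hf : MemLp f (ENNReal.ofReal m) (volume.restrict Ω))
    (hm : θ ≠ criticalTheta N p γ₂ → threshold N p θ γ₂ ≤ m)
    (hm' : θ = criticalTheta N p γ₂ → 1 < m)
    (hu : IsEntropySolution Ω p a h f u) : IsDistributionalSolution Ω a h f u := by
  have : IsFiniteMeasure (volume.restrict Ω) := ⟨by
    rw [Measure.restrict_apply_univ]; exact hΩb.measure_lt_top⟩
  have hL : (0 : ℝ) < N - p + 1 := by linarith
  have hN : (0 : ℝ) < N := by linarith
  have hp1 : 0 < p - 1 := by linarith
  have hNp : (0 : ℝ) < N - p := by linarith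
  -- The unique solution of the two linear relations r = -ρp(p-1), from Young, and r(N-p)/N = ρp +
  -- p, from Sobolev.
  set ρ : ℝ := -(N / (p * (N - p + 1))) with hρ
  set r : ℝ := N * (p - 1) / (N - p + 1) with hr_def
  have hρp : ρ * p = -(N / (N - p + 1)) := by rw [hρ]; field_simp
  have hr : r = -(ρ * p * (p - 1)) := by rw [hρp, hr_def]; ring
  have hr0 : 0 < r := by positivity
  have hrp : p - 1 ≤ r := by
    rw [hr_def, le_div_iff₀ hL]; nlinarith
  have hre : r * ((N - p) / N) = ρ * p + p := by
    rw [hρp, hr_def]; field_simp; ring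
  have hκ : ∀ θ' : ℝ, ρ * p + 1 + θ' * (p - 1) - γ₂ = (p - 1) * (θ' - criticalTheta N p γ₂) := by
    intro θ'
    rw [hρp, criticalTheta]; field_simp; ring
  have hκr : ∀ θ' : ℝ, (p - 1) * (θ' - criticalTheta N p γ₂) / r =
      (θ' - criticalTheta N p γ₂) * (N - p + 1) / N := by
    intro θ'
    rw [hr_def]; field_simp
  have key : ∀ θ' : ℝ, θ ≤ θ' → 1 ≤ m →
      (θ' < criticalTheta N p γ₂ ∨ (criticalTheta N p γ₂ < θ' ∧ θ' ≤ 1 + γ₂ / (p - 1) ∧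
        1 / m ≤ 1 - (θ' - criticalTheta N p γ₂) * (N - p + 1) / N)) →
      IsDistributionalSolution Ω a h f u := by
    intro θ' hθθ' hm1 hc
    obtain ⟨h1, h2⟩ := hu.integrable_of_exponents hΩ hp hpN (hθ.trans hθθ') hγ
      (ha.mono hp hθθ') hh hf0 hm1 hf hr hrp hre (hκ θ').symm (by
        rcases hc with hc | ⟨hc1, hc2, hc3⟩
        · exact Or.inl (mul_neg_of_pos_of_neg hp1 (by linarith))
        · refine Or.inr ⟨mul_pos hp1 (by linarith), ?_, ?_⟩
          · rw [hκr]; exact sub_criticalTheta_le hp hpN hc2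
          · rw [hκr]; exact hc3)
    exact hu.isDistributionalSolution hΩ hp ha h1 h2
  rcases lt_trichotomy θ (criticalTheta N p γ₂) with hlt | heq | hgt
  · exact key θ le_rfl ((le_max_right _ _).trans (hm hlt.ne)) (Or.inl hlt)
  · have hm1 := hm' heq
    have h1m : 1 / m < 1 := by rw [div_lt_one (by linarith)]; exact hm1
    -- At θ = θ_* the exponent κ vanishes and the geometric sums diverge, so θ is raised by δ. The
    -- first bound keeps m above the new Hölder exponent; the second keeps θ_* + δ ≤ 1 + γ₂/(p-1).
    set δ : ℝ := min ((1 - 1 / m) * N / (N - p + 1)) ((N - p) / (N - p + 1)) with hδ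
    have hδ0 : 0 < δ := lt_min (div_pos (mul_pos (by linarith) hN) hL) (div_pos hNp hL)
    refine key (criticalTheta N p γ₂ + δ) (by linarith) hm1.le (Or.inr ⟨by linarith, ?_, ?_⟩)
    · have h1 : δ ≤ (N - p) / (N - p + 1) := min_le_right _ _
      have h2 : ((N : ℝ) - p) / (N - p + 1) = 1 - 1 / (N - p + 1) := by field_simp; ring
      rw [criticalTheta]
      linarith
    · have h1 : δ ≤ (1 - 1 / m) * N / (N - p + 1) := min_le_left _ _
      rw [le_div_iff₀ hL] at h1
      have h2 : δ * (N - p + 1) / N ≤ 1 - 1 / m := by rw [div_le_iff₀ hN]; exact h1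
      rw [add_sub_cancel_left]
      linarith
  · have hm1 := hm hgt.ne'
    rw [threshold_eq hp hpN] at hm1
    have h4 := sub_criticalTheta_le hp hpN hθ1
    have h5 : ((N : ℝ) - p) / N < 1 := by rw [div_lt_one hN]; linarith
    have h1m : 1 ≤ m := (le_max_right _ _).trans hm1
    refine key θ le_rfl h1m (Or.inr ⟨hgt, hθ1, ?_⟩)
    exact (one_div_le (by linarith) (by linarith)).1 ((le_max_left _ _).trans hm1)

end

/-! ### Powers of |x|, the model operator and its skew perturbation. -/

theorem integrableOn_norm_rpow_iff (hN : 1 ≤ N) {r : ℝ} (hr : 0 < r) (s : ℝ) :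
    IntegrableOn (fun x : Euc N => ‖x‖ ^ s) (Metric.ball 0 r) ↔ -(N : ℝ) < s := by
  have : Nonempty (Fin N) := ⟨⟨0, hN⟩⟩
  have h1 := integrableOn_fun_norm_addHaar (volume : Measure (Euc N)) (r := r)
    (f := fun y : ℝ => y ^ s)
  rw [h1, finrank_euclideanSpace_fin, integrableOn_congr_fun (g := fun y : ℝ => y ^ ((N : ℝ) - 1 + s))
    _ measurableSet_Ioo, intervalIntegral.integrableOn_Ioo_rpow_iff hr]
  · constructor <;> intro h <;> linarith
  · intro y hy
    simp only [smul_eq_mul]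
    rw [← Real.rpow_natCast, ← Real.rpow_add hy.1, Nat.cast_sub hN, Nat.cast_one]

theorem ae_ne_zero_ball (hN : 1 ≤ N) :
    ∀ᵐ x ∂(volume.restrict (Metric.ball (0 : Euc N) 1)), x ≠ 0 := by
  have : Nonempty (Fin N) := ⟨⟨0, hN⟩⟩
  exact ae_restrict_of_ae (Measure.ae_ne volume 0)

theorem aestronglyMeasurable_norm_rpow (s : ℝ) (μ : Measure (Euc N)) :
    AEStronglyMeasurable (fun x : Euc N => ‖x‖ ^ s) μ :=
  (measurable_norm.pow_const s).aestronglyMeasurable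

theorem memLp_radialDatum_iff (hN : 1 ≤ N) {C ε m : ℝ} (hC : 0 < C) (hε : ε < N) (hm : 0 < m) :
    MemLp (radialDatum N C ε) (ENNReal.ofReal m)
      (volume.restrict (Metric.ball (0 : Euc N) 1)) ↔ m < (N : ℝ) / ((N : ℝ) - ε) := by
  have hmeas : AEStronglyMeasurable (radialDatum N C ε)
      (volume.restrict (Metric.ball (0 : Euc N) 1)) :=
    (measurable_const.div (measurable_norm.pow_const _)).aestronglyMeasurable
  rw [← integrable_norm_rpow_iff hmeas (by simpa using hm) ENNReal.ofReal_ne_top,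
    ENNReal.toReal_ofReal hm.le, lt_div_iff₀ (by linarith), 
    integrable_congr (g := fun x : Euc N => C ^ m * ‖x‖ ^ (-(m * ((N : ℝ) - ε))))]
  · rw [integrable_const_mul_iff (by simpa using (Real.rpow_pos_of_pos hC m).ne')]
    refine (integrableOn_norm_rpow_iff hN one_pos _).trans ?_
    rw [neg_lt_neg_iff]
  · refine Eventually.of_forall fun x => ?_
    have h0 : 0 ≤ ‖x‖ ^ ((N : ℝ) - ε) := by positivity
    simp only [radialDatum]
    rw [Real.norm_of_nonneg (by positivity), Real.div_rpow hC.le h0, ← Real.rpow_mul (norm_nonneg _),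
      Real.rpow_neg (norm_nonneg _), mul_comm m, div_eq_mul_inv]

/-- The model operator perturbed by a linear map. -/
def perturbedOperator (θ : ℝ) (S : Euc N →L[ℝ] Euc N) (_x : Euc N) (s : ℝ) (ξ : Euc N) : Euc N :=
  ((1 + |s|) ^ θ)⁻¹ • ξ + S ξ

theorem perturbedOperator_zero (θ : ℝ) : perturbedOperator θ (0 : Euc N →L[ℝ] Euc N) =
    modelOperator N θ := by
  funext x s ξ
  simp [perturbedOperator, modelOperator]

theorem one_add_abs_rpow_inv_le_one {θ : ℝ} (hθ : 0 ≤ θ) (s : ℝ) : ((1 + |s|) ^ θ)⁻¹ ≤ 1 :=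
  inv_le_one_of_one_le₀ (Real.one_le_rpow (by linarith [abs_nonneg s]) hθ)

theorem continuous_one_add_abs_rpow_inv (θ : ℝ) :
    Continuous (fun s : ℝ => ((1 + |s|) ^ θ)⁻¹) := by
  have h : ∀ s : ℝ, 0 < 1 + |s| := fun s => by positivity
  refine Continuous.inv₀ (Continuous.rpow_const (by fun_prop) fun s => Or.inl (h s).ne') fun s => ?_
  exact (Real.rpow_pos_of_pos (h s) θ).ne'

theorem norm_perturbedOperator_le {θ : ℝ} (hθ : 0 ≤ θ) (S : Euc N →L[ℝ] Euc N) (x : Euc N) (s : ℝ)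
    (ξ : Euc N) : ‖perturbedOperator θ S x s ξ‖ ≤ (1 + ‖S‖) * ‖ξ‖ := by
  refine (norm_add_le _ _).trans ?_
  rw [add_mul, norm_smul, Real.norm_of_nonneg (by positivity)]
  gcongr
  · exact one_add_abs_rpow_inv_le_one hθ s
  · exact S.le_opNorm ξ

theorem continuous_perturbedOperator (θ : ℝ) (S : Euc N →L[ℝ] Euc N) (x : Euc N) :
    Continuous (fun z : ℝ × Euc N => perturbedOperator θ S x z.1 z.2) :=
  (((continuous_one_add_abs_rpow_inv θ).comp continuous_fst).smul continuous_snd).add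
    (S.continuous.comp continuous_snd)

theorem inner_perturbedOperator {S : Euc N →L[ℝ] Euc N} (hS : ∀ x, inner ℝ (S x) x = 0) (θ : ℝ)
    (x : Euc N) (s : ℝ) (ξ : Euc N) :
    inner ℝ (perturbedOperator θ S x s ξ) ξ = ((1 + |s|) ^ θ)⁻¹ * ‖ξ‖ ^ 2 := by
  rw [perturbedOperator, inner_add_left, hS, real_inner_smul_left, real_inner_self_eq_norm_sq,
    add_zero]

theorem isAdmissibleOperator_perturbed (Ω : Set (Euc N)) [IsFiniteMeasure (volume.restrict Ω)]
    {θ : ℝ} (hθ : 0 ≤ θ) {S : Euc N →L[ℝ] Euc N} (hS : ∀ x, inner ℝ (S x) x = 0) :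
    IsAdmissibleOperator Ω 2 θ (perturbedOperator θ S) where
  measurable s ξ := aemeasurable_const
  continuous := Eventually.of_forall fun x => continuous_perturbedOperator θ S x
  coercive := by
    refine ⟨fun s => ((1 + |s|) ^ θ)⁻¹, continuous_one_add_abs_rpow_inv θ, ⟨1, fun s => ?_⟩,
      ⟨1, one_pos, fun s => ?_⟩, Eventually.of_forall fun x s ξ => ?_⟩
    · rw [abs_of_nonneg (by positivity)]
      exact one_add_abs_rpow_inv_le_one hθ s
    · norm_num
    · rw [inner_perturbedOperator hS]
      norm_num
  growth := by
    refine ⟨1 + ‖S‖, 0, by positivity, Eventually.of_forall fun x => le_rfl, MemLp.zero,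
      Eventually.of_forall fun x s ξ => ?_⟩
    refine (norm_perturbedOperator_le hθ S x s ξ).trans ?_
    have : (2 : ℝ) - 1 = 1 := by norm_num
    simp only [this, Real.rpow_one, Pi.zero_apply, zero_add]
    gcongr
    linarith [abs_nonneg s]

theorem isStrictlyMonotone_perturbed (Ω : Set (Euc N)) (θ : ℝ) {S : Euc N →L[ℝ] Euc N}
    (hS : ∀ x, inner ℝ (S x) x = 0) : IsStrictlyMonotone Ω (perturbedOperator θ S) := by
  refine Eventually.of_forall fun x s ξ ξ' h => ?_
  have : perturbedOperator θ S x s ξ - perturbedOperator θ S x s ξ' =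
      perturbedOperator θ S x s (ξ - ξ') := by
    simp only [perturbedOperator, smul_sub, map_sub]
    abel
  rw [this, inner_perturbedOperator hS]
  have : 0 < ‖ξ - ξ'‖ := norm_pos_iff.2 (sub_ne_zero.2 h)
  positivity

theorem modelSource_ne_top (γ₂ s : ℝ) : modelSource γ₂ s ≠ ⊤ := ENNReal.ofReal_ne_top

theorem isAdmissibleSource_model {γ₂ : ℝ} (hγ : 0 ≤ γ₂) :
    IsAdmissibleSource γ₂ (modelSource γ₂) where
  continuousOn := by
    refine ENNReal.continuous_ofReal.comp_continuousOn ?_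
    refine ContinuousOn.inv₀ (ContinuousOn.rpow_const (by fun_prop) fun s hs => ?_) fun s hs => ?_
    · left; rw [mem_Ioi] at hs; linarith
    · rw [mem_Ioi] at hs
      exact (Real.rpow_pos_of_pos (by linarith) _).ne'
  finite s _ := modelSource_ne_top γ₂ s
  decay := by
    refine ⟨1, 1, one_pos, one_pos, fun s hs => ENNReal.ofReal_le_ofReal ?_⟩
    rw [one_div]
    have : 0 < s ^ γ₂ := Real.rpow_pos_of_pos (by linarith) _
    gcongr
    linarith


/-! ### Truncations of u = |x|^α - 1. -/

theorem gradient_norm_sq (x : Euc N) : gradient (fun y : Euc N => ‖y‖ ^ 2) x = (2 : ℝ) • x := by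
  have h := (hasStrictFDerivAt_norm_sq x).hasFDerivAt
  rw [gradient, h.fderiv]
  apply (InnerProductSpace.toDual ℝ (Euc N)).injective
  ext y
  simp [two_mul]

theorem gradient_comp_norm_sq {F : ℝ → ℝ} {x : Euc N} (hF : DifferentiableAt ℝ F (‖x‖ ^ 2)) :
    gradient (fun y : Euc N => F (‖y‖ ^ 2)) x = (2 * deriv F (‖x‖ ^ 2)) • x := by
  rw [gradient_comp (f := fun y : Euc N => ‖y‖ ^ 2) hF
    (hasStrictFDerivAt_norm_sq x).hasFDerivAt.differentiableAt, gradient_norm_sq, smul_smul,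
    mul_comm]

theorem norm_sq_rpow (x : Euc N) (s : ℝ) : (‖x‖ ^ 2) ^ s = ‖x‖ ^ (2 * s) := by
  rw [← Real.rpow_natCast, ← Real.rpow_mul (norm_nonneg x), Nat.cast_ofNat]

theorem gradient_norm_rpow_sub_one {x : Euc N} (hx : x ≠ 0) (α : ℝ) :
    gradient (fun y : Euc N => ‖y‖ ^ α - 1) x = (α * ‖x‖ ^ (α - 2)) • x := by
  have hx0 : ‖x‖ ^ 2 ≠ 0 := by simpa using hx
  have hd := (Real.hasDerivAt_rpow_const (x := ‖x‖ ^ 2) (p := α / 2) (Or.inl hx0)).sub_const 1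
  have h : (fun y : Euc N => ‖y‖ ^ α - 1) = fun y => (fun t : ℝ => t ^ (α / 2) - 1) (‖y‖ ^ 2) := by
    funext y
    simp only [norm_sq_rpow]
    rw [mul_div_cancel₀ _ two_ne_zero]
  rw [h, gradient_comp_norm_sq hd.differentiableAt, hd.deriv, norm_sq_rpow]
  congr 1
  rw [← mul_assoc, mul_div_cancel₀ _ two_ne_zero]
  congr 2
  ring

/-- A smooth positive substitute for max(t, δ), obtained by interpolating between δ/2 and t. It
removes the singularity of |x|^α where the truncation cannot see it. -/
theorem exists_smooth_max {δ : ℝ} (hδ : 0 < δ) : ∃ m : ℝ → ℝ, ContDiff ℝ ∞ m ∧ (∀ t, 0 < m t) ∧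
    (∀ t, δ ≤ t → m t = t) ∧ ∀ t, t ≤ δ → m t ≤ δ := by
  let χ : ℝ → ℝ := fun t => Real.smoothTransition (2 * t / δ - 1)
  have hχ : ContDiff ℝ ∞ χ := Real.smoothTransition.contDiff.comp (by fun_prop)
  have h0 : ∀ t, 0 ≤ χ t := fun t => Real.smoothTransition.nonneg _
  have h1 : ∀ t, χ t ≤ 1 := fun t => Real.smoothTransition.le_one _
  refine ⟨fun t => t * χ t + (1 - χ t) * (δ / 2), by fun_prop, fun t => ?_, fun t ht => ?_,
    fun t ht => ?_⟩
  · simp only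
    rcases le_or_gt t (δ / 2) with ht | ht
    · have : χ t = 0 := Real.smoothTransition.zero_of_nonpos (by
        rw [sub_nonpos, div_le_one hδ]; linarith)
      rw [this]; linarith
    · nlinarith [h0 t, h1 t]
  · have : χ t = 1 := Real.smoothTransition.one_of_one_le (by
      rw [le_sub_iff_add_le, le_div_iff₀ hδ]; linarith)
    simp only [this]; ring
  · simp only
    nlinarith [h0 t, h1 t]

instance isFiniteMeasure_restrict_ball (x : Euc N) (r : ℝ) :
    IsFiniteMeasure (volume.restrict (Metric.ball x r)) :=
  ⟨by rw [Measure.restrict_apply_univ]; exact measure_ball_lt_top⟩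

/-- Near the origin u exceeds k, so T_k(u) is also the truncation of a smooth function W which is
positive exactly in the ball. The lemmas on positive functions and on truncation then apply. -/
theorem isTruncW0_norm_rpow_sub_one (hN : 1 ≤ N) {α : ℝ} (hα : α < 0) {q : ℝ≥0∞} (hq : 1 ≤ q)
    (hq' : q ≠ ⊤) : IsTruncW0 (Metric.ball (0 : Euc N) 1) q (fun x => ‖x‖ ^ α - 1)
      (fun x => (α * ‖x‖ ^ (α - 2)) • x) := by
  refine ⟨((aestronglyMeasurable_norm_rpow _ _).const_mul α).smul
    continuous_id.aestronglyMeasurable, fun k hk => ?_⟩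
  have hρ0 : 0 < (k + 2) ^ (2 / α) := Real.rpow_pos_of_pos (by linarith) _
  -- Chosen so that u = k + 1 on |x|² = δ; both u and W are then at least k + 1 on the rest of |x|²
  -- ≤ δ, the origin excepted for u.
  obtain ⟨δ, hδ⟩ : ∃ δ, δ = (k + 2) ^ (2 / α) := ⟨_, rfl⟩
  have hδ1 : δ < 1 := by
    rw [hδ]
    exact Real.rpow_lt_one_of_one_lt_of_neg (by linarith) (div_neg_of_pos_of_neg two_pos hα)
  rw [← hδ] at hρ0
  have hδk : δ ^ (α / 2) = k + 2 := by
    rw [hδ, ← Real.rpow_mul (by linarith), show 2 / α * (α / 2) = 1 by field_simp [hα.ne], Real.rpow_one]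
  obtain ⟨m, hm, hm0, hm1, hm2⟩ := exists_smooth_max hρ0
  have hmlt : ∀ t, t < 1 → m t < 1 := fun t ht => by
    rcases le_total t δ with h | h
    · exact (hm2 t h).trans_lt hδ1
    · rwa [hm1 t h]
  let W : Euc N → ℝ := fun x => m (‖x‖ ^ 2) ^ (α / 2) - 1
  have hα2 : α / 2 < 0 := by linarith
  have hWs : ContDiff ℝ ∞ W :=
    ((hm.comp (contDiff_norm_sq ℝ)).rpow_const_of_ne fun x => (hm0 _).ne').sub contDiff_const
  have hWeq : ∀ x, δ ≤ ‖x‖ ^ 2 → W x = ‖x‖ ^ α - 1 := fun x hx => by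
    simp only [W]
    rw [hm1 _ hx, norm_sq_rpow, mul_div_cancel₀ _ two_ne_zero]
  have hWge : ∀ x, ‖x‖ ^ 2 ≤ δ → k + 1 ≤ W x := fun x hx => by
    have := Real.rpow_le_rpow_of_nonpos (hm0 _) (hm2 _ hx) hα2.le
    rw [hδk] at this
    simp only [W]
    linarith
  have huge : ∀ x : Euc N, x ≠ 0 → ‖x‖ ^ 2 ≤ δ → k + 1 ≤ ‖x‖ ^ α - 1 := fun x hx0 hx => by
    have := Real.rpow_le_rpow_of_nonpos (by positivity) hx hα2.le
    rw [hδk, norm_sq_rpow, mul_div_cancel₀ _ two_ne_zero] at this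
    linarith
  have hW0 : IsW0 (Metric.ball (0 : Euc N) 1) q W (gradient W) := by
    refine isW0_of_pos Metric.isBounded_ball Metric.isOpen_ball hq hq' hWs (fun x hx => ?_)
      fun x hx => ?_
    · rw [mem_ball_zero_iff] at hx
      have : 1 < m (‖x‖ ^ 2) ^ (α / 2) := Real.one_lt_rpow_of_pos_of_lt_one_of_neg (hm0 _)
        (hmlt _ (pow_lt_one₀ (norm_nonneg x) hx two_ne_zero)) hα2
      simp only [W]
      linarith
    · rw [mem_ball_zero_iff, not_lt] at hx
      rw [hWeq x (hδ1.le.trans (one_le_pow₀ hx))]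
      linarith [Real.rpow_le_one_of_one_le_of_nonpos hx hα.le]
  refine (hW0.trunc hq hq' hk.le).congr ?_ ?_
  · filter_upwards [ae_ne_zero_ball hN] with x hx
    rcases le_total (‖x‖ ^ 2) δ with h | h
    · rw [trunc_of_le hk.le (by linarith [hWge x h]), trunc_of_le hk.le (by linarith [huge x hx h])]
    · rw [hWeq x h]
  · filter_upwards [ae_ne_zero_ball hN] with x hx
    rcases le_or_gt (‖x‖ ^ 2) δ with h | h
    · rw [indicator_of_notMem, indicator_of_notMem]
      · intro h'
        have h'' : |‖x‖ ^ α - 1| ≤ k := h'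
        linarith [huge x hx h, le_abs_self (‖x‖ ^ α - 1)]
      · intro h'
        have h'' : |W x| ≤ k := h'
        linarith [hWge x h, le_abs_self (W x)]
    · have e : gradient W x = (α * ‖x‖ ^ (α - 2)) • x := by
        rw [← gradient_norm_rpow_sub_one hx α]
        have : W =ᶠ[𝓝 x] fun y => ‖y‖ ^ α - 1 := by
          filter_upwards [(isOpen_lt continuous_const (continuous_norm.pow 2)).mem_nhds h] with y hy
            using hWeq y (le_of_lt hy)
        rw [gradient, gradient, this.fderiv_eq]
      simp only [indicator, mem_ofPred_eq, hWeq x h.le, e]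

/-! ### The divergence theorem for singular radial and rotational fields. -/

theorem EuclideanSpace_real_inner_eq_sum (x y : Euc N) : inner ℝ x y = ∑ i, x i * y i := by
  rw [PiLp.inner_apply]
  simp [mul_comm]

theorem integral_inner_gradient {Ω : Set (Euc N)} {η : Euc N → ℝ} (hη : IsTestFunction ∞ Ω η)
    {V : Euc N → Euc N} (hV : ContDiff ℝ 1 V) :
    ∫ x in Ω, inner ℝ (V x) (gradient η x) =
      - ∫ x in Ω, (∑ i, fderiv ℝ V x (EuclideanSpace.single i 1) i) * η x := by
  have hVi : ∀ i : Fin N, ContDiff ℝ 1 (fun x => V x i) := fun i =>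
    (EuclideanSpace.proj (𝕜 := ℝ) i).contDiff.comp hV
  have hVd : ∀ (i : Fin N) x v, fderiv ℝ (fun x => V x i) x v = fderiv ℝ V x v i := by
    intro i x v
    have := ((EuclideanSpace.proj (𝕜 := ℝ) i).hasFDerivAt.comp x
      (hV.differentiable (by simp) x).hasFDerivAt).fderiv
    have h2 : fderiv ℝ (fun x => V x i) x = (EuclideanSpace.proj (𝕜 := ℝ) i).comp (fderiv ℝ V x) :=
      this
    rw [h2]; rfl
  have hη0 : ∀ x ∉ Ω, η x = 0 := fun x hx =>
    image_eq_zero_of_notMem_tsupport fun h => hx (hη.tsupport_subset h)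
  have hη0' : ∀ x ∉ Ω, fderiv ℝ η x = 0 := fun x hx => by
    by_contra h
    exact hx (hη.tsupport_subset (support_fderiv_subset ℝ (f := η) h))
  have hη' : ∀ i : Fin N, Continuous (fun x => fderiv ℝ η x (EuclideanSpace.single i 1)) := fun i =>
    (hη.contDiff.continuous_fderiv (by simp)).clm_apply continuous_const
  rw [setIntegral_eq_integral_of_forall_compl_eq_zero fun x hx => by
      rw [gradient, hη0' x hx, map_zero, inner_zero_right],
    setIntegral_eq_integral_of_forall_compl_eq_zero fun x hx => by rw [hη0 x hx, mul_zero]]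
  have e1 : ∀ x, inner ℝ (V x) (gradient η x) =
      ∑ i, fderiv ℝ η x (EuclideanSpace.single i 1) * V x i := by
    intro x
    rw [EuclideanSpace_real_inner_eq_sum]
    refine Finset.sum_congr rfl fun i _ => ?_
    rw [← inner_gradient_left, EuclideanSpace.inner_single_right, mul_comm]
    simp
  simp_rw [e1, Finset.sum_mul]
  rw [integral_finsetSum, integral_finsetSum, ← Finset.sum_neg_distrib]
  · refine Finset.sum_congr rfl fun i _ => ?_
    have := integral_gradient_mul hη (hVi i) (EuclideanSpace.single i 1)
    simp_rw [hVd] at this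
    rw [← neg_eq_iff_eq_neg, ← this]
    exact integral_congr_ae (Eventually.of_forall fun x => mul_comm _ _)
  · intro i _
    have hc : Continuous (fun x => fderiv ℝ V x (EuclideanSpace.single i 1) i) :=
      (EuclideanSpace.proj (𝕜 := ℝ) i).continuous.comp
        ((hV.continuous_fderiv (by simp)).clm_apply continuous_const)
    exact (hc.mul hη.contDiff.continuous).integrable_of_hasCompactSupport
      hη.hasCompactSupport.mul_left
  · intro i _
    exact ((hη' i).mul (hVi i).continuous).integrable_of_hasCompactSupport
      ((hη.hasCompactSupport.fderiv_apply (𝕜 := ℝ) _).mul_right)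

/-- The part Q(|x|²) Sx is divergence free: S has zero diagonal, and Sx is orthogonal to the radial
gradient of Q(|x|²). -/
theorem sum_fderiv_radial {S : Euc N →L[ℝ] Euc N} (hS : ∀ x, inner ℝ (S x) x = 0) {P Q : ℝ → ℝ}
    (hP : Differentiable ℝ P) (hQ : Differentiable ℝ Q) (x : Euc N) :
    ∑ i, fderiv ℝ (fun x => P (‖x‖ ^ 2) • x + Q (‖x‖ ^ 2) • S x) x (EuclideanSpace.single i 1) i =
      N * P (‖x‖ ^ 2) + 2 * ‖x‖ ^ 2 * deriv P (‖x‖ ^ 2) := by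
  have hn := (hasStrictFDerivAt_norm_sq x).hasFDerivAt
  have hP' := (hP (‖x‖ ^ 2)).hasDerivAt.comp_hasFDerivAt x hn
  have hQ' := (hQ (‖x‖ ^ 2)).hasDerivAt.comp_hasFDerivAt x hn
  have h : HasFDerivAt (fun x => P (‖x‖ ^ 2) • x + Q (‖x‖ ^ 2) • S x) _ x :=
    (hP'.smul (hasFDerivAt_id x)).add (hQ'.smul S.hasFDerivAt)
  rw [h.fderiv]
  have hSi : ∀ i, S (EuclideanSpace.single i 1) i = 0 := fun i => by
    have := hS (EuclideanSpace.single i 1)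
    rw [EuclideanSpace.inner_single_right] at this
    simpa using this
  have hSx : ∑ i, x i * S x i = 0 := by
    rw [← EuclideanSpace_real_inner_eq_sum, real_inner_comm, hS]
  have hxx : ∑ i, x i * x i = ‖x‖ ^ 2 := by
    rw [← EuclideanSpace_real_inner_eq_sum, real_inner_self_eq_norm_sq]
  have e : ∀ i : Fin N, inner ℝ x (EuclideanSpace.single i 1) = x i := fun i => by
    rw [EuclideanSpace.inner_single_right]; simp
  simp only [_root_.add_apply, _root_.smul_apply,
    ContinuousLinearMap.smulRight_apply, PiLp.add_apply, PiLp.smul_apply, smul_eq_mul, 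
    Function.comp_apply, innerSL_apply_apply, e, hSi, ContinuousLinearMap.id_apply, id,
    PiLp.single_apply]
  simp only [ite_true, mul_one, mul_zero, zero_add, nsmul_eq_mul, Nat.cast_ofNat]
  have : ∀ i, P (‖x‖ ^ 2) + deriv P (‖x‖ ^ 2) * (2 * x i) * x i +
      deriv Q (‖x‖ ^ 2) * (2 * x i) * S x i = P (‖x‖ ^ 2) + 2 * deriv P (‖x‖ ^ 2) * (x i * x i) +
      2 * deriv Q (‖x‖ ^ 2) * (x i * S x i) := fun i => by ring
  simp_rw [this, Finset.sum_add_distrib, ← Finset.mul_sum, hSx, hxx]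
  simp
  ring


theorem deriv_smoothTransition_eq_zero {t : ℝ} (ht : 1 < t) : deriv Real.smoothTransition t = 0 := by
  have : Real.smoothTransition =ᶠ[𝓝 t] fun _ => (1 : ℝ) := by
    filter_upwards [Ioi_mem_nhds ht] with s hs using Real.smoothTransition.one_of_one_le (le_of_lt hs)
  rw [this.deriv_eq, deriv_const]

theorem deriv_smoothTransition_eq_zero' {t : ℝ} (ht : t < 0) :
    deriv Real.smoothTransition t = 0 := by
  have : Real.smoothTransition =ᶠ[𝓝 t] fun _ => (0 : ℝ) := by
    filter_upwards [Iio_mem_nhds ht] with s hs using Real.smoothTransition.zero_of_nonpos (le_of_lt hs)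
  rw [this.deriv_eq, deriv_const]

/-- With τ = ct - 1, the expression is ct times the cutoff derivative at τ: the error created by
cutting off at scale 1/c is bounded uniformly in c. -/
theorem exists_abs_mul_deriv_smoothTransition_le :
    ∃ K : ℝ, 0 ≤ K ∧ ∀ t : ℝ, |(t + 1) * deriv Real.smoothTransition t| ≤ K := by
  have hc : Continuous (fun t => (t + 1) * deriv Real.smoothTransition t) :=
    (by fun_prop : Continuous fun t : ℝ => t + 1).mul
      ((Real.smoothTransition.contDiff (n := 1)).continuous_deriv le_rfl)
  obtain ⟨K, hK⟩ := (isCompact_Icc (a := (0 : ℝ)) (b := 1)).exists_bound_of_continuousOn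
    hc.continuousOn
  have hK0 : 0 ≤ K := (norm_nonneg _).trans (hK 0 (by simp))
  refine ⟨K, hK0, fun t => ?_⟩
  rcases lt_or_ge t 0 with h | h
  · simpa [deriv_smoothTransition_eq_zero' h] using hK0
  rcases lt_or_ge 1 t with h' | h'
  · simpa [deriv_smoothTransition_eq_zero h'] using hK0
  exact hK t ⟨h, h'⟩

theorem contDiff_cutoff_mul_rpow {c : ℝ} (hc : 0 < c) (A s : ℝ) :
    ContDiff ℝ ∞ (fun t : ℝ => Real.smoothTransition (c * t - 1) * (A * t ^ s)) := by
  refine contDiff_iff_contDiffAt.2 fun t => ?_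
  rcases lt_or_ge t c⁻¹ with h | h
  · refine (contDiffAt_const (c := (0 : ℝ))).congr_of_eventuallyEq ?_
    filter_upwards [Iio_mem_nhds h] with r hr
    rw [Real.smoothTransition.zero_of_nonpos, zero_mul]
    rw [mem_Iio, inv_eq_one_div, lt_div_iff₀ hc] at hr
    linarith
  · have ht : t ≠ 0 := ((inv_pos.2 hc).trans_le h).ne'
    exact (Real.smoothTransition.contDiff.contDiffAt.comp t (by fun_prop)).mul
      (contDiffAt_const.mul (Real.contDiffAt_rpow_const_of_ne ht))

theorem deriv_cutoff_mul_rpow (c A s : ℝ) {t : ℝ} (ht : t ≠ 0) :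
    2 * t * deriv (fun t : ℝ => Real.smoothTransition (c * t - 1) * (A * t ^ s)) t =
      2 * ((c * t - 1 + 1) * deriv Real.smoothTransition (c * t - 1)) * (A * t ^ s) +
        2 * s * Real.smoothTransition (c * t - 1) * (A * t ^ s) := by
  have h1 : HasDerivAt (fun t : ℝ => Real.smoothTransition (c * t - 1))
      (deriv Real.smoothTransition (c * t - 1) * (c * 1)) t :=
    HasDerivAt.comp t ((Real.smoothTransition.contDiff (n := 1)).differentiable
      (by simp) _).hasDerivAt (((hasDerivAt_id t).const_mul c).sub_const 1)
  rw [(h1.fun_mul ((Real.hasDerivAt_rpow_const (p := s) (Or.inl ht)).const_mul A)).deriv,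
    Real.rpow_sub_one ht]
  field_simp
  ring

/-- The divergence theorem for the vector field `A |x|^{2s} x + D |x|^{2r} S x`, with `S`
skew-symmetric, tested with a bounded function whose gradient vanishes near the origin. -/
theorem IsW0.integral_inner_radial (hN : 1 ≤ N) {S : Euc N →L[ℝ] Euc N}
    (hS : ∀ x, inner ℝ (S x) x = 0) {A D s r : ℝ} (hs : -(N : ℝ) < 2 * s) {q : ℝ≥0∞} (hq : 1 ≤ q)
    {w : Euc N → ℝ} {G : Euc N → Euc N} (h : IsW0 (Metric.ball (0 : Euc N) 1) q w G) {k ρ : ℝ}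
    (hwk : ∀ᵐ x ∂(volume.restrict (Metric.ball (0 : Euc N) 1)), |w x| ≤ k) (hρ : 0 < ρ)
    (hG : ∀ᵐ x ∂(volume.restrict (Metric.ball (0 : Euc N) 1)), ‖x‖ ^ 2 < ρ → G x = 0) :
    ∫ x in Metric.ball 0 1, inner ℝ ((A * (‖x‖ ^ 2) ^ s) • x + (D * (‖x‖ ^ 2) ^ r) • S x) (G x) =
      - ∫ x in Metric.ball 0 1, (N + 2 * s) * (A * (‖x‖ ^ 2) ^ s) * w x := by
  set B := Metric.ball (0 : Euc N) 1 with hB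
  -- The cutoff vanishes for t ≤ 1/(n+1), which makes the fields smooth across the origin.
  let P : ℕ → ℝ → ℝ := fun n t => Real.smoothTransition (((n : ℝ) + 1) * t - 1) * (A * t ^ s)
  let Q : ℕ → ℝ → ℝ := fun n t => Real.smoothTransition (((n : ℝ) + 1) * t - 1) * (D * t ^ r)
  have hP : ∀ n, ContDiff ℝ ∞ (P n) := fun n => contDiff_cutoff_mul_rpow (by positivity) A s
  have hQ : ∀ n, ContDiff ℝ ∞ (Q n) := fun n => contDiff_cutoff_mul_rpow (by positivity) D r
  let V : ℕ → Euc N → Euc N := fun n x => P n (‖x‖ ^ 2) • x + Q n (‖x‖ ^ 2) • S x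
  let d : ℕ → Euc N → ℝ := fun n x =>
    N * P n (‖x‖ ^ 2) + 2 * ‖x‖ ^ 2 * deriv (P n) (‖x‖ ^ 2)
  have hV : ∀ n, ContDiff ℝ 1 (V n) := fun n =>
    ((((hP n).of_le (by simp)).comp (contDiff_norm_sq ℝ)).smul contDiff_id).add
      ((((hQ n).of_le (by simp)).comp (contDiff_norm_sq ℝ)).smul S.contDiff)
  have hn2 : Continuous (fun x : Euc N => ‖x‖ ^ 2) := continuous_norm.pow 2
  have hd : ∀ n, Continuous (d n) := fun n =>
    (continuous_const.mul ((hP n).continuous.comp hn2)).add ((continuous_const.mul hn2).mul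
      (((hP n).continuous_deriv (by simp)).comp hn2))
  have hparts : ∀ n, ∫ x in B, inner ℝ (V n x) (G x) = - ∫ x in B, d n x * w x := by
    intro n
    obtain ⟨C₁, hC₁⟩ := (isCompact_closedBall (0 : Euc N) 1).exists_bound_of_continuousOn
      (hV n).continuous.continuousOn
    obtain ⟨C₂, hC₂⟩ := (isCompact_closedBall (0 : Euc N) 1).exists_bound_of_continuousOn
      (hd n).continuousOn
    refine h.integral_parts hq (C := max C₁ C₂) (hV n).continuous.aestronglyMeasurable
      (hd n).aestronglyMeasurable ?_ ?_ fun η hη => ?_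
    · filter_upwards [ae_restrict_mem measurableSet_ball] with x hx
      exact (hC₁ x (Metric.ball_subset_closedBall hx)).trans (le_max_left _ _)
    · filter_upwards [ae_restrict_mem measurableSet_ball] with x hx
      exact (hC₂ x (Metric.ball_subset_closedBall hx)).trans (le_max_right _ _)
    · rw [integral_inner_gradient hη (hV n)]
      simp only [V, d]
      simp_rw [sum_fderiv_radial hS ((hP n).differentiable (by simp))
        ((hQ n).differentiable (by simp))]
  obtain ⟨K, hK0, hK⟩ := exists_abs_mul_deriv_smoothTransition_le
  have hd' : ∀ n x, x ≠ 0 → d n x = ((N + 2 * s) *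
      Real.smoothTransition (((n : ℝ) + 1) * ‖x‖ ^ 2 - 1) + 2 * ((((n : ℝ) + 1) * ‖x‖ ^ 2 - 1 + 1) *
      deriv Real.smoothTransition (((n : ℝ) + 1) * ‖x‖ ^ 2 - 1))) * (A * (‖x‖ ^ 2) ^ s) := by
    intro n x hx
    simp only [d]
    rw [deriv_cutoff_mul_rpow _ _ _ (by simpa using hx)]
    simp only [P]
    ring
  have hlim1 : Tendsto (fun n => ∫ x in B, d n x * w x) atTop
      (𝓝 (∫ x in B, (N + 2 * s) * (A * (‖x‖ ^ 2) ^ s) * w x)) := by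
    -- The cut-off divergences are dominated by a multiple of |x|^{2s}, integrable because 2s > -N.
    have hint : Integrable (fun x : Euc N => ((N + 2 * s) + 2 * K) * |A| * k * ‖x‖ ^ (2 * s))
        (volume.restrict B) := by
      refine Integrable.const_mul ?_ _
      exact (integrableOn_norm_rpow_iff hN one_pos _).2 hs
    refine tendsto_integral_of_dominated_convergence _
      (fun n => (hd n).aestronglyMeasurable.mul h.memLp.1) hint (fun n => ?_) ?_
    · filter_upwards [hwk, ae_ne_zero_ball hN] with x hx hx0
      rw [hd' n x hx0, norm_mul, norm_mul, norm_mul, Real.norm_eq_abs A,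
        Real.norm_of_nonneg (by positivity : 0 ≤ (‖x‖ ^ 2) ^ s), norm_sq_rpow]
      have h1 := Real.smoothTransition.nonneg (((n : ℝ) + 1) * ‖x‖ ^ 2 - 1)
      have h2 := Real.smoothTransition.le_one (((n : ℝ) + 1) * ‖x‖ ^ 2 - 1)
      have hNs : 0 < (N : ℝ) + 2 * s := by linarith
      have h3 : ‖(N + 2 * s) *
          Real.smoothTransition (((n : ℝ) + 1) * ‖x‖ ^ 2 - 1) +
          2 * ((((n : ℝ) + 1) * ‖x‖ ^ 2 - 1 + 1) *
          deriv Real.smoothTransition (((n : ℝ) + 1) * ‖x‖ ^ 2 - 1))‖ ≤ (N + 2 * s) + 2 * K := by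
        refine (norm_add_le _ _).trans (add_le_add ?_ ?_)
        · rw [Real.norm_of_nonneg (by positivity)]
          exact mul_le_of_le_one_right hNs.le h2
        · rw [norm_mul, Real.norm_ofNat]
          exact mul_le_mul_of_nonneg_left (hK _) zero_le_two
      calc _ ≤ ((N + 2 * s) + 2 * K) * (|A| * ‖x‖ ^ (2 * s)) * k := by
            gcongr
            exact hx
        _ = _ := by ring
    · filter_upwards [ae_ne_zero_ball hN] with x hx0
      refine tendsto_const_nhds.congr' ?_
      have hx2 : 0 < ‖x‖ ^ 2 := by positivity
      obtain ⟨m, hm⟩ := exists_nat_gt (2 / ‖x‖ ^ 2)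
      filter_upwards [eventually_ge_atTop m] with n hn
      have hn' : (m : ℝ) ≤ n := by exact_mod_cast hn
      have : 1 < ((n : ℝ) + 1) * ‖x‖ ^ 2 - 1 := by
        rw [div_lt_iff₀ hx2] at hm
        nlinarith
      rw [hd' n x hx0, Real.smoothTransition.one_of_one_le this.le,
        deriv_smoothTransition_eq_zero this]
      ring
  have hlim2 : Tendsto (fun n => ∫ x in B, inner ℝ (V n x) (G x)) atTop (𝓝 (∫ x in B,
      inner ℝ ((A * (‖x‖ ^ 2) ^ s) • x + (D * (‖x‖ ^ 2) ^ r) • S x) (G x))) := by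
    -- Since G vanishes for |x|² < ρ, the left-hand integrals are eventually constant; no
    -- integrability of the rotational part is needed.
    refine tendsto_const_nhds.congr' ?_
    obtain ⟨m, hm⟩ := exists_nat_gt (2 / ρ)
    filter_upwards [eventually_ge_atTop m] with n hn
    have hn' : (m : ℝ) ≤ n := by exact_mod_cast hn
    refine integral_congr_ae ?_
    filter_upwards [hG] with x hx
    rcases lt_or_ge (‖x‖ ^ 2) ρ with h1 | h1
    · rw [hx h1, inner_zero_right, inner_zero_right]
    · have : 1 ≤ ((n : ℝ) + 1) * ‖x‖ ^ 2 - 1 := by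
        rw [div_lt_iff₀ hρ] at hm
        nlinarith
      simp only [V, P, Q]
      rw [Real.smoothTransition.one_of_one_le this, one_mul, one_mul]
  simp_rw [hparts] at hlim2
  exact tendsto_nhds_unique hlim2 hlim1.neg


/-! ### The radial function as an entropy solution. -/

theorem one_add_abs_norm_rpow_sub_one {α : ℝ} (hα : α < 0) {x : Euc N} (hx0 : x ≠ 0)
    (hx : x ∈ Metric.ball (0 : Euc N) 1) : 0 ≤ ‖x‖ ^ α - 1 ∧ 1 + |‖x‖ ^ α - 1| = ‖x‖ ^ α := by
  have h1 : 1 ≤ ‖x‖ ^ α :=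
    Real.one_le_rpow_of_pos_of_le_one_of_nonpos (norm_pos_iff.2 hx0) (mem_ball_zero_iff.1 hx).le
      hα.le
  refine ⟨by linarith, ?_⟩
  rw [abs_of_nonneg (by linarith)]
  ring

theorem perturbedOperator_radial {α : ℝ} (hα : α < 0) (θ : ℝ) (S : Euc N →L[ℝ] Euc N) {x : Euc N}
    (hx0 : x ≠ 0) (hx : x ∈ Metric.ball (0 : Euc N) 1) :
    perturbedOperator θ S x (‖x‖ ^ α - 1) ((α * ‖x‖ ^ (α - 2)) • x) =
      (α * (‖x‖ ^ 2) ^ ((α * (1 - θ) - 2) / 2)) • x +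
        (α * (‖x‖ ^ 2) ^ ((α - 2) / 2)) • S x := by
  have h0 : 0 < ‖x‖ := norm_pos_iff.2 hx0
  rw [perturbedOperator, (one_add_abs_norm_rpow_sub_one hα hx0 hx).2, map_smul, smul_smul,
    norm_sq_rpow, norm_sq_rpow, ← Real.rpow_mul h0.le, ← Real.rpow_neg h0.le]
  congr 2
  · rw [mul_left_comm, ← Real.rpow_add h0]
    congr 2
    ring
  · congr 2
    ring

/-- The relation on α is the balance of powers: -αγ₂ - (N-ε), from h(u) f, equals α(1-θ) - 2, from
the divergence of the flux. -/
theorem rhs_radial {α : ℝ} {γ₂ C ε θ : ℝ} (hC : 0 ≤ C)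
    (h : α * (1 - θ + γ₂) = 2 + ε - N) {x : Euc N} (hx0 : x ≠ 0) :
    (rhs (modelSource γ₂) (radialDatum N C ε) (fun x => ‖x‖ ^ α - 1) x).toReal =
      C * (‖x‖ ^ 2) ^ ((α * (1 - θ) - 2) / 2) := by
  have h0 : 0 < ‖x‖ := norm_pos_iff.2 hx0
  have e : 1 + (‖x‖ ^ α - 1) = ‖x‖ ^ α := by ring
  rw [rhs, modelSource, radialDatum, e, ← ENNReal.ofReal_mul (by positivity),
    ENNReal.toReal_ofReal (by positivity), ← Real.rpow_mul h0.le, ← Real.rpow_neg h0.le,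
    norm_sq_rpow, div_eq_mul_inv, ← Real.rpow_neg h0.le, mul_left_comm, ← Real.rpow_add h0]
  congr 2
  linarith

theorem rhs_model_ne_top (γ₂ : ℝ) (f u : Euc N → ℝ) (x : Euc N) :
    rhs (modelSource γ₂) f u x ≠ ⊤ :=
  ENNReal.mul_ne_top ENNReal.ofReal_ne_top ENNReal.ofReal_ne_top

theorem aemeasurable_norm_rpow_sub_one (α : ℝ) (μ : Measure (Euc N)) :
    AEMeasurable (fun x : Euc N => ‖x‖ ^ α - 1) μ :=
  ((measurable_norm.pow_const α).sub_const 1).aemeasurable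

theorem genGrad_norm_rpow_sub_one (hN : 1 ≤ N) {α : ℝ} (hα : α < 0) :
    genGrad (Metric.ball (0 : Euc N) 1) (fun x => ‖x‖ ^ α - 1)
      =ᵐ[volume.restrict (Metric.ball (0 : Euc N) 1)] fun x => (α * ‖x‖ ^ (α - 2)) • x := by
  have hT := isTruncW0_norm_rpow_sub_one hN hα le_rfl ENNReal.one_ne_top
  exact (isTruncW0_genGrad Metric.isOpen_ball le_rfl ENNReal.one_ne_top
    fun k hk => ⟨_, hT.isW0 k hk⟩).ae_eq Metric.isOpen_ball le_rfl le_rfl hT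

theorem flux_norm_rpow_sub_one (hN : 1 ≤ N) {α : ℝ} (hα : α < 0) (θ : ℝ) (S : Euc N →L[ℝ] Euc N) :
    ∀ᵐ x ∂(volume.restrict (Metric.ball (0 : Euc N) 1)), perturbedOperator θ S x (‖x‖ ^ α - 1)
      (genGrad (Metric.ball (0 : Euc N) 1) (fun x => ‖x‖ ^ α - 1) x) =
      (α * (‖x‖ ^ 2) ^ ((α * (1 - θ) - 2) / 2)) • x +
        (α * (‖x‖ ^ 2) ^ ((α - 2) / 2)) • S x := by
  filter_upwards [genGrad_norm_rpow_sub_one hN hα, ae_ne_zero_ball hN,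
    ae_restrict_mem measurableSet_ball] with x hx hx0 hxB
  rw [hx, perturbedOperator_radial hα θ S hx0 hxB]

theorem aestronglyMeasurable_perturbedOperator (θ : ℝ) (S : Euc N →L[ℝ] Euc N)
    {μ : Measure (Euc N)} {w : Euc N → ℝ} {G : Euc N → Euc N} (hw : AEStronglyMeasurable w μ)
    (hG : AEStronglyMeasurable G μ) :
    AEStronglyMeasurable (fun x => perturbedOperator θ S x (w x) (G x)) μ := by
  simp only [perturbedOperator]
  exact (((continuous_one_add_abs_rpow_inv θ).comp_aestronglyMeasurable hw).smul hG).add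
    (S.continuous.comp_aestronglyMeasurable hG)

/-- As φ is bounded and u blows up at the origin, u - φ > k near it. Hence u may be replaced by
T_M(u) with M above k + sup |φ|, and the gradient of the truncation vanishes near the origin. -/
theorem exists_isW0_trunc_norm_rpow_sub (hN : 1 ≤ N) {α k : ℝ} (hα : α < 0) {φ : Euc N → ℝ}
    (hk : 0 < k) (hφ : MemW0 (Metric.ball (0 : Euc N) 1) 2 φ)
    (hφ' : MemLp φ ⊤ (volume.restrict (Metric.ball (0 : Euc N) 1))) :
    ∃ G : Euc N → Euc N, ∃ ρ > 0, IsW0 (Metric.ball (0 : Euc N) 1) (ENNReal.ofReal 2)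
        (fun x => trunc k (‖x‖ ^ α - 1 - φ x)) G ∧
      ∀ᵐ x ∂(volume.restrict (Metric.ball (0 : Euc N) 1)), ‖x‖ ^ 2 < ρ → G x = 0 := by
  have h2 : (1 : ℝ≥0∞) ≤ ENNReal.ofReal 2 := by simp
  have h2' : ENNReal.ofReal 2 ≠ ⊤ := ENNReal.ofReal_ne_top
  have hT := isTruncW0_norm_rpow_sub_one hN hα h2 h2'
  obtain ⟨Gφ, hGφ⟩ := (memW0_iff one_le_two).1 hφ
  obtain ⟨L, hL⟩ : ∃ L : ℝ, ∀ᵐ x ∂(volume.restrict (Metric.ball (0 : Euc N) 1)), |φ x| ≤ L :=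
    ⟨_, by
      have := ae_le_eLpNormEssSup (f := φ) (μ := volume.restrict (Metric.ball (0 : Euc N) 1))
      filter_upwards [this] with x hx
      have h3 : eLpNormEssSup φ (volume.restrict (Metric.ball (0 : Euc N) 1)) ≠ ⊤ := by
        rw [← eLpNorm_exponent_top]; exact hφ'.2.ne
      have := ENNReal.toReal_mono h3 hx
      rwa [toReal_enorm, Real.norm_eq_abs] at this⟩
  obtain ⟨M, hM⟩ : ∃ M, M = k + max L 0 + 1 := ⟨_, rfl⟩
  have hL0 := le_max_right L 0
  have hM0 : 0 < M := by linarith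
  have hw := ((hT.isW0 M hM0).sub hGφ h2).trunc h2 h2' hk.le
  refine ⟨_, (M + 1) ^ (2 / α), Real.rpow_pos_of_pos (by linarith) _, hw.congr ?_
    EventuallyEq.rfl, ?_⟩
  · filter_upwards [hL, ae_ne_zero_ball hN, ae_restrict_mem measurableSet_ball]
      with x hx hx0 hxB
    have h0 := (one_add_abs_norm_rpow_sub_one hα hx0 hxB).1
    rcases le_total (‖x‖ ^ α - 1) M with h1 | h1
    · have e : trunc M (‖x‖ ^ α - 1) = ‖x‖ ^ α - 1 :=
        trunc_of_abs_le (by rwa [abs_of_nonneg h0])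
      rw [e]
    · have hx1 := (abs_le.1 hx).2.trans (le_max_left L 0)
      rw [trunc_of_le hM0.le h1, trunc_of_le hk.le (by linarith),
        trunc_of_le hk.le (by linarith)]
  · filter_upwards [hL, ae_ne_zero_ball hN] with x hx hx0 hxρ
    refine indicator_of_notMem (fun hmem => ?_) _
    have h1 := Real.rpow_lt_rpow_of_neg (by positivity) hxρ (by linarith : α / 2 < 0)
    rw [← Real.rpow_mul (by linarith), show 2 / α * (α / 2) = 1 by
      field_simp [hα.ne], Real.rpow_one, norm_sq_rpow, mul_div_cancel₀ _ two_ne_zero] at h1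
    have hmem' : |trunc M (‖x‖ ^ α - 1) - φ x| ≤ k := hmem
    rw [trunc_of_le hM0.le (by linarith)] at hmem'
    have hx1 := (abs_le.1 hx).2.trans (le_max_left L 0)
    linarith [(abs_le.1 hmem').2]

/-- The entropy inequality holds with equality, and S plays no role in it because its contribution
to the flux is divergence free. -/
theorem isEntropySolution_norm_rpow_sub_one (hN : 1 ≤ N) {α θ γ₂ ε : ℝ} (hα : α < 0) (hθ : 0 ≤ θ)
    (hγ : 0 ≤ γ₂) (hε : 0 < ε) (h : α * (1 - θ + γ₂) = 2 + ε - N) {S : Euc N →L[ℝ] Euc N}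
    (hS : ∀ x, inner ℝ (S x) x = 0) :
    IsEntropySolution (Metric.ball (0 : Euc N) 1) 2 (perturbedOperator θ S) (modelSource γ₂)
      (radialDatum N (-α * (ε - α * γ₂)) ε) (fun x => ‖x‖ ^ α - 1) := by
  have h2 : (1 : ℝ≥0∞) ≤ ENNReal.ofReal 2 := by simp
  have h2' : ENNReal.ofReal 2 ≠ ⊤ := ENNReal.ofReal_ne_top
  have hT := isTruncW0_norm_rpow_sub_one hN hα h2 h2'
  -- The radial flux is α|x|^{2s} x, with divergence α(N+2s)|x|^{2s}; the constant of the datum is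
  -- -α(N+2s), and N + 2s = ε - αγ₂ > 0.
  obtain ⟨s, hs⟩ : ∃ s, s = (α * (1 - θ) - 2) / 2 := ⟨_, rfl⟩
  have hNs : (N : ℝ) + 2 * s = ε - α * γ₂ := by rw [hs]; linarith
  have hpos : 0 < ε - α * γ₂ := by nlinarith
  have hC : 0 < -α * (ε - α * γ₂) := mul_pos (by linarith) hpos
  have hrhs : ∀ᵐ x ∂(volume.restrict (Metric.ball (0 : Euc N) 1)),
      (rhs (modelSource γ₂) (radialDatum N (-α * (ε - α * γ₂)) ε) (fun x => ‖x‖ ^ α - 1) x).toReal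
        = -α * (ε - α * γ₂) * (‖x‖ ^ 2) ^ s := by
    filter_upwards [ae_ne_zero_ball hN] with x hx0
    rw [rhs_radial hC.le h hx0, hs]
  have hweak : ∀ {w : Euc N → ℝ} {G}, IsW0 (Metric.ball (0 : Euc N) 1) (ENNReal.ofReal 2) w G →
      weakGrad (Metric.ball (0 : Euc N) 1) w =ᵐ[volume.restrict (Metric.ball (0 : Euc N) 1)] G :=
    fun hw => (hw.hasWeakGrad h2).weakGrad_ae_eq Metric.isOpen_ball EventuallyEq.rfl
  refine ⟨aemeasurable_norm_rpow_sub_one α _, ?_, fun k hk => ?_, fun k hk => ?_,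
    fun k φ hk hφ hφ' => ⟨Eventually.of_forall fun x hx => absurd hx (rhs_model_ne_top _ _ _ _), ?_⟩,
    fun k φ hk hφ hφ' => ?_⟩
  · filter_upwards [ae_ne_zero_ball hN, ae_restrict_mem measurableSet_ball] with x hx0 hxB
      using (one_add_abs_norm_rpow_sub_one hα hx0 hxB).1
  · exact (memW0_iff one_le_two).2 ⟨_, hT.isW0 k hk⟩
  · have hk' := hT.isW0 k hk
    have hm := hk'.memLp_grad.ae_eq (hweak hk').symm
    rw [show (2 : ℝ) / (2 - 1) = 2 by norm_num]
    refine hm.of_le_mul (c := 1 + ‖S‖) ?_ (Eventually.of_forall fun x =>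
      norm_perturbedOperator_le hθ S x _ _)
    exact aestronglyMeasurable_perturbedOperator θ S hk'.memLp.1 hm.1
  · obtain ⟨G, ρ, -, hG, -⟩ := exists_isW0_trunc_norm_rpow_sub hN hα hk hφ hφ'
    have hint : Integrable (fun x : Euc N => -α * (ε - α * γ₂) * k * ‖x‖ ^ (2 * s))
        (volume.restrict (Metric.ball (0 : Euc N) 1)) :=
      Integrable.const_mul ((integrableOn_norm_rpow_iff hN one_pos _).2 (by linarith)) _
    refine (Integrable.mono' hint (f := fun x => -α * (ε - α * γ₂) * (‖x‖ ^ 2) ^ s *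
      trunc k (‖x‖ ^ α - 1 - φ x)) ?_ (Eventually.of_forall fun x => ?_)).congr ?_
    · exact (((measurable_norm.pow_const 2).pow_const s).const_mul
        (-α * (ε - α * γ₂))).aestronglyMeasurable.mul hG.memLp.1
    · rw [norm_mul, Real.norm_of_nonneg (by positivity), norm_sq_rpow, mul_right_comm]
      gcongr
      exact abs_trunc_le hk.le _
    · filter_upwards [hrhs] with x hx
      rw [hx]
  · obtain ⟨G, ρ, hρ, hG, hG0⟩ := exists_isW0_trunc_norm_rpow_sub hN hα hk hφ hφ'
    have key := hG.integral_inner_radial hN hS (A := α) (D := α) (s := s) (r := (α - 2) / 2)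
      (by linarith) h2 (Eventually.of_forall fun x => abs_trunc_le hk.le _) hρ hG0
    refine le_of_eq (Eq.trans ?_ (key.trans ?_))
    · refine integral_congr_ae ?_
      filter_upwards [hweak hG, flux_norm_rpow_sub_one hN hα θ S] with x hx hx'
      rw [hx, hx', hs]
    · rw [← integral_neg]
      refine integral_congr_ae ?_
      filter_upwards [hrhs] with x hx
      rw [hx, hNs]
      ring


/-! ### Sobolev regularity of the example and optimality of the threshold. -/

theorem norm_rpow_smul_self {x : Euc N} (hx : x ≠ 0) (α : ℝ) :
    ‖(α * ‖x‖ ^ (α - 2)) • x‖ = |α| * ‖x‖ ^ (α - 1) := by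
  rw [norm_smul, norm_mul, Real.norm_eq_abs, Real.norm_of_nonneg (by positivity), mul_assoc,
    ← Real.rpow_add_one (norm_ne_zero_iff.2 hx)]
  congr 2
  ring

/-- A weak gradient of u must coincide with the generalized one, of size |x|^{α-1} up to a factor.
Conversely, if this is integrable, the truncations converge to u by domination. -/
theorem memW0_one_norm_rpow_sub_one_iff (hN : 1 ≤ N) {α : ℝ} (hα : α < 0) :
    MemW0 (Metric.ball (0 : Euc N) 1) 1 (fun x => ‖x‖ ^ α - 1) ↔ -(N : ℝ) < α - 1 := by
  have hT := isTruncW0_norm_rpow_sub_one hN hα le_rfl ENNReal.one_ne_top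
  rw [memW0_iff le_rfl, ENNReal.ofReal_one]
  refine ⟨fun ⟨G, hG⟩ => ?_, fun h => ⟨fun x => (α * ‖x‖ ^ (α - 2)) • x, ?_⟩⟩
  · have hG' : IsTruncW0 (Metric.ball (0 : Euc N) 1) 1 (fun x => ‖x‖ ^ α - 1) G :=
      ⟨hG.memLp_grad.1, fun k hk => hG.trunc le_rfl ENNReal.one_ne_top hk.le⟩
    have he := hT.ae_eq Metric.isOpen_ball le_rfl le_rfl hG'
    rw [← integrableOn_norm_rpow_iff hN one_pos]
    have := ((memLp_one_iff_integrable.1 hG.memLp_grad).norm.const_mul |α|⁻¹)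
    refine this.congr ?_
    filter_upwards [he, ae_ne_zero_ball hN] with x hx hx0
    rw [← hx, norm_rpow_smul_self hx0, inv_mul_cancel_left₀ (abs_ne_zero.2 hα.ne)]
  · have i1 := (integrableOn_norm_rpow_iff hN one_pos α).2 (by linarith)
    have i2 := (integrableOn_norm_rpow_iff hN one_pos (α - 1)).2 h
    refine IsW0.of_dominated le_rfl ENNReal.one_ne_top
      (fun n : ℕ => hT.isW0 ((n : ℝ) + 1) (by positivity))
      (memLp_one_iff_integrable.2 (i1.add (integrable_const (1 : ℝ))))
      (memLp_one_iff_integrable.2 (i2.const_mul |α|)) (fun n => ?_) (fun n => ?_) ?_ ?_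
    · filter_upwards with x
      refine (abs_trunc_le_abs (by positivity) _).trans ((abs_sub _ _).trans ?_)
      rw [abs_one, abs_of_nonneg (by positivity)]
      rfl
    · filter_upwards [ae_ne_zero_ball hN] with x hx0
      rw [← norm_rpow_smul_self hx0]
      exact norm_indicator_le_norm_self _ _
    · filter_upwards with x
      refine tendsto_const_nhds.congr' ?_
      filter_upwards [eventually_ge_atTop ⌈|‖x‖ ^ α - 1|⌉₊] with n hn
      exact (trunc_of_abs_le ((Nat.ceil_le.1 hn).trans (by linarith))).symm
    · filter_upwards with x
      refine tendsto_const_nhds.congr' ?_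
      filter_upwards [eventually_ge_atTop ⌈|‖x‖ ^ α - 1|⌉₊] with n hn
      have hmem : x ∈ {x : Euc N | |‖x‖ ^ α - 1| ≤ (n : ℝ) + 1} :=
        (Nat.ceil_le.1 hn).trans (by linarith)
      rw [indicator_of_mem hmem]

/-- The skew-symmetric map `x ↦ ⟨e', x⟩ e - ⟨e, x⟩ e'`. -/
def skewMap (e e' : Euc N) : Euc N →L[ℝ] Euc N :=
  (innerSL ℝ e').smulRight e - (innerSL ℝ e).smulRight e'

theorem skewMap_apply (e e' x : Euc N) :
    skewMap e e' x = (inner ℝ e' x : ℝ) • e - (inner ℝ e x : ℝ) • e' := rfl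

theorem inner_skewMap_self (e e' x : Euc N) : inner ℝ (skewMap e e' x) x = 0 := by
  rw [skewMap_apply, inner_sub_left, real_inner_smul_left, real_inner_smul_left, mul_comm, sub_self]

/-- If all skew perturbations had a locally integrable flux, subtracting the case S = 0 would make
every S∇u integrable near the origin. Elementary rotations recover each component of ∇u, so
|x|^{α-1} would be integrable. -/
theorem exists_skew_not_locallyIntegrableOn (hN : 2 ≤ N) {α θ : ℝ} (hα : α < 0)
    (hαN : α - 1 ≤ -(N : ℝ)) : ∃ S : Euc N →L[ℝ] Euc N, (∀ x, inner ℝ (S x) x = 0) ∧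
      ¬ LocallyIntegrableOn (fun x => perturbedOperator θ S x (‖x‖ ^ α - 1)
        (genGrad (Metric.ball (0 : Euc N) 1) (fun x => ‖x‖ ^ α - 1) x)) (Metric.ball 0 1) := by
  by_contra! hcon
  have hN1 : 1 ≤ N := by omega
  have hsub : Metric.closedBall (0 : Euc N) (1 / 2) ⊆ Metric.ball 0 1 :=
    Metric.closedBall_subset_ball (by norm_num)
  have hK : ∀ S : Euc N →L[ℝ] Euc N, (∀ x, inner ℝ (S x) x = 0) →
      IntegrableOn (fun x => (α * ‖x‖ ^ (α - 2)) • S x) (Metric.closedBall (0 : Euc N) (1 / 2)) := by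
    intro S hS
    have h1 := (hcon S hS).integrableOn_compact_subset hsub (isCompact_closedBall _ _)
    have h0 := (hcon 0 fun x => inner_zero_left _).integrableOn_compact_subset hsub
      (isCompact_closedBall _ _)
    refine (h1.sub h0).congr ?_
    refine ae_restrict_of_ae_restrict_of_subset hsub ?_
    filter_upwards [flux_norm_rpow_sub_one hN1 hα θ S, flux_norm_rpow_sub_one hN1 hα θ 0]
      with x hx hx'
    simp only [Pi.sub_apply]
    rw [hx, hx', zero_apply, smul_zero, add_zero, add_sub_cancel_left, norm_sq_rpow,
      mul_div_cancel₀ _ two_ne_zero]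
  have hcoord : ∀ i : Fin N, IntegrableOn (fun x : Euc N => α * ‖x‖ ^ (α - 2) * x i)
      (Metric.closedBall (0 : Euc N) (1 / 2)) := by
    intro i
    have : Nontrivial (Fin N) := Fin.nontrivial_iff_two_le.2 hN
    obtain ⟨j, hj⟩ := exists_ne i
    -- This map sends x to x_i e_j - x_j e_i, whose j-th coordinate is x_i.
    have h1 := hK (skewMap (EuclideanSpace.single j 1) (EuclideanSpace.single i 1))
      (inner_skewMap_self _ _)
    refine ((EuclideanSpace.proj (𝕜 := ℝ) j).integrable_comp h1).congr
      (Eventually.of_forall fun x => ?_)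
    simp [skewMap_apply, EuclideanSpace.inner_single_left, hj]
  have hvec : IntegrableOn (fun x : Euc N => (α * ‖x‖ ^ (α - 2)) • x)
      (Metric.closedBall (0 : Euc N) (1 / 2)) := by
    have := integrable_finsetSum Finset.univ fun i _ =>
      (hcoord i).smul_const (EuclideanSpace.single i (1 : ℝ))
    refine this.congr (Eventually.of_forall fun x => ?_)
    ext k
    simp [Finset.sum_apply, Pi.single_apply]
  have hfin := ((hvec.mono_set Metric.ball_subset_closedBall).norm.const_mul |α|⁻¹)
  have : IntegrableOn (fun x : Euc N => ‖x‖ ^ (α - 1)) (Metric.ball 0 (1 / 2)) := by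
    refine hfin.congr ?_
    refine ae_restrict_of_ae_restrict_of_subset (Metric.ball_subset_closedBall.trans hsub) ?_
    filter_upwards [ae_ne_zero_ball hN1] with x hx0
    rw [norm_rpow_smul_self hx0, inv_mul_cancel_left₀ (abs_ne_zero.2 hα.ne)]
  rw [integrableOn_norm_rpow_iff hN1 (by norm_num)] at this
  linarith

theorem radial_example (hN : 3 ≤ N) {θ γ₂ ε : ℝ} (hγ : 0 ≤ γ₂) (hθ : 0 ≤ θ) (hθ1 : θ < 1 + γ₂)
    (hε : 0 < ε) (hεN : ε < (N : ℝ) - 2) :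
    IsAdmissibleOperator (Metric.ball (0 : Euc N) 1) 2 θ (modelOperator N θ) ∧
      IsStrictlyMonotone (Metric.ball (0 : Euc N) 1) (modelOperator N θ) ∧
      IsAdmissibleSource γ₂ (modelSource γ₂) ∧
      (∃ C : ℝ, 0 < C ∧
        IsEntropySolution (Metric.ball (0 : Euc N) 1) 2 (modelOperator N θ) (modelSource γ₂)
          (radialDatum N C ε) (radialSolution N θ γ₂ ε) ∧
        ∀ m : ℝ, 1 ≤ m →
          (MemLp (radialDatum N C ε) (ENNReal.ofReal m)
              (volume.restrict (Metric.ball (0 : Euc N) 1)) ↔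
            m < (N : ℝ) / ((N : ℝ) - ε))) ∧
      (MemW0 (Metric.ball (0 : Euc N) 1) 1 (radialSolution N θ γ₂ ε) ↔
        θ < (1 + ε) / ((N : ℝ) - 1) + γ₂) := by
  have hN1 : 1 ≤ N := by omega
  have hS : ∀ x : Euc N, inner ℝ ((0 : Euc N →L[ℝ] Euc N) x) x = 0 := fun x => inner_zero_left _
  have hd : 0 < 1 - θ + γ₂ := by linarith
  obtain ⟨α, hα⟩ : ∃ α, α = (2 + ε - (N : ℝ)) / (1 - θ + γ₂) := ⟨_, rfl⟩
  have hα0 : α < 0 := by rw [hα]; exact div_neg_of_neg_of_pos (by linarith) hd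
  have hrel : α * (1 - θ + γ₂) = 2 + ε - N := by rw [hα, div_mul_cancel₀ _ hd.ne']
  have hu : radialSolution N θ γ₂ ε = fun x => ‖x‖ ^ α - 1 := by
    funext x; rw [radialSolution, hα]
  have hC : 0 < -α * (ε - α * γ₂) := mul_pos (by linarith) (by nlinarith)
  rw [← perturbedOperator_zero, hu]
  refine ⟨isAdmissibleOperator_perturbed _ hθ hS, isStrictlyMonotone_perturbed _ θ hS,
    isAdmissibleSource_model hγ, ⟨-α * (ε - α * γ₂), hC,
      isEntropySolution_norm_rpow_sub_one hN1 hα0 hθ hγ hε hrel hS,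
      fun m hm => memLp_radialDatum_iff hN1 hC (by linarith) (by linarith)⟩, ?_⟩
  have hN1' : (0 : ℝ) < N - 1 := by
    have : (3 : ℝ) ≤ N := by exact_mod_cast hN
    linarith
  rw [memW0_one_norm_rpow_sub_one_iff hN1 hα0, ← sub_lt_iff_lt_add, lt_div_iff₀ hN1']
  constructor <;> intro h <;> nlinarith

/-- The solution fails to be distributional only through the local integrability of its flux. The
skew term is what destroys it, while every property required of the operator and of the entropy
solution is insensitive to that term. -/
theorem exists_entropy_not_distributional (hN : 3 ≤ N) {θ γ₂ m : ℝ} (hγ : 0 ≤ γ₂)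
    (hθ : criticalTheta N 2 γ₂ < θ) (hθ1 : θ < 1 + γ₂) (hm : 1 ≤ m)
    (hm' : m < threshold N 2 θ γ₂) :
    ∃ (a : Euc N → ℝ → Euc N → Euc N) (h : ℝ → ℝ≥0∞) (f u : Euc N → ℝ),
      IsAdmissibleOperator (Metric.ball (0 : Euc N) 1) 2 θ a ∧
      IsStrictlyMonotone (Metric.ball (0 : Euc N) 1) a ∧
      IsAdmissibleSource γ₂ h ∧
      (∀ᵐ x ∂(volume.restrict (Metric.ball (0 : Euc N) 1)), 0 ≤ f x) ∧
      MemLp f (ENNReal.ofReal m) (volume.restrict (Metric.ball (0 : Euc N) 1)) ∧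
      IsEntropySolution (Metric.ball (0 : Euc N) 1) 2 a h f u ∧
      ¬ IsDistributionalSolution (Metric.ball (0 : Euc N) 1) a h f u := by
  have hN1 : 1 ≤ N := by omega
  have hN3 : (3 : ℝ) ≤ N := by exact_mod_cast hN
  have hN1' : (0 : ℝ) < N - 1 := by linarith
  -- This ε makes α = -(N-1), so |∇u| behaves like |x|^{-N}, the borderline of non-integrability.
  -- Moreover ε = (θ-θ_*)(N-1), hence N/(N-ε) = m_*, and ε < N-2 is equivalent to θ < 1 + γ₂.
  obtain ⟨ε, hε⟩ : ∃ ε, ε = ((N : ℝ) - 1) * (θ - γ₂) - 1 := ⟨_, rfl⟩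
  have hcrit : criticalTheta N 2 γ₂ = 1 / ((N : ℝ) - 1) + γ₂ := by
    rw [criticalTheta]
    norm_num
    ring
  have hεθ : (θ - criticalTheta N 2 γ₂) * (N - 2 + 1) = ε := by
    rw [hcrit, hε]
    field_simp
    ring
  have hε0 : 0 < ε := by
    rw [← hεθ]
    exact mul_pos (by linarith) (by linarith)
  have hεN : ε < (N : ℝ) - 2 := by
    rw [hε]; nlinarith
  have hθ0 : 0 ≤ θ := by
    have : 0 < 1 / ((N : ℝ) - 1) := by positivity
    linarith
  have hα0 : -((N : ℝ) - 1) < 0 := by linarith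
  have hrel : -((N : ℝ) - 1) * (1 - θ + γ₂) = 2 + ε - N := by rw [hε]; ring
  have hC : 0 < -(-((N : ℝ) - 1)) * (ε - -((N : ℝ) - 1) * γ₂) :=
    mul_pos (by linarith) (by nlinarith)
  have hmε : m < (N : ℝ) / (N - ε) := by
    rw [threshold_eq one_lt_two (by linarith), hεθ, lt_max_iff] at hm'
    rcases hm' with h | h
    · rwa [one_sub_div (by linarith), one_div, inv_div] at h
    · linarith
  obtain ⟨S, hS, hS'⟩ := exists_skew_not_locallyIntegrableOn (θ := θ) (by omega : 2 ≤ N) hα0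
    (by linarith)
  refine ⟨perturbedOperator θ S, modelSource γ₂, radialDatum N _ ε,
    fun x => ‖x‖ ^ (-((N : ℝ) - 1)) - 1, isAdmissibleOperator_perturbed _ hθ0 hS,
    isStrictlyMonotone_perturbed _ θ hS, isAdmissibleSource_model hγ,
    Eventually.of_forall fun x => ?_,
    (memLp_radialDatum_iff hN1 hC (by linarith) (by linarith)).2 hmε,
    isEntropySolution_norm_rpow_sub_one hN1 hα0 hθ0 hγ hε0 hrel hS,
    fun h => hS' h.flux_locallyIntegrable⟩
  rw [radialDatum]
  exact div_nonneg hC.le (by positivity)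

end EntropyDistributional

end

open EntropyDistributional in
theorem lemma7p3 :
    -- Every entropy solution is a distributional solution.
    (∀ (N : ℕ) (Ω : Set (Euc N)) (p θ γ₂ m : ℝ) (a : Euc N → ℝ → Euc N → Euc N)
        (h : ℝ → ℝ≥0∞) (f u : Euc N → ℝ),
      2 ≤ N → IsOpen Ω → Bornology.IsBounded Ω → 1 < p → p < N →
      0 ≤ γ₂ → 0 ≤ θ → θ ≤ 1 + γ₂ / (p - 1) →
      IsAdmissibleOperator Ω p θ a → IsAdmissibleSource γ₂ h →
      (∀ᵐ x ∂(volume.restrict Ω), 0 ≤ f x) →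
      MemLp f (ENNReal.ofReal m) (volume.restrict Ω) →
      (θ ≠ criticalTheta N p γ₂ → threshold N p θ γ₂ ≤ m) →
      (θ = criticalTheta N p γ₂ → 1 < m) →
      IsEntropySolution Ω p a h f u → IsDistributionalSolution Ω a h f u) ∧
    -- The threshold equals `1` exactly up to the critical value of `θ`.
    (∀ (N : ℕ) (p θ γ₂ : ℝ), 2 ≤ N → 1 < p → p < N → 0 ≤ γ₂ → 0 ≤ θ → θ ≤ 1 + γ₂ / (p - 1) →
      (threshold N p θ γ₂ = 1 ↔ θ ≤ criticalTheta N p γ₂)) ∧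
    -- The radial example in the unit ball, with `p = 2`.
    (∀ (N : ℕ) (θ γ₂ ε : ℝ), 3 ≤ N → 0 ≤ γ₂ → 0 ≤ θ → θ < 1 + γ₂ → 0 < ε → ε < (N : ℝ) - 2 →
      IsAdmissibleOperator (Metric.ball (0 : Euc N) 1) 2 θ (modelOperator N θ) ∧
      IsStrictlyMonotone (Metric.ball (0 : Euc N) 1) (modelOperator N θ) ∧
      IsAdmissibleSource γ₂ (modelSource γ₂) ∧
      (∃ C : ℝ, 0 < C ∧
        IsEntropySolution (Metric.ball (0 : Euc N) 1) 2 (modelOperator N θ) (modelSource γ₂)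
          (radialDatum N C ε) (radialSolution N θ γ₂ ε) ∧
        ∀ m : ℝ, 1 ≤ m →
          (MemLp (radialDatum N C ε) (ENNReal.ofReal m)
              (volume.restrict (Metric.ball (0 : Euc N) 1)) ↔
            m < (N : ℝ) / ((N : ℝ) - ε))) ∧
      (MemW0 (Metric.ball (0 : Euc N) 1) 1 (radialSolution N θ γ₂ ε) ↔
        θ < (1 + ε) / ((N : ℝ) - 1) + γ₂)) ∧
    -- Optimality: below the threshold an entropy solution need not be a distributional one.
    (∀ (N : ℕ) (θ γ₂ m : ℝ), 3 ≤ N → 0 ≤ γ₂ → criticalTheta N 2 γ₂ < θ → θ < 1 + γ₂ →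
      1 ≤ m → m < threshold N 2 θ γ₂ →
      ∃ (a : Euc N → ℝ → Euc N → Euc N) (h : ℝ → ℝ≥0∞) (f u : Euc N → ℝ),
        IsAdmissibleOperator (Metric.ball (0 : Euc N) 1) 2 θ a ∧
        IsStrictlyMonotone (Metric.ball (0 : Euc N) 1) a ∧
        IsAdmissibleSource γ₂ h ∧
        (∀ᵐ x ∂(volume.restrict (Metric.ball (0 : Euc N) 1)), 0 ≤ f x) ∧
        MemLp f (ENNReal.ofReal m) (volume.restrict (Metric.ball (0 : Euc N) 1)) ∧
        IsEntropySolution (Metric.ball (0 : Euc N) 1) 2 a h f u ∧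
        ¬ IsDistributionalSolution (Metric.ball (0 : Euc N) 1) a h f u) := by
  refine ⟨fun N Ω p θ γ₂ m a h f u _ hΩ hΩb hp hpN hγ hθ hθ1 ha hh hf0 hf hm hm' hu =>
    hu.isDistributionalSolution_of_threshold_le hΩ hΩb hp hpN hγ hθ hθ1 ha hh hf0 hf hm hm',
    fun N p θ γ₂ _ hp hpN _ _ hθ1 => threshold_eq_one_iff hp hpN hθ1,
    fun N θ γ₂ ε hN hγ hθ hθ1 hε hεN => radial_example hN hγ hθ hθ1 hε hεN,
    fun N θ γ₂ m hN hγ hθ hθ1 hm hm' => exists_entropy_not_distributional hN hγ hθ hθ1 hm hm'⟩
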